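/- **Setting.** For a law $\mu$ of a random row vector $\mathbf c\in[0,1]^n$ put $\Sigma=\mathbb E[\mathbf c^{\mathsf T}\mathbf c]$, let $\xi>0$ be the smallest nonzero eigenvalue of $\Sigma$, and call a vector *visible* if it lies in the range of $\Sigma$ (every vector is visible if $\Sigma$ is nonsingular). Let $M\ge 1$, $\tau_e,\varepsilon>0$, $\delta\in(0,1)$. A sample of size $m$ of a target $f=(f_1,\dots,f_M)$ consists of i.i.d. challenges $\mathbf c_1,\dots,\mathbf c_m$ and responses $r_{ik}=f_k(\mathbf c_i)+e_{ik}$, where for each pixel $k$ the noises $e_{1k},\dots,e_{mk}$ are independent of each other and of the challenges, and $\tau_e$-subgaussian: $\mathbb E[\exp(te_{ik})]\le\exp(\tau_e^2t^2/2)$ for all $t\in\mathbb R$. (Different pixels need not be independent.) Let $\mathbf C$ be the $m\times n$ matrix with rows $\mathbf c_i$ and $\mathbf r_k=(r_{1k},\dots,r_{mk})$. Put $$m_*=\max\left\{\frac{8n}{\xi}\ln\frac{2Mn}{\delta},\ \frac{4n^2\tau_e^2}{\varepsilon^2\xi}\ln\frac{4Mn}{\delta}\right\}.$$ **1. Accuracy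 of least squares.** Let $f_k(\mathbf c)=\langle\mathbf c,\mathbf s_k\rangle$ with arbitrary $\mathbf s_k\in\mathbb R^n$. Then $\mu$-almost every $\mathbf c$ is visible. Let $\mathbf O$ be orthogonal with $\mathbf O^{\mathsf T}\Sigma\mathbf O=\operatorname{diag}(\lambda_1,\dots,\lambda_n)$ and let $\tilde{\mathbf C}$ consist of the columns $j$ of $\mathbf C\mathbf O$ with $\lambda_j\ne0$. If $m\ge m_*$, then with probability at least $1-\delta$ the matrix $\tilde{\mathbf C}^{\mathsf T}\tilde{\mathbf C}$ is invertible and, simultaneously for all $k\le M$ and all visible $\mathbf c\in[0,1]^n$, $$|\langle\mathbf c,\hat{\mathbf s}_k\rangle-\langle\mathbf c,\mathbf s_k\rangle|\le\varepsilon$$ for every $\hat{\mathbf s}_k\in\mathbb R^n$ such that the components of $\mathbf O^{\mathsf T}\hat{\mathbf s}_k$ with $\lambda_j\neq0$ are those of $(\tilde{\mathbf C}^{\mathsf T}\tilde{\mathbf C})^{-1}\tilde{\mathbf C}^{\mathsf T}\mathbf r_k$ (the others being arbitrary), and for every $\hat{\mathbf s}_k$ that minimizes $\|\mathbf C\mathbf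 x-\mathbf r_k\|$ over $\mathbf x\in\mathbb R^n$. **2. Linear optical PUF.** A PUF with $N$ mask pixels, $M$ detector pixels and a linear medium has complex transmission coefficients $t_{kj}$ and maps a mask $\mathbf b\in[0,1]^N$ to the intensities $f_k(\mathbf b)=\left|\sum_{j=1}^N b_jt_{kj}\right|^2$, $k\le M$. Let $\mathbf c=\mathbf c(\mathbf b)\in[0,1]^n$ list distinct monomials of degree at most $2$ in $b_1,\dots,b_N$, among them the constant $1$ and all monomials of degree $2$ (so $n=O(N^2)$). Let the masks be i.i.d. with any law on $[0,1]^N$, and let $\xi$ and visibility refer to the induced law of $\mathbf c$. There is a single algorithm, a program for a unit-cost real random access machine, that from any $\mathbf C$ and $\mathbf r_1,\dots,\mathbf r_M$ computes for every $k$ a minimizer $\hat{\mathbf s}_k$ of $\|\mathbf C\mathbf x-\mathbf r_k\|$, and for which the following holds. (a) If $m\ge m_*$ (and $N\ge2$), then with probability at least $1-\delta$ we have $|\langle\mathbf c(\mathbf b),\hat{\mathbf s}_k\rangle-f_k(\mathbf b)|\le\varepsilon$ simultaneously for all $k\le M$ and all $\mathbf b\in[0,1]^N$ with $\mathbf c(\mathbf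 b)$ visible. (b) For every $\kappa>0$ there is a constant $K$, depending only on $\kappa$, such that for all $N\ge2$, $M\geq 1$ and all values of the other parameters: if $\varepsilon\le\kappa N\tau_e$, then $$\lceil m_*\rceil\le K\,\frac{N^4\tau_e^2}{\varepsilon^2\xi}\ln\frac{MN^2}{\delta};$$ if $\varepsilon\le\kappa\tau_e$, then the running time for all $M$ pixels together on $m=\lceil m_*\rceil$ samples is at most $$K\,\frac{(N^8+MN^6)\,\tau_e^2}{\varepsilon^2\xi}\ln\frac{MN^2}{\delta},$$ and, if moreover $M\le\kappa N^2$, at most $K\,\frac{N^8\tau_e^2}{\varepsilon^2\xi}\ln\frac{MN^2}{\delta}$. (c) The algorithm is an efficient PAC learner of linear optical PUFs, with the largest prediction error over the visible challenges as the risk: there is a polynomial $Q$ such that for all $N,M\ge0$, $\varepsilon,\tau_e,\xi>0$ and $\delta\in(0,1)$ some number $m\le Q(N,M,1/\varepsilon,1/\delta,\tau_e,1/\xi)$ of samples suffices for the conclusion of (a), for every PUF, every list of monomials, every law of the masks with smallest nonzero eigenvalue $\xi$ and every $\tau_e$-subgaussian noise, and the running time on $m$ samples is at most $Q(N,M,1/\varepsilon,1/\delta,\tau_e,1/\xi)$.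 -/

import Mathlib

open MeasureTheory ProbabilityTheory Matrix
open scoped ENNReal

universe u

noncomputable section

namespace PUF

/-! ### Linear regression -/

/-- The set `[0,1]^ι`. -/
def cube (ι : Type*) : Set (ι → ℝ) := {c | ∀ i, 0 ≤ c i ∧ c i ≤ 1}

/-- `E[cᵀ c]` for a random row vector `c` with the given law. -/
def secondMoment {n : ℕ} (law : Measure (Fin n → ℝ)) : Matrix (Fin n) (Fin n) ℝ :=
  Matrix.of fun i j => ∫ c, c i * c j ∂law

/-- `ξ` is the smallest nonzero eigenvalue of `A`. -/
def IsSmallestNonzeroEigenvalue {n : ℕ} (A : Matrix (Fin n) (Fin n) ℝ) (ξ : ℝ) : Prop :=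
  IsLeast {l : ℝ | l ≠ 0 ∧ Module.End.HasEigenvalue (Matrix.toLin' A) l} ξ

/-- The vectors orthogonal to the kernel of the (symmetric) second moment matrix, described as its
range: everything if that matrix is nonsingular. -/
def visible {n : ℕ} (law : Measure (Fin n → ℝ)) : Set (Fin n → ℝ) :=
  {c | c ∈ LinearMap.range (Matrix.toLin' (secondMoment law))}

/-- `x` minimizes the sum of squared residuals of `C x = r`. -/
def IsLeastSquares {m n : ℕ} (C : Matrix (Fin m) (Fin n) ℝ) (r : Fin m → ℝ)
    (x : Fin n → ℝ) : Prop :=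
  ∀ y : Fin n → ℝ, ∑ i, ((C *ᵥ x) i - r i) ^ 2 ≤ ∑ i, ((C *ᵥ y) i - r i) ^ 2

/-- `C̃`: the columns of `C P` that belong to the nonzero entries of `lam`. -/
def reduced {m n : ℕ} (C : Matrix (Fin m) (Fin n) ℝ) (P : Matrix (Fin n) (Fin n) ℝ)
    (lam : Fin n → ℝ) : Matrix (Fin m) {j : Fin n // lam j ≠ 0} ℝ :=
  (C * P).submatrix id Subtype.val

/-- `x` is a reduced least-squares estimate: the components of `Pᵀ x` with `lam j ≠ 0` are those of
`(C̃ᵀ C̃)⁻¹ C̃ᵀ r`, and the other components are arbitrary. -/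
def IsReducedEstimate {m n : ℕ} (C : Matrix (Fin m) (Fin n) ℝ) (P : Matrix (Fin n) (Fin n) ℝ)
    (lam : Fin n → ℝ) (r : Fin m → ℝ) (x : Fin n → ℝ) : Prop :=
  ∀ j : {j : Fin n // lam j ≠ 0}, (Pᵀ *ᵥ x) j =
    (((reduced C P lam)ᵀ * reduced C P lam)⁻¹ *ᵥ ((reduced C P lam)ᵀ *ᵥ r)) j

/-- Noisy challenge-response pairs `(x i, r i)`, `i < m`, of a target `f` with `M` output pixels:
i.i.d. challenges, and in each pixel a noise that is independent over `i`, independent of the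
challenges, and `τ`-subgaussian (`E exp(t e) ≤ exp(τ² t² / 2)` for all real `t`). No independence
between different pixels is required. -/
structure IsSample {Ω : Type*} [MeasurableSpace Ω] (P : Measure Ω) {X : Type*} [MeasurableSpace X]
    {m M : ℕ} (law : Measure X) (f : X → Fin M → ℝ) (τ : ℝ)
    (x : Fin m → Ω → X) (r : Fin m → Ω → Fin M → ℝ) : Prop where
  hasLaw : ∀ i, HasLaw (x i) law P
  indep : iIndepFun x P
  noise_subgaussian : ∀ i k,
    HasSubgaussianMGF (fun ω => r i ω k - f (x i ω) k) (Real.toNNReal (τ ^ 2)) P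
  noise_indep : ∀ k, iIndepFun (fun i ω => r i ω k - f (x i ω) k) P
  noise_indep_challenge : ∀ k,
    IndepFun (fun ω i => x i ω) (fun ω i => r i ω k - f (x i ω) k) P

/-- The number of challenge-response pairs that is claimed to suffice. -/
def sampleBound (n M : ℕ) (ξ τ ε δ : ℝ) : ℝ :=
  max (8 * n / ξ * Real.log (2 * M * n / δ))
    (4 * n ^ 2 * τ ^ 2 / (ε ^ 2 * ξ) * Real.log (4 * M * n / δ))

/-! ### The optical PUF with a linear medium -/

/-- The intensity `|∑ j, b_j t_j|²` at detector pixel `k` for the mask `b`, where row `k` of `T`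
holds the complex transmission coefficients to that pixel. -/
def intensity {N M : ℕ} (T : Matrix (Fin M) (Fin N) ℂ) (b : Fin N → ℝ) (k : Fin M) : ℝ :=
  ‖∑ j, (b j : ℂ) * T k j‖ ^ 2

/-- The exponents `α 0, …, α (n-1)` list monomials of degree at most two in `N` variables, without
repetition, among them the constant and all monomials of degree two. -/
structure IsQuadraticFeatures {N n : ℕ} (α : Fin n → Fin N → ℕ) : Prop where
  injective : Function.Injective α
  degree_le : ∀ i, ∑ j, α i j ≤ 2
  constant : ∃ i, α i = 0
  quadratic : ∀ a : Fin N → ℕ, ∑ j, a j = 2 → ∃ i, α i = a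

/-- The feature vector `c` of a mask `b`: the values of the listed monomials at `b`. -/
def features {N n : ℕ} (α : Fin n → Fin N → ℕ) (b : Fin N → ℝ) : Fin n → ℝ :=
  fun i => ∏ j, b j ^ α i j

/-! ### A real random access machine with unit cost -/

/-- Natural-number registers, and real arrays addressed by a name, a row and a column. -/
structure State where
  reg : ℕ → ℕ
  mem : ℕ → ℕ → ℕ → ℝ

/-- A reference to an array entry: the array's name, and the registers that hold row and column. -/
structure Cell where
  arr : ℕ
  row : ℕ
  col : ℕ

def State.get (σ : State) (c : Cell) : ℝ := σ.mem c.arr (σ.reg c.row) (σ.reg c.col)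

def State.set (σ : State) (c : Cell) (v : ℝ) : State where
  reg := σ.reg
  mem := fun a i j =>
    if a = c.arr ∧ i = σ.reg c.row ∧ j = σ.reg c.col then v else σ.mem a i j

def State.setReg (σ : State) (x v : ℕ) : State where
  reg := fun y => if y = x then v else σ.reg y
  mem := σ.mem

/-- The real arithmetic operations. -/
inductive Op
  | add
  | sub
  | mul
  | div

def Op.eval : Op → ℝ → ℝ → ℝ
  | .add, a, b => a + b
  | .sub, a, b => a - b
  | .mul, a, b => a * b
  | .div, a, b => a / b

/-- Programs. `loop x y p` runs `p` for `x = 0, 1, …, v - 1`, where `v` is the content of register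
`y` on entry. -/
inductive Program
  | skip
  | seq (p q : Program)
  | regZero (x : ℕ)
  | regSucc (x : ℕ)
  | regCopy (x y : ℕ)
  | zero (c : Cell)
  | one (c : Cell)
  | arith (op : Op) (dst a b : Cell)
  | ifRegEq (x y : ℕ) (p q : Program)
  | ifLe (a b : Cell) (p q : Program)
  | loop (x y : ℕ) (p : Program)

open Classical in
/-- The final state and the number of steps. Every instruction, every test and every pass of a loop
costs one step, in addition to the cost of the commands that it executes. -/
def Program.run : Program → State → State × ℕ
  | .skip, σ => (σ, 1)
  | .seq p q, σ => ((q.run (p.run σ).1).1, (p.run σ).2 + (q.run (p.run σ).1).2)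
  | .regZero x, σ => (σ.setReg x 0, 1)
  | .regSucc x, σ => (σ.setReg x (σ.reg x + 1), 1)
  | .regCopy x y, σ => (σ.setReg x (σ.reg y), 1)
  | .zero c, σ => (σ.set c 0, 1)
  | .one c, σ => (σ.set c 1, 1)
  | .arith op dst a b, σ => (σ.set dst (op.eval (σ.get a) (σ.get b)), 1)
  | .ifRegEq x y p q, σ =>
      if σ.reg x = σ.reg y then ((p.run σ).1, (p.run σ).2 + 1)
      else ((q.run σ).1, (q.run σ).2 + 1)
  | .ifLe a b p q, σ =>
      if σ.get a ≤ σ.get b then ((p.run σ).1, (p.run σ).2 + 1)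
      else ((q.run σ).1, (q.run σ).2 + 1)
  | .loop x y p, σ =>
      Nat.rec (σ, 1)
        (fun k acc => ((p.run (acc.1.setReg x k)).1, acc.2 + (p.run (acc.1.setReg x k)).2 + 1))
        (σ.reg y)

/-- The initial state: `n`, `m`, `M` in registers 0, 1, 2, the `m × n` challenge matrix in array 0,
the `m × M` matrix of responses in array 1, and zero everywhere else. -/
def inputState {m n M : ℕ} (C : Matrix (Fin m) (Fin n) ℝ) (R : Matrix (Fin m) (Fin M) ℝ) :
    State where
  reg := fun x => if x = 0 then n else if x = 1 then m else if x = 2 then M else 0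
  mem := fun a i j =>
    if a = 0 then (if h : i < m ∧ j < n then C ⟨i, h.1⟩ ⟨j, h.2⟩ else 0)
    else if a = 1 then (if h : i < m ∧ j < M then R ⟨i, h.1⟩ ⟨j, h.2⟩ else 0)
    else 0

/-- The running time on the given input. -/
def Program.steps (p : Program) {m n M : ℕ} (C : Matrix (Fin m) (Fin n) ℝ)
    (R : Matrix (Fin m) (Fin M) ℝ) : ℕ :=
  (p.run (inputState C R)).2

/-- The output: for each pixel `k`, a coefficient vector, read from column `k` of array 2. -/
def Program.output (p : Program) {m n M : ℕ} (C : Matrix (Fin m) (Fin n) ℝ)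
    (R : Matrix (Fin m) (Fin M) ℝ) (k : Fin M) : Fin n → ℝ :=
  fun i => (p.run (inputState C R)).1.mem 2 i k

/-! ### Learning the PUF -/

/-- From `m` noisy challenge-response pairs of the PUF `T` with i.i.d. masks of law `ν`, the program
`p` finds, with probability at least `1 - δ`, coefficient vectors that predict the responses to all
challenges within `ε`, simultaneously on all pixels. Challenges are the masks in `[0,1]^N` whose
feature vector is visible under the law. -/
def Learns (p : Program) {N M n : ℕ} (α : Fin n → Fin N → ℕ) (ν : Measure (Fin N → ℝ))
    (T : Matrix (Fin M) (Fin N) ℂ) (τ ε δ : ℝ) (m : ℕ) : Prop :=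
  ∀ (Ω : Type u) [MeasurableSpace Ω] (P : Measure Ω) [IsProbabilityMeasure P]
    (b : Fin m → Ω → Fin N → ℝ) (r : Fin m → Ω → Fin M → ℝ),
    IsSample P ν (intensity T) τ b r →
    ∃ E : Set Ω, MeasurableSet E ∧ ENNReal.ofReal (1 - δ) ≤ P E ∧
      ∀ ω ∈ E, ∀ x ∈ cube (Fin N), features α x ∈ visible (ν.map (features α)) → ∀ k,
        |features α x ⬝ᵥ p.output (Matrix.of fun i => features α (b i ω))
            (Matrix.of fun i => r i ω) k - intensity T x k| ≤ ε

/-- `p` is an efficient PAC learner for linear optical PUFs: a number of samples and a running time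
that are polynomial in `N`, `M`, `1/ε`, `1/δ`, `τ`, `1/ξ` suffice, for all PUFs, all laws of the
masks with smallest nonzero eigenvalue `ξ`, and all `τ`-subgaussian noises. -/
def IsEfficientPACLearner (p : Program) : Prop :=
  ∃ Q : MvPolynomial (Fin 6) ℝ, ∀ (N M : ℕ) (ε δ τ ξ : ℝ),
    0 < ε → 0 < δ → δ < 1 → 0 < τ → 0 < ξ →
    ∃ m : ℕ, (m : ℝ) ≤ MvPolynomial.eval ![(N : ℝ), (M : ℝ), 1 / ε, 1 / δ, τ, 1 / ξ] Q ∧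
      ∀ (n : ℕ) (α : Fin n → Fin N → ℕ), IsQuadraticFeatures α →
        (∀ (C : Matrix (Fin m) (Fin n) ℝ) (R : Matrix (Fin m) (Fin M) ℝ),
          (p.steps C R : ℝ) ≤
            MvPolynomial.eval ![(N : ℝ), (M : ℝ), 1 / ε, 1 / δ, τ, 1 / ξ] Q) ∧
        ∀ (ν : Measure (Fin N → ℝ)) [IsProbabilityMeasure ν], (∀ᵐ b ∂ν, b ∈ cube (Fin N)) →
          IsSmallestNonzeroEigenvalue (secondMoment (ν.map (features α))) ξ →
          ∀ T : Matrix (Fin M) (Fin N) ℂ, Learns.{u} p α ν T τ ε δ m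

end PUF

end

namespace PUF

section TraceExp

variable {ι : Type*} [Fintype ι] [DecidableEq ι]

theorem exists_orthogonal_diagonalization {A : Matrix ι ι ℝ} (hA : A.IsHermitian) :
    ∃ (U : Matrix ι ι ℝ) (d : ι → ℝ), U * Uᵀ = 1 ∧ Uᵀ * U = 1 ∧ A = U * diagonal d * Uᵀ := by
  refine ⟨hA.eigenvectorUnitary, hA.eigenvalues, ?_, ?_, ?_⟩
  · have := Unitary.coe_mul_star_self hA.eigenvectorUnitary
    rwa [Unitary.coe_star, star_eq_conjTranspose, conjTranspose_eq_transpose_of_trivial] at this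
  · have := Unitary.coe_star_mul_self hA.eigenvectorUnitary
    rwa [star_eq_conjTranspose, conjTranspose_eq_transpose_of_trivial] at this
  · have := hA.spectral_theorem
    rw [Unitary.conjStarAlgAut_apply, star_eq_conjTranspose,
      conjTranspose_eq_transpose_of_trivial] at this
    exact this

theorem exp_orthogonal_conj {U : Matrix ι ι ℝ} (hU : U * Uᵀ = 1) (d : ι → ℝ) :
    NormedSpace.exp (U * diagonal d * Uᵀ) = U * diagonal (fun i => Real.exp (d i)) * Uᵀ := by
  have hinv : U⁻¹ = Uᵀ := inv_eq_right_inv hU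
  have hunit : IsUnit U := (isUnit_iff_isUnit_det U).2 (isUnit_det_of_right_inverse hU)
  rw [← hinv, exp_conj _ _ hunit, exp_diagonal]
  congr 3
  ext i
  rw [Pi.coe_exp, Real.exp_eq_exp_ℝ]

theorem trace_conj_mul_conj {U V : Matrix ι ι ℝ} (f g : ι → ℝ) :
    trace ((U * diagonal f * Uᵀ) * (V * diagonal g * Vᵀ)) =
      ∑ i, ∑ j, f i * g j * ((Uᵀ * V) i j) ^ 2 := by
  have h : trace ((U * diagonal f * Uᵀ) * (V * diagonal g * Vᵀ)) =
      trace ((diagonal f * (Uᵀ * V)) * (diagonal g * (Uᵀ * V)ᵀ)) := by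
    rw [transpose_mul, transpose_transpose]
    calc _ = trace (U * (diagonal f * Uᵀ * V * diagonal g * Vᵀ)) := by simp only [Matrix.mul_assoc]
      _ = _ := by rw [trace_mul_comm]; simp only [Matrix.mul_assoc]
  rw [h, trace]
  refine Finset.sum_congr rfl fun i _ => ?_
  simp only [diag_apply, Matrix.mul_apply (M := diagonal f * (Uᵀ * V)), diagonal_mul, transpose_apply]
  refine Finset.sum_congr rfl fun j _ => ?_
  ring

/-- **Klein's inequality** for the exponential. -/
theorem trace_exp_add_le {X Y : Matrix ι ι ℝ} (hX : X.IsHermitian) (hY : Y.IsHermitian) :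
    trace (NormedSpace.exp Y) + trace ((X - Y) * NormedSpace.exp Y) ≤
      trace (NormedSpace.exp X) := by
  obtain ⟨U, x, hU, hU', rfl⟩ := exists_orthogonal_diagonalization hX
  obtain ⟨V, y, hV, hV', rfl⟩ := exists_orthogonal_diagonalization hY
  rw [exp_orthogonal_conj hU, exp_orthogonal_conj hV]
  have e1 : trace (U * diagonal (fun i => Real.exp (x i)) * Uᵀ) =
      ∑ i, ∑ j, Real.exp (x i) * 1 * ((Uᵀ * V) i j) ^ 2 := by
    rw [← trace_conj_mul_conj, show diagonal (fun _ : ι => (1 : ℝ)) = 1 from diagonal_one,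
      Matrix.mul_one V, hV, Matrix.mul_one]
  have e2 : trace (V * diagonal (fun i => Real.exp (y i)) * Vᵀ) =
      ∑ i, ∑ j, 1 * Real.exp (y j) * ((Uᵀ * V) i j) ^ 2 := by
    rw [← trace_conj_mul_conj, show diagonal (fun _ : ι => (1 : ℝ)) = 1 from diagonal_one,
      Matrix.mul_one U, hU, Matrix.one_mul]
  have e3 : trace (V * diagonal y * Vᵀ * (V * diagonal (fun i => Real.exp (y i)) * Vᵀ)) =
      ∑ i, ∑ j, 1 * (y j * Real.exp (y j)) * ((Uᵀ * V) i j) ^ 2 := by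
    rw [← trace_conj_mul_conj, show diagonal (fun _ : ι => (1 : ℝ)) = 1 from diagonal_one,
      Matrix.mul_one U, hU, Matrix.one_mul]
    congr 1
    calc _ = V * diagonal y * (Vᵀ * V) * diagonal (fun i => Real.exp (y i)) * Vᵀ := by
          simp only [Matrix.mul_assoc]
      _ = _ := by
          rw [hV', Matrix.mul_one, Matrix.mul_assoc V, diagonal_mul_diagonal]
  rw [sub_mul, trace_sub, trace_conj_mul_conj, e1, e2, e3, ← Finset.sum_sub_distrib,
    ← Finset.sum_add_distrib]
  refine Finset.sum_le_sum fun i _ => ?_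
  rw [← Finset.sum_sub_distrib, ← Finset.sum_add_distrib]
  refine Finset.sum_le_sum fun j _ => ?_
  have h1 := Real.add_one_le_exp (x i - y j)
  have h2 : Real.exp (x i) = Real.exp (x i - y j) * Real.exp (y j) := by
    rw [← Real.exp_add]; congr 1; ring
  have h3 : 0 ≤ ((Uᵀ * V) i j) ^ 2 := sq_nonneg _
  have h4 : Real.exp (y j) + (x i - y j) * Real.exp (y j) ≤ Real.exp (x i) := by
    rw [h2]; nlinarith [Real.exp_pos (y j)]
  nlinarith

theorem hasSum_dotProduct_exp (A : Matrix ι ι ℝ) (p q : ι → ℝ) :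
    HasSum (fun k : ℕ => (p ⬝ᵥ (A ^ k) *ᵥ q) / k.factorial)
      (p ⬝ᵥ NormedSpace.exp A *ᵥ q) := by
  have h : HasSum (fun k : ℕ => ((k.factorial : ℝ)⁻¹) • A ^ k) (NormedSpace.exp A) := by
    open scoped Norms.Operator in exact NormedSpace.exp_series_hasSum_exp' (𝕂 := ℝ) A
  let φ : Matrix ι ι ℝ →ₗ[ℝ] ℝ :=
    { toFun := fun B => p ⬝ᵥ B *ᵥ q
      map_add' := fun B C => by rw [add_mulVec, dotProduct_add]
      map_smul' := fun c B => by simp [smul_mulVec, dotProduct_smul] }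
  have hφ : Continuous φ := φ.continuous_of_finiteDimensional
  have h' : HasSum (fun k : ℕ => φ (((k.factorial : ℝ)⁻¹) • A ^ k)) (φ (NormedSpace.exp A)) :=
    h.map φ hφ
  have hk : ∀ k : ℕ, φ (((k.factorial : ℝ)⁻¹) • A ^ k) = (p ⬝ᵥ (A ^ k) *ᵥ q) / k.factorial := by
    intro k
    rw [map_smul, smul_eq_mul, div_eq_inv_mul]
    rfl
  simp only [hk] at h'
  exact h'

theorem dotProduct_pow_mul_add_pow_le {D : Matrix ι ι ℝ} (hD : D.PosSemidef) {s : ℝ} (hs : 0 ≤ s)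
    (b : ι → ℝ) (i j : ℕ) :
    b ⬝ᵥ (D ^ (i + j)) *ᵥ b ≤ b ⬝ᵥ (D ^ i * (D + s • 1) ^ j) *ᵥ b := by
  induction j generalizing i with
  | zero => simp
  | succ j ih =>
    have h : D ^ i * (D + s • 1) ^ (j + 1) =
        D ^ (i + 1) * (D + s • 1) ^ j + s • (D ^ i * (D + s • 1) ^ j) := by
      rw [pow_succ' (D + s • 1), add_mul, mul_add, pow_succ, Matrix.mul_assoc]
      simp
    rw [h, add_mulVec, dotProduct_add, smul_mulVec, dotProduct_smul, smul_eq_mul]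
    have h1 := ih (i + 1)
    have h2 := ih i
    have h3 : 0 ≤ b ⬝ᵥ (D ^ (i + j)) *ᵥ b := by
      simpa using (hD.pow (i + j)).dotProduct_mulVec_nonneg b
    rw [show i + (j + 1) = i + 1 + j by ring]
    nlinarith

theorem compression_mulVec {A : Matrix ι ι ℝ} {p y : ι → ℝ}
    (hy : p ⬝ᵥ y = 0) :
    ((1 - vecMulVec p p) * A * (1 - vecMulVec p p)) *ᵥ y =
      A *ᵥ y - (p ⬝ᵥ A *ᵥ y) • p := by
  have h : (1 - vecMulVec p p) *ᵥ y = y := by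
    rw [sub_mulVec, one_mulVec, vecMulVec_mulVec, hy]; simp
  rw [← mulVec_mulVec, ← mulVec_mulVec, h, sub_mulVec, one_mulVec, vecMulVec_mulVec]
  simp

theorem moment_mono {A : Matrix ι ι ℝ} (hA : A.PosSemidef) {p : ι → ℝ} (hp : p ⬝ᵥ p = 1)
    {s : ℝ} (hs : 0 ≤ s) (k : ℕ) :
    p ⬝ᵥ (A ^ k) *ᵥ p ≤ p ⬝ᵥ ((A + s • (1 - vecMulVec p p)) ^ k) *ᵥ p := by
  set Q : Matrix ι ι ℝ := 1 - vecMulVec p p with hQ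
  have hQs : Qᴴ = Q := by
    simp [hQ, conjTranspose_eq_transpose_of_trivial, transpose_sub]
  set D := Q * A * Q with hD
  have hDpsd : D.PosSemidef := by
    have := hA.conjTranspose_mul_mul_same Q
    rwa [hQs] at this
  have hAt : Aᵀ = A := by
    simpa [conjTranspose_eq_transpose_of_trivial] using hA.isHermitian.eq
  set a := p ⬝ᵥ A *ᵥ p with ha
  have ha0 : 0 ≤ a := by simpa using hA.dotProduct_mulVec_nonneg p
  set b := A *ᵥ p - a • p with hb
  have hpb : p ⬝ᵥ b = 0 := by
    rw [hb, dotProduct_sub, dotProduct_smul, hp]; simp [ha]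
  have hAp : A *ᵥ p = a • p + b := by rw [hb]; abel
  have hpA : ∀ y, p ⬝ᵥ y = 0 → p ⬝ᵥ A *ᵥ y = b ⬝ᵥ y := by
    intro y hy
    rw [dotProduct_mulVec, ← mulVec_transpose, hAt, hAp, add_dotProduct, smul_dotProduct, hy]
    simp
  have hQp : Q *ᵥ p = 0 := by
    rw [hQ, sub_mulVec, one_mulVec, vecMulVec_mulVec, hp]; simp
  have hQy : ∀ y, p ⬝ᵥ y = 0 → Q *ᵥ y = y := by
    intro y hy
    rw [hQ, sub_mulVec, one_mulVec, vecMulVec_mulVec, hy]; simp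
  have hDy : ∀ y, p ⬝ᵥ y = 0 → A *ᵥ y = (b ⬝ᵥ y) • p + D *ᵥ y := by
    intro y hy
    rw [hD, hQ, compression_mulVec hy, hpA y hy]; abel
  have hpD : ∀ y, p ⬝ᵥ y = 0 → p ⬝ᵥ D *ᵥ y = 0 := by
    intro y hy
    rw [hD, hQ, compression_mulVec hy, dotProduct_sub, dotProduct_smul, hp]; simp
  have key : ∀ t : ℝ, ∀ k : ℕ,
      (p ⬝ᵥ ((A + t • Q) ^ (k + 1)) *ᵥ p = a * (p ⬝ᵥ ((A + t • Q) ^ k) *ᵥ p) +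
        p ⬝ᵥ ((A + t • Q) ^ k) *ᵥ ((D + t • 1) ^ 0 *ᵥ b)) ∧
      ∀ j : ℕ, p ⬝ᵥ ((A + t • Q) ^ (k + 1)) *ᵥ ((D + t • 1) ^ j *ᵥ b) =
        (b ⬝ᵥ (D + t • 1) ^ j *ᵥ b) * (p ⬝ᵥ ((A + t • Q) ^ k) *ᵥ p) +
        p ⬝ᵥ ((A + t • Q) ^ k) *ᵥ ((D + t • 1) ^ (j + 1) *ᵥ b) := by
    intro t k
    constructor
    · rw [pow_succ, ← mulVec_mulVec, add_mulVec, smul_mulVec, hQp, smul_zero, add_zero, hAp,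
        mulVec_add, dotProduct_add, mulVec_smul, dotProduct_smul, pow_zero, one_mulVec, smul_eq_mul]
    · intro j
      have horth : ∀ j, p ⬝ᵥ ((D + t • 1) ^ j *ᵥ b) = 0 := by
        intro j
        induction j with
        | zero => simpa using hpb
        | succ j ih =>
          rw [pow_succ', ← mulVec_mulVec, add_mulVec, dotProduct_add, hpD _ ih, smul_mulVec,
            one_mulVec, dotProduct_smul, ih]
          simp
      rw [pow_succ, ← mulVec_mulVec, add_mulVec, smul_mulVec, hQy _ (horth j), hDy _ (horth j),
        add_assoc, mulVec_add, dotProduct_add, mulVec_smul, dotProduct_smul, smul_eq_mul,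
        pow_succ' (D + t • 1), ← mulVec_mulVec _ (D + t • 1), add_mulVec D,
        smul_mulVec _ (1 : Matrix ι ι ℝ), one_mulVec]
  have main : ∀ k : ℕ,
      (0 ≤ p ⬝ᵥ (A ^ k) *ᵥ p ∧
        p ⬝ᵥ (A ^ k) *ᵥ p ≤ p ⬝ᵥ ((A + s • Q) ^ k) *ᵥ p) ∧
      ∀ j : ℕ, 0 ≤ p ⬝ᵥ (A ^ k) *ᵥ (D ^ j *ᵥ b) ∧
        p ⬝ᵥ (A ^ k) *ᵥ (D ^ j *ᵥ b) ≤
          p ⬝ᵥ ((A + s • Q) ^ k) *ᵥ ((D + s • 1) ^ j *ᵥ b) := by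
    have key0 := key 0
    simp only [zero_smul, add_zero] at key0
    have horth : ∀ (t : ℝ) j, p ⬝ᵥ ((D + t • 1) ^ j *ᵥ b) = 0 := by
      intro t j
      induction j with
      | zero => simpa using hpb
      | succ j ih =>
        rw [pow_succ', ← mulVec_mulVec, add_mulVec, dotProduct_add, hpD _ ih, smul_mulVec,
          one_mulVec, dotProduct_smul, ih]
        simp
    intro k
    induction k with
    | zero =>
      refine ⟨by simp [hp], fun j => ?_⟩
      have h0 := horth 0 j
      rw [zero_smul, add_zero] at h0
      simp [horth s j, h0]
    | succ k ih =>
      obtain ⟨⟨h0, h1⟩, h2⟩ := ih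
      refine ⟨?_, fun j => ?_⟩
      · rw [(key0 k).1, (key s k).1]
        obtain ⟨h3, h4⟩ := h2 0
        exact ⟨by positivity, by gcongr⟩
      · rw [(key0 k).2 j, (key s k).2 j]
        obtain ⟨h3, h4⟩ := h2 (j + 1)
        have h5 := dotProduct_pow_mul_add_pow_le hDpsd hs b 0 j
        rw [zero_add, pow_zero, Matrix.one_mul] at h5
        have h6 : 0 ≤ b ⬝ᵥ (D ^ j) *ᵥ b := by
          simpa using (hDpsd.pow j).dotProduct_mulVec_nonneg b
        exact ⟨by positivity, by gcongr; exact h6.trans h5⟩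
  exact (main k).1.2

theorem exp_add_smul_one (A : Matrix ι ι ℝ) (c : ℝ) :
    NormedSpace.exp (A + c • (1 : Matrix ι ι ℝ)) = Real.exp c • NormedSpace.exp A := by
  have hc : NormedSpace.exp (c • (1 : Matrix ι ι ℝ)) = Real.exp c • (1 : Matrix ι ι ℝ) := by
    rw [← diagonal_one, ← diagonal_smul, exp_diagonal, ← diagonal_smul]
    congr 1
    ext i
    rw [Pi.coe_exp, ← Real.exp_eq_exp_ℝ]
    simp
  rw [exp_add_of_commute _ _ ((Commute.one_right A).smul_right c), hc]
  simp

theorem exists_posSemidef_add_smul_one {A : Matrix ι ι ℝ} (hA : A.IsHermitian) :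
    ∃ c : ℝ, (A + c • (1 : Matrix ι ι ℝ)).PosSemidef := by
  obtain ⟨U, d, hU, hU', rfl⟩ := exists_orthogonal_diagonalization hA
  refine ⟨∑ i, |d i|, ?_⟩
  have h : U * diagonal d * Uᵀ + (∑ i, |d i|) • (1 : Matrix ι ι ℝ) =
      U * diagonal (fun i => d i + ∑ i, |d i|) * Uᴴ := by
    rw [conjTranspose_eq_transpose_of_trivial, ← diagonal_add, Matrix.mul_add, Matrix.add_mul]
    congr 1
    rw [show (diagonal fun _ : ι => ∑ i, |d i|) = (∑ i, |d i|) • (1 : Matrix ι ι ℝ) by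
      ext; simp [diagonal_apply, one_apply], Matrix.mul_smul, Matrix.smul_mul, Matrix.mul_one, hU]
  rw [h]
  refine (PosSemidef.diagonal fun i => ?_).mul_mul_conjTranspose_same U
  have := Finset.single_le_sum (f := fun i => |d i|) (fun i _ => abs_nonneg _) (Finset.mem_univ i)
  have h2 := neg_abs_le (d i)
  simp only [Pi.zero_apply] at *
  linarith

theorem dotProduct_exp_mono {A : Matrix ι ι ℝ} (hA : A.IsHermitian) {p : ι → ℝ}
    (hp : p ⬝ᵥ p = 1) {s : ℝ} (hs : 0 ≤ s) :
    Real.exp (-s) * (p ⬝ᵥ NormedSpace.exp A *ᵥ p) ≤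
      p ⬝ᵥ NormedSpace.exp (A - s • vecMulVec p p) *ᵥ p := by
  obtain ⟨c, hc⟩ := exists_posSemidef_add_smul_one hA
  have h := hasSum_le (fun k => div_le_div_of_nonneg_right (moment_mono hc hp hs k)
    (by positivity)) (hasSum_dotProduct_exp _ p p) (hasSum_dotProduct_exp _ p p)
  rw [show A + c • (1 : Matrix ι ι ℝ) + s • (1 - vecMulVec p p) =
    (A - s • vecMulVec p p) + (c + s) • (1 : Matrix ι ι ℝ) by module, exp_add_smul_one,
    exp_add_smul_one, smul_mulVec, smul_mulVec, dotProduct_smul, dotProduct_smul, smul_eq_mul,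
    smul_eq_mul, Real.exp_add, mul_assoc] at h
  have h1 := le_of_mul_le_mul_left h (Real.exp_pos c)
  calc _ ≤ Real.exp (-s) * (Real.exp s * (p ⬝ᵥ NormedSpace.exp (A - s • vecMulVec p p) *ᵥ p)) := by
        gcongr
    _ = _ := by rw [← mul_assoc, ← Real.exp_add]; simp

theorem dotProduct_exp_nonneg {A : Matrix ι ι ℝ} (hA : A.IsHermitian) (v : ι → ℝ) :
    0 ≤ v ⬝ᵥ NormedSpace.exp A *ᵥ v := by
  obtain ⟨U, d, hU, hU', rfl⟩ := exists_orthogonal_diagonalization hA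
  rw [exp_orthogonal_conj hU]
  have : (U * diagonal (fun i => Real.exp (d i)) * Uᴴ).PosSemidef :=
    (PosSemidef.diagonal fun i => (Real.exp_pos (d i)).le).mul_mul_conjTranspose_same U
  simpa [conjTranspose_eq_transpose_of_trivial] using this.dotProduct_mulVec_nonneg v

omit [Fintype ι] [DecidableEq ι] in
theorem isHermitian_sub_smul_vecMulVec {A : Matrix ι ι ℝ} (hA : A.IsHermitian) (s : ℝ)
    (v : ι → ℝ) : (A - s • vecMulVec v v).IsHermitian := by
  refine hA.sub ?_
  rw [IsHermitian, conjTranspose_eq_transpose_of_trivial, transpose_smul, transpose_vecMulVec]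

omit [DecidableEq ι] in
theorem trace_vecMulVec_mul (v : ι → ℝ) (A : Matrix ι ι ℝ) :
    trace (vecMulVec v v * A) = v ⬝ᵥ A *ᵥ v := by
  rw [trace_mul_comm, mul_vecMulVec, trace_vecMulVec, dotProduct_comm]

theorem trace_exp_sub_smul_vecMulVec_le {A : Matrix ι ι ℝ} (hA : A.IsHermitian) {p : ι → ℝ}
    (hp : p ⬝ᵥ p = 1) {s : ℝ} (hs : 0 ≤ s) :
    trace (NormedSpace.exp (A - s • vecMulVec p p)) ≤
      trace (NormedSpace.exp A) - (1 - Real.exp (-s)) * (p ⬝ᵥ NormedSpace.exp A *ᵥ p) := by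
  set g := p ⬝ᵥ NormedSpace.exp A *ᵥ p with hg
  have hg0 : 0 ≤ g := dotProduct_exp_nonneg hA p
  have step : ∀ h : ℝ, 0 ≤ h → ∀ N : ℕ,
      trace (NormedSpace.exp (A - (N * h) • vecMulVec p p)) ≤
        trace (NormedSpace.exp A) - Real.exp (-h) * (1 - Real.exp (-(N * h))) * g := by
    intro h hh N
    induction N with
    | zero => simp
    | succ N ih =>
      have klein := trace_exp_add_le
        (isHermitian_sub_smul_vecMulVec hA (N * h) p)
        (isHermitian_sub_smul_vecMulVec hA ((N + 1 : ℕ) * h) p)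
      rw [show A - (N * h) • vecMulVec p p - (A - ((N + 1 : ℕ) * h) • vecMulVec p p) =
        h • vecMulVec p p by push_cast; module, Matrix.smul_mul, trace_smul, trace_vecMulVec_mul,
        smul_eq_mul] at klein
      have mono := dotProduct_exp_mono hA hp (s := (N + 1 : ℕ) * h) (by positivity)
      have e1 : Real.exp (-((N + 1 : ℕ) * h)) = Real.exp (-(N * h)) * Real.exp (-h) := by
        rw [← Real.exp_add]; congr 1; push_cast; ring
      have e2 : 1 - Real.exp (-h) ≤ h := by linarith [Real.add_one_le_exp (-h)]
      rw [e1] at mono ⊢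
      have e3 : (1 - Real.exp (-h)) * (Real.exp (-(N * h)) * Real.exp (-h) * g) ≤
          h * (p ⬝ᵥ NormedSpace.exp (A - ((N + 1 : ℕ) * h) • vecMulVec p p) *ᵥ p) :=
        (mul_le_mul_of_nonneg_right e2 (by positivity)).trans
          (mul_le_mul_of_nonneg_left mono hh)
      linarith
  have hlim : Filter.Tendsto (fun N : ℕ => trace (NormedSpace.exp A) -
      Real.exp (-(s / ((N : ℝ) + 1))) * (1 - Real.exp (-s)) * g) Filter.atTop
      (nhds (trace (NormedSpace.exp A) - Real.exp (-0) * (1 - Real.exp (-s)) * g)) := by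
    have h0 : Filter.Tendsto (fun N : ℕ => s / ((N : ℝ) + 1)) Filter.atTop (nhds 0) := by
      simpa [div_eq_mul_inv] using
        (tendsto_one_div_add_atTop_nhds_zero_nat (𝕜 := ℝ)).const_mul s
    exact (((Real.continuous_exp.tendsto _).comp h0.neg).mul_const _ |>.mul_const _).const_sub _
  rw [neg_zero, Real.exp_zero, one_mul] at hlim
  refine ge_of_tendsto' hlim fun N => ?_
  have h := step (s / ((N : ℝ) + 1)) (by positivity) (N + 1)
  rwa [show ((N + 1 : ℕ) : ℝ) * (s / ((N : ℝ) + 1)) = s by push_cast; field_simp] at h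

theorem trace_exp_sub_vecMulVec_le {A : Matrix ι ι ℝ} (hA : A.IsHermitian) {v : ι → ℝ} {R θ : ℝ}
    (hR : 0 < R) (hv : v ⬝ᵥ v ≤ R) (hθ : 0 ≤ θ) :
    trace (NormedSpace.exp (A - θ • vecMulVec v v)) ≤
      trace (NormedSpace.exp A) -
        (1 - Real.exp (-(θ * R))) / R * (v ⬝ᵥ NormedSpace.exp A *ᵥ v) := by
  have hx0 : 0 ≤ v ⬝ᵥ v := by
    simpa using dotProduct_star_self_nonneg v
  rcases hx0.eq_or_lt with h0 | hpos
  · have hv0 : v = 0 := by simpa using h0.symm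
    simp [hv0]
  set x := v ⬝ᵥ v with hx
  set p := (Real.sqrt x)⁻¹ • v with hpdef
  have hsq : Real.sqrt x * Real.sqrt x = x := Real.mul_self_sqrt hx0
  have hs0 : Real.sqrt x ≠ 0 := (Real.sqrt_pos.2 hpos).ne'
  have hp : p ⬝ᵥ p = 1 := by
    rw [hpdef, smul_dotProduct, dotProduct_smul, ← hx, smul_eq_mul, smul_eq_mul, ← mul_assoc,
      ← mul_inv, hsq, inv_mul_cancel₀ hpos.ne']
  have hvp : v = Real.sqrt x • p := by
    rw [hpdef, smul_smul, mul_inv_cancel₀ hs0, one_smul]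
  have hmat : θ • vecMulVec v v = (θ * x) • vecMulVec p p := by
    conv_lhs => rw [hvp]
    rw [smul_vecMulVec, vecMulVec_smul, smul_smul, smul_smul, mul_assoc, hsq]
  have hq : v ⬝ᵥ NormedSpace.exp A *ᵥ v = x * (p ⬝ᵥ NormedSpace.exp A *ᵥ p) := by
    conv_lhs => rw [hvp]
    rw [mulVec_smul, smul_dotProduct, dotProduct_smul, smul_eq_mul, smul_eq_mul, ← mul_assoc, hsq]
  rw [hmat, hq]
  refine (trace_exp_sub_smul_vecMulVec_le hA hp (by positivity)).trans ?_
  have hx1 : 0 ≤ 1 - x / R := by rw [sub_nonneg, div_le_one hR]; exact hv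
  have hx2 : 0 ≤ x / R := by positivity
  have hcvx := convexOn_exp.2 (Set.mem_univ (0 : ℝ)) (Set.mem_univ (-(θ * R))) hx1 hx2 (by ring)
  simp only [smul_eq_mul, mul_zero, zero_add, Real.exp_zero, mul_one] at hcvx
  rw [show x / R * -(θ * R) = -(θ * x) by field_simp] at hcvx
  have hg0 := dotProduct_exp_nonneg hA p
  have : (1 - Real.exp (-(θ * R))) / R * x ≤ 1 - Real.exp (-(θ * x)) := by
    have : (1 - Real.exp (-(θ * R))) / R * x = x / R - x / R * Real.exp (-(θ * R)) := by
      field_simp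
    linarith
  nlinarith

end TraceExp

section Chernoff

variable {ι κ : Type*} [Fintype ι] [DecidableEq ι]

/-- `exp (-θ ∑ i ∈ s, (x i)(x i)ᵀ)`. -/
noncomputable def expGram (θ : ℝ) (s : Finset κ) (x : κ → ι → ℝ) : Matrix ι ι ℝ :=
  NormedSpace.exp (-(θ • ∑ i ∈ s, vecMulVec (x i) (x i)))

omit [Fintype ι] [DecidableEq ι] in
theorem isHermitian_sum_vecMulVec (s : Finset κ) (x : κ → ι → ℝ) :
    (∑ i ∈ s, vecMulVec (x i) (x i)).IsHermitian := by
  rw [IsHermitian, conjTranspose_eq_transpose_of_trivial, transpose_sum]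
  simp [transpose_vecMulVec]

omit [Fintype ι] [DecidableEq ι] in
theorem isHermitian_neg_smul_sum_vecMulVec (θ : ℝ) (s : Finset κ) (x : κ → ι → ℝ) :
    (-(θ • ∑ i ∈ s, vecMulVec (x i) (x i))).IsHermitian := by
  have := isHermitian_sum_vecMulVec s x
  rw [IsHermitian, conjTranspose_eq_transpose_of_trivial] at *
  rw [transpose_neg, transpose_smul, this]

theorem abs_exp_apply_le_trace {A : Matrix ι ι ℝ} (hA : A.IsHermitian) (a b : ι) :
    |NormedSpace.exp A a b| ≤ trace (NormedSpace.exp A) := by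
  have hnn : ∀ i, 0 ≤ NormedSpace.exp A i i := fun i => by
    simpa using dotProduct_exp_nonneg hA (Pi.single i 1)
  by_cases hab : a = b
  · subst hab
    rw [abs_of_nonneg (hnn a)]
    exact Finset.single_le_sum (f := fun i => NormedSpace.exp A i i) (fun i _ => hnn i)
      (Finset.mem_univ a)
  have hsymm : NormedSpace.exp A b a = NormedSpace.exp A a b := by
    have := hA.exp.apply a b
    simpa using this
  have hp := dotProduct_exp_nonneg hA (Pi.single a 1 + Pi.single b 1)
  have hm := dotProduct_exp_nonneg hA (Pi.single a 1 - Pi.single b 1)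
  simp only [mulVec_add, mulVec_sub, dotProduct_add, add_dotProduct, dotProduct_sub,
    sub_dotProduct, single_one_dotProduct, mulVec_single_one, col_apply] at hp hm
  have hle : NormedSpace.exp A a a + NormedSpace.exp A b b ≤ trace (NormedSpace.exp A) := by
    rw [← Finset.sum_pair (f := fun i => NormedSpace.exp A i i) hab]
    exact Finset.sum_le_sum_of_subset_of_nonneg (Finset.subset_univ _) fun i _ _ => hnn i
  have h1 := hnn a
  have h2 := hnn b
  rw [abs_le]
  constructor <;> linarith

theorem expGram_insert_trace_le [DecidableEq κ] {θ R : ℝ} (hθ : 0 ≤ θ) (hR : 0 < R)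
    {s : Finset κ} {a : κ} (ha : a ∉ s) (x : κ → ι → ℝ) (hx : x a ⬝ᵥ x a ≤ R) :
    trace (expGram θ (insert a s) x) ≤ trace (expGram θ s x) -
      (1 - Real.exp (-(θ * R))) / R * (x a ⬝ᵥ expGram θ s x *ᵥ x a) := by
  have h := trace_exp_sub_vecMulVec_le (isHermitian_neg_smul_sum_vecMulVec θ s x) hR hx hθ
  rwa [show -(θ • ∑ i ∈ s, vecMulVec (x i) (x i)) - θ • vecMulVec (x a) (x a) =
    -(θ • ∑ i ∈ insert a s, vecMulVec (x i) (x i)) by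
      rw [Finset.sum_insert ha, smul_add]; abel] at h

theorem expGram_trace_le {θ : ℝ} (hθ : 0 ≤ θ) (s : Finset κ) (x : κ → ι → ℝ) :
    trace (expGram θ s x) ≤ Fintype.card ι := by
  classical
  induction s using Finset.induction_on with
  | empty => simp [expGram, NormedSpace.exp_zero]
  | insert a s ha ih =>
    have h0 : 0 ≤ x a ⬝ᵥ x a := by simpa using dotProduct_star_self_nonneg (x a)
    have h := expGram_insert_trace_le hθ (R := x a ⬝ᵥ x a + 1) (by linarith) ha x (by linarith)
    have h1 : 0 ≤ x a ⬝ᵥ expGram θ s x *ᵥ x a :=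
      dotProduct_exp_nonneg (isHermitian_neg_smul_sum_vecMulVec θ s x) _
    have h2 : 0 ≤ 1 - Real.exp (-(θ * (x a ⬝ᵥ x a + 1))) := by
      rw [sub_nonneg, Real.exp_le_one_iff, neg_nonpos]; positivity
    have h3 : 0 ≤ (1 - Real.exp (-(θ * (x a ⬝ᵥ x a + 1)))) / (x a ⬝ᵥ x a + 1) *
      (x a ⬝ᵥ expGram θ s x *ᵥ x a) := by positivity
    linarith

theorem continuous_matrix_exp :
    Continuous (NormedSpace.exp : Matrix ι ι ℝ → Matrix ι ι ℝ) := by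
  open scoped Norms.Operator in
  let : NormedAlgebra ℚ (Matrix ι ι ℝ) := NormedAlgebra.restrictScalars ℚ ℝ _
  exact NormedSpace.exp_continuous

theorem continuous_expGram_apply (θ : ℝ) (s : Finset κ) (a b : ι) :
    Continuous fun x : κ → ι → ℝ => expGram θ s x a b := by
  unfold expGram
  refine (continuous_matrix_exp.comp ?_).matrix_elem a b
  refine ((continuous_finsetSum _ fun i _ => ?_).const_smul θ).neg
  exact (continuous_apply i).matrix_vecMulVec (continuous_apply i)

theorem smul_trace_exp_le {A S : Matrix ι ι ℝ} (hA : A.IsHermitian) {ξ : ℝ}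
    (hS : ∀ v, ξ * (v ⬝ᵥ v) ≤ v ⬝ᵥ S *ᵥ v) :
    ξ * trace (NormedSpace.exp A) ≤ ∑ a, ∑ b, NormedSpace.exp A a b * S a b := by
  have hsymm : (NormedSpace.exp A)ᵀ = NormedSpace.exp A := by
    simpa [conjTranspose_eq_transpose_of_trivial] using hA.exp.eq
  have e : ∑ a, ∑ b, NormedSpace.exp A a b * S a b = trace (NormedSpace.exp A * S) := by
    conv_rhs => rw [← hsymm, trace]
    rw [Finset.sum_comm]
    simp only [diag_apply, Matrix.mul_apply, transpose_apply]
  rw [e]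
  obtain ⟨U, d, hU, hU', rfl⟩ := exists_orthogonal_diagonalization hA
  have t1 : trace (U * diagonal (fun i => Real.exp (d i)) * Uᵀ) = ∑ i, Real.exp (d i) := by
    rw [trace_mul_comm, ← Matrix.mul_assoc, hU', Matrix.one_mul, trace_diagonal]
  have t2 : trace (U * diagonal (fun i => Real.exp (d i)) * Uᵀ * S) =
      trace (diagonal (fun i => Real.exp (d i)) * (Uᵀ * S * U)) := by
    rw [Matrix.mul_assoc, Matrix.mul_assoc, trace_mul_comm]
    simp only [Matrix.mul_assoc]
  rw [exp_orthogonal_conj hU, t1, t2, trace, Finset.mul_sum]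
  refine Finset.sum_le_sum fun i _ => ?_
  rw [diag_apply, diagonal_mul, mul_comm]
  refine mul_le_mul_of_nonneg_left ?_ (Real.exp_pos _).le
  have h := hS (U.col i)
  have h1 : U.col i ⬝ᵥ U.col i = 1 := by
    have := congrFun (congrFun hU' i) i
    simpa [Matrix.mul_apply, dotProduct] using this
  have h2 : U.col i ⬝ᵥ S *ᵥ U.col i = (Uᵀ * S * U) i i := by
    rw [Matrix.mul_assoc, Matrix.mul_apply]
    simp [dotProduct, Matrix.mul_apply, mulVec]
  rw [← h2]
  simpa [h1] using h

theorem exp_neg_smul_le_trace_exp {S : Matrix ι ι ℝ} (hS : S.IsHermitian) {θ x : ℝ} (hθ : 0 ≤ θ)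
    (h : ¬ ∀ v, x * (v ⬝ᵥ v) ≤ v ⬝ᵥ S *ᵥ v) :
    Real.exp (-(θ * x)) ≤ trace (NormedSpace.exp (-(θ • S))) := by
  obtain ⟨U, d, hU, hU', rfl⟩ := exists_orthogonal_diagonalization hS
  have hex : ∃ i, d i < x := by
    by_contra! hd
    refine h fun v => ?_
    have e : U * diagonal d * Uᵀ = U * diagonal (fun i => d i - x) * Uᴴ + x • 1 := by
      rw [conjTranspose_eq_transpose_of_trivial, ← diagonal_sub, Matrix.mul_sub, Matrix.sub_mul]
      rw [show (diagonal fun _ : ι => x) = x • (1 : Matrix ι ι ℝ) by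
        ext; simp [diagonal_apply, one_apply], Matrix.mul_smul, Matrix.smul_mul, Matrix.mul_one, hU]
      abel
    have hp : (U * diagonal (fun i => d i - x) * Uᴴ).PosSemidef :=
      (PosSemidef.diagonal fun i => sub_nonneg.2 (hd i)).mul_mul_conjTranspose_same U
    have := hp.dotProduct_mulVec_nonneg v
    rw [e, add_mulVec, dotProduct_add, smul_mulVec, one_mulVec, dotProduct_smul, smul_eq_mul]
    simp only [star_trivial] at this
    linarith
  obtain ⟨i, hi⟩ := hex
  have e : -(θ • (U * diagonal d * Uᵀ)) = U * diagonal (fun i => -(θ * d i)) * Uᵀ := by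
    rw [show (diagonal fun i => -(θ * d i)) = -(θ • diagonal d) by
      rw [← diagonal_smul, ← diagonal_neg]; rfl]
    simp
  rw [e, exp_orthogonal_conj hU, trace_mul_comm, ← Matrix.mul_assoc, hU', Matrix.one_mul,
    trace_diagonal]
  calc Real.exp (-(θ * x)) ≤ Real.exp (-(θ * d i)) :=
        Real.exp_le_exp.2 (by nlinarith)
    _ ≤ _ := Finset.single_le_sum (f := fun i => Real.exp (-(θ * d i)))
        (fun i _ => (Real.exp_pos _).le) (Finset.mem_univ i)

variable {Ω : Type*} [MeasurableSpace Ω] {P : Measure Ω} [IsProbabilityMeasure P]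

omit [IsProbabilityMeasure P] in
theorem aestronglyMeasurable_expGram_apply [Finite κ] {c : κ → Ω → ι → ℝ}
    (hc : ∀ i, AEMeasurable (c i) P) (θ : ℝ) (s : Finset κ) (a b : ι) :
    AEStronglyMeasurable (fun ω => expGram θ s (fun i => c i ω) a b) P := by
  have := Fintype.ofFinite κ
  have h : AEMeasurable (fun ω i => c i ω) P := aemeasurable_pi_lambda _ hc
  exact ((continuous_expGram_apply θ s a b).measurable.comp_aemeasurable h).aestronglyMeasurable

theorem integrable_expGram_apply [Finite κ] {c : κ → Ω → ι → ℝ}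
    (hc : ∀ i, AEMeasurable (c i) P) {θ : ℝ} (hθ : 0 ≤ θ) (s : Finset κ) (a b : ι) :
    Integrable (fun ω => expGram θ s (fun i => c i ω) a b) P :=
  Integrable.of_bound (aestronglyMeasurable_expGram_apply hc θ s a b) (Fintype.card ι)
    (.of_forall fun _ => (abs_exp_apply_le_trace
      (isHermitian_neg_smul_sum_vecMulVec θ s _) a b).trans (expGram_trace_le hθ s _))

omit [DecidableEq ι] in
theorem abs_mul_le_of_dotProduct_self_le {v : ι → ℝ} {R : ℝ} (h : v ⬝ᵥ v ≤ R) (a b : ι) :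
    |v a * v b| ≤ R := by
  have h1 : ∀ i, v i * v i ≤ v ⬝ᵥ v := fun i =>
    Finset.single_le_sum (f := fun i => v i * v i) (fun i _ => mul_self_nonneg _)
      (Finset.mem_univ i)
  have ha := h1 a
  have hb := h1 b
  rw [abs_le]
  constructor <;> nlinarith [sq_nonneg (v a + v b), sq_nonneg (v a - v b)]

omit [DecidableEq ι] in
theorem integrable_apply_mul_apply {X : Ω → ι → ℝ} (hX : AEMeasurable X P) {R : ℝ}
    (hR : ∀ᵐ ω ∂P, X ω ⬝ᵥ X ω ≤ R) (a b : ι) : Integrable (fun ω => X ω a * X ω b) P := by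
  have h := aemeasurable_pi_iff.1 hX
  refine Integrable.of_bound ((h a).mul (h b)).aestronglyMeasurable R ?_
  filter_upwards [hR] with ω hω using abs_mul_le_of_dotProduct_self_le hω a b

theorem integral_trace_expGram_le [Finite κ] {c : κ → Ω → ι → ℝ}
    (hc : ∀ i, AEMeasurable (c i) P) (hind : iIndepFun c P) {R ξ θ : ℝ} (hR : 0 < R) (hθ : 0 ≤ θ)
    (hbd : ∀ i, ∀ᵐ ω ∂P, c i ω ⬝ᵥ c i ω ≤ R)
    (hmom : ∀ i v, ξ * (v ⬝ᵥ v) ≤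
      v ⬝ᵥ (Matrix.of fun a b => ∫ ω, c i ω a * c i ω b ∂P) *ᵥ v) (s : Finset κ) :
    ∫ ω, trace (expGram θ s fun i => c i ω) ∂P ≤
      Fintype.card ι * Real.exp (-((1 - Real.exp (-(θ * R))) / R * ξ)) ^ s.card := by
  classical
  have hint := fun s a b => integrable_expGram_apply hc hθ s a b
  have htr : ∀ s, Integrable (fun ω => trace (expGram θ s fun i => c i ω)) P := fun s =>
    integrable_finsetSum _ fun i _ => hint s i i
  set g := (1 - Real.exp (-(θ * R))) / R with hg
  have hg0 : 0 ≤ g := by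
    refine div_nonneg ?_ hR.le
    rw [sub_nonneg, Real.exp_le_one_iff, neg_nonpos]; positivity
  induction s using Finset.induction_on with
  | empty => simp [expGram, NormedSpace.exp_zero]
  | insert j s hj ih =>
    have hindep : ∀ a b, IndepFun (fun ω => expGram θ s (fun i => c i ω) a b)
        (fun ω => c j ω a * c j ω b) P := by
      intro a b
      have h := hind.indepFun_finset₀ s {j} (by simpa using hj) hc
      have h1 : Measurable fun x : s → ι → ℝ => expGram θ Finset.univ x a b :=
        (continuous_expGram_apply θ Finset.univ a b).measurable
      have h2 : Measurable fun x : ({j} : Finset κ) → ι → ℝ =>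
          x ⟨j, Finset.mem_singleton_self j⟩ a * x ⟨j, Finset.mem_singleton_self j⟩ b := by
        fun_prop
      have h3 := h.comp h1 h2
      convert h3 using 1
      · ext ω
        simp only [expGram, Function.comp_apply]
        rw [Finset.sum_coe_sort s fun i => vecMulVec (c i ω) (c i ω)]
      · rfl
    have hprod : ∀ a b, Integrable (fun ω => expGram θ s (fun i => c i ω) a b *
        (c j ω a * c j ω b)) P := fun a b =>
      (hindep a b).integrable_mul (hint s a b) (integrable_apply_mul_apply (hc j) (hbd j) a b)
    have hquad : ∀ ω, c j ω ⬝ᵥ expGram θ s (fun i => c i ω) *ᵥ c j ω =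
        ∑ a, ∑ b, expGram θ s (fun i => c i ω) a b * (c j ω a * c j ω b) := by
      intro ω
      simp only [dotProduct, mulVec, Finset.mul_sum]
      refine Finset.sum_congr rfl fun a _ => Finset.sum_congr rfl fun b _ => ?_
      ring
    have hquadint : Integrable (fun ω => c j ω ⬝ᵥ expGram θ s (fun i => c i ω) *ᵥ c j ω) P := by
      simp only [hquad]
      exact integrable_finsetSum _ fun a _ => integrable_finsetSum _ fun b _ => hprod a b
    have hlow : ξ * ∫ ω, trace (expGram θ s fun i => c i ω) ∂P ≤
        ∫ ω, c j ω ⬝ᵥ expGram θ s (fun i => c i ω) *ᵥ c j ω ∂P := by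
      calc ξ * ∫ ω, trace (expGram θ s fun i => c i ω) ∂P
          = ∫ ω, ξ * trace (expGram θ s fun i => c i ω) ∂P := (integral_const_mul _ _).symm
        _ ≤ ∫ ω, ∑ a, ∑ b, expGram θ s (fun i => c i ω) a b *
              (∫ ω', c j ω' a * c j ω' b ∂P) ∂P := by
            refine integral_mono ((htr s).const_mul ξ) (integrable_finsetSum _ fun a _ =>
              integrable_finsetSum _ fun b _ => (hint s a b).mul_const _) fun ω => ?_
            exact smul_trace_exp_le (isHermitian_neg_smul_sum_vecMulVec θ s _) (hmom j)
        _ = ∫ ω, c j ω ⬝ᵥ expGram θ s (fun i => c i ω) *ᵥ c j ω ∂P := by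
            simp only [hquad]
            rw [integral_finsetSum _ fun a _ => integrable_finsetSum _ fun b _ =>
              (hint s a b).mul_const _, integral_finsetSum _ fun a _ =>
              integrable_finsetSum _ fun b _ => hprod a b]
            refine Finset.sum_congr rfl fun a _ => ?_
            rw [integral_finsetSum _ fun b _ => (hint s a b).mul_const _,
              integral_finsetSum _ fun b _ => hprod a b]
            refine Finset.sum_congr rfl fun b _ => ?_
            rw [integral_mul_const, (hindep a b).integral_fun_mul_eq_mul_integral
              (hint s a b).aestronglyMeasurable
              (integrable_apply_mul_apply (hc j) (hbd j) a b).aestronglyMeasurable]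
    have hstep : ∫ ω, trace (expGram θ (insert j s) fun i => c i ω) ∂P ≤
        ∫ ω, trace (expGram θ s fun i => c i ω) ∂P -
          g * ∫ ω, c j ω ⬝ᵥ expGram θ s (fun i => c i ω) *ᵥ c j ω ∂P := by
      rw [← integral_const_mul, ← integral_sub (htr s) (hquadint.const_mul g)]
      refine integral_mono_ae (htr _) ((htr s).sub (hquadint.const_mul g)) ?_
      filter_upwards [hbd j] with ω hω
      exact expGram_insert_trace_le hθ hR hj _ hω
    have hE0 : 0 ≤ ∫ ω, trace (expGram θ s fun i => c i ω) ∂P :=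
      integral_nonneg fun ω => Finset.sum_nonneg fun i _ => by
        simpa using! dotProduct_exp_nonneg
          (isHermitian_neg_smul_sum_vecMulVec θ s fun i => c i ω) (Pi.single i 1)
    have h1 := mul_le_mul_of_nonneg_left hlow hg0
    have h2 : 1 - g * ξ ≤ Real.exp (-(g * ξ)) := by linarith [Real.add_one_le_exp (-(g * ξ))]
    have h3 := mul_le_mul_of_nonneg_right h2 hE0
    rw [Finset.card_insert_of_notMem hj, pow_succ]
    have h4 := mul_le_mul_of_nonneg_left ih (Real.exp_pos (-(g * ξ))).le
    linarith

/-- **Matrix Chernoff bound**, lower tail, for sums of independent rank-one matrices. -/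
theorem measure_not_le_quadraticForm_le [Fintype κ] {c : κ → Ω → ι → ℝ}
    (hc : ∀ i, AEMeasurable (c i) P) (hind : iIndepFun c P) {R ξ : ℝ} (hR : 0 < R) (hξ : 0 ≤ ξ)
    (hbd : ∀ i, ∀ᵐ ω ∂P, c i ω ⬝ᵥ c i ω ≤ R)
    (hmom : ∀ i v, ξ * (v ⬝ᵥ v) ≤
      v ⬝ᵥ (Matrix.of fun a b => ∫ ω, c i ω a * c i ω b ∂P) *ᵥ v) :
    P {ω | ¬ ∀ v, Fintype.card κ * ξ / 2 * (v ⬝ᵥ v) ≤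
        v ⬝ᵥ (∑ i, vecMulVec (c i ω) (c i ω)) *ᵥ v} ≤
      ENNReal.ofReal (Fintype.card ι * Real.exp (-(Fintype.card κ * ξ / (8 * R)))) := by
  set m := Fintype.card κ with hm
  set θ := Real.log 2 / R with hθdef
  have hlog := Real.log_pos one_lt_two
  have hθ : 0 ≤ θ := by positivity
  set x := m * ξ / 2 with hx
  have hsub : {ω | ¬ ∀ v, x * (v ⬝ᵥ v) ≤ v ⬝ᵥ (∑ i, vecMulVec (c i ω) (c i ω)) *ᵥ v} ⊆
      {ω | Real.exp (-(θ * x)) ≤ trace (expGram θ Finset.univ fun i => c i ω)} := fun ω hω =>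
    exp_neg_smul_le_trace_exp (isHermitian_sum_vecMulVec _ _) hθ hω
  refine (measure_mono hsub).trans ?_
  have htr : Integrable (fun ω => trace (expGram θ Finset.univ fun i => c i ω)) P :=
    integrable_finsetSum _ fun i _ => integrable_expGram_apply hc hθ _ i i
  have hmarkov := mul_meas_ge_le_integral_of_nonneg (.of_forall fun ω =>
    Finset.sum_nonneg fun i _ => by
      simpa using! dotProduct_exp_nonneg
        (isHermitian_neg_smul_sum_vecMulVec θ Finset.univ fun i => c i ω) (Pi.single i 1))
    htr (Real.exp (-(θ * x)))
  have hE := integral_trace_expGram_le hc hind hR hθ hbd hmom Finset.univ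
  have hθR : θ * R = Real.log 2 := by rw [hθdef]; field_simp
  have hel : Real.exp (-Real.log 2) = 2⁻¹ := by rw [Real.exp_neg, Real.exp_log two_pos]
  rw [hθR, hel, ← Real.exp_nat_mul, Finset.card_univ, ← hm] at hE
  rw [← ofReal_measureReal]
  refine ENNReal.ofReal_le_ofReal ?_
  have h1 := hmarkov.trans hE
  have h2 : P.real {ω | Real.exp (-(θ * x)) ≤ trace (expGram θ Finset.univ fun i => c i ω)} ≤
      Real.exp (θ * x) * (Fintype.card ι * Real.exp (m * -((1 - 2⁻¹) / R * ξ))) := by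
    calc _ = Real.exp (θ * x) * (Real.exp (-(θ * x)) *
          P.real {ω | Real.exp (-(θ * x)) ≤ trace (expGram θ Finset.univ fun i => c i ω)}) := by
          rw [← mul_assoc, ← Real.exp_add]; simp
      _ ≤ _ := mul_le_mul_of_nonneg_left h1 (Real.exp_pos _).le
  refine h2.trans ?_
  rw [mul_left_comm, ← Real.exp_add]
  gcongr
  rw [hθdef, hx]
  have h3 : 0 ≤ m * ξ / R := by positivity
  have h4 : Real.log 2 / R * (m * ξ / 2) + m * -((1 - 2⁻¹) / R * ξ) =
      (Real.log 2 / 2 - 1 / 2) * (m * ξ / R) := by ring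
  have h5 : -(m * ξ / (8 * R)) = (-(1 / 8)) * (m * ξ / R) := by field_simp
  rw [h4, h5]
  have h6 := Real.log_two_lt_d9
  exact mul_le_mul_of_nonneg_right (by linarith) h3

end Chernoff

section Noise

variable {Ω κ : Type*} [MeasurableSpace Ω] {P : Measure Ω} [IsProbabilityMeasure P] [Fintype κ]

omit [IsProbabilityMeasure P] in
theorem hasSubgaussianMGF_mono {X : Ω → ℝ} {c c' : NNReal} (h : HasSubgaussianMGF X c P)
    (hc : c ≤ c') : HasSubgaussianMGF X c' P where
  integrable_exp_mul := h.integrable_exp_mul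
  mgf_le t := (h.mgf_le t).trans (Real.exp_le_exp.2 (by gcongr))

theorem measure_le_abs_weighted_sum_le {e : κ → Ω → ℝ} (hind : iIndepFun e P) {v : NNReal}
    (hsub : ∀ i, HasSubgaussianMGF (e i) v P) {w : κ → ℝ} {V t : ℝ}
    (hw : ∑ i, w i ^ 2 ≤ V) (ht : 0 ≤ t) :
    P {ω | t ≤ |∑ i, w i * e i ω|} ≤ ENNReal.ofReal (2 * Real.exp (-t ^ 2 / (2 * (V * v)))) := by
  have hV : 0 ≤ V := (Finset.sum_nonneg fun i _ => sq_nonneg (w i)).trans hw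
  have hs : HasSubgaussianMGF (fun ω => ∑ i, w i * e i ω) (Real.toNNReal V * v) P := by
    have h1 : iIndepFun (fun i ω => w i * e i ω) P :=
      hind.comp (fun i x => w i * x) fun i => measurable_const_mul _
    have h0 : ∀ i, HasSubgaussianMGF (fun ω => w i * e i ω) (Real.toNNReal (w i ^ 2) * v) P := by
      intro i
      have h : Real.toNNReal (w i ^ 2) = ⟨w i ^ 2, sq_nonneg _⟩ :=
        Real.toNNReal_of_nonneg (sq_nonneg _)
      rw [h]
      exact (hsub i).const_mul (w i)
    have h2 := HasSubgaussianMGF.sum_of_iIndepFun h1 (s := Finset.univ) fun i _ => h0 i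
    refine hasSubgaussianMGF_mono h2 ?_
    rw [← Finset.sum_mul]
    gcongr
    rw [← NNReal.coe_le_coe, Real.coe_toNNReal _ hV]
    rw [NNReal.coe_sum]
    simpa only [Real.coe_toNNReal _ (sq_nonneg _)] using hw
  have hcoe : ((Real.toNNReal V * v : NNReal) : ℝ) = V * v := by
    push_cast; rw [Real.coe_toNNReal _ hV]
  have h1 := hs.measure_ge_le ht
  have h2 := hs.neg.measure_ge_le ht
  rw [hcoe] at h1 h2
  have hun : {ω | t ≤ |∑ i, w i * e i ω|} ⊆ {ω | t ≤ ∑ i, w i * e i ω} ∪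
      {ω | t ≤ (-fun ω => ∑ i, w i * e i ω) ω} := fun ω hω => by
    simpa [le_abs] using hω
  rw [← ofReal_measureReal]
  refine ENNReal.ofReal_le_ofReal ?_
  calc _ ≤ _ := measureReal_mono hun
    _ ≤ _ := measureReal_union_le _ _
    _ ≤ _ := by rw [two_mul]; exact add_le_add h1 h2

theorem measure_le_abs_random_weighted_sum_le {𝓧 : Type*} [MeasurableSpace 𝓧] {X : Ω → 𝓧}
    (hX : AEMeasurable X P) {e : κ → Ω → ℝ} (hXe : IndepFun X (fun ω i => e i ω) P)
    (hind : iIndepFun e P) {v : NNReal} (hsub : ∀ i, HasSubgaussianMGF (e i) v P)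
    {w : 𝓧 → κ → ℝ} (hw : Measurable w) (V : ℝ) {t : ℝ} (ht : 0 ≤ t) :
    P {ω | ∑ i, w (X ω) i ^ 2 ≤ V ∧ t ≤ |∑ i, w (X ω) i * e i ω|} ≤
      ENNReal.ofReal (2 * Real.exp (-t ^ 2 / (2 * (V * v)))) := by
  have he : AEMeasurable (fun ω i => e i ω) P :=
    aemeasurable_pi_lambda _ fun i => (hsub i).aemeasurable
  set B : Set (𝓧 × (κ → ℝ)) :=
    {z | ∑ i, w z.1 i ^ 2 ≤ V ∧ t ≤ |∑ i, w z.1 i * z.2 i|} with hB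
  have hwi : ∀ i, Measurable fun z : 𝓧 × (κ → ℝ) => w z.1 i := fun i =>
    (measurable_pi_apply i).comp (hw.comp measurable_fst)
  have hBm : MeasurableSet B := by
    have h1 : Measurable fun z : 𝓧 × (κ → ℝ) => ∑ i, w z.1 i ^ 2 :=
      Finset.measurable_sum _ fun i _ => (hwi i).pow_const 2
    have h2 : Measurable fun z : 𝓧 × (κ → ℝ) => |∑ i, w z.1 i * z.2 i| := by
      have h3 : Measurable fun z : 𝓧 × (κ → ℝ) => ∑ i, w z.1 i * z.2 i :=
        Finset.measurable_sum _ fun i _ =>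
          (hwi i).mul ((measurable_pi_apply i).comp measurable_snd)
      exact measurable_norm.comp h3
    exact (measurableSet_le h1 measurable_const).inter (measurableSet_le measurable_const h2)
  have hmap := (indepFun_iff_map_prod_eq_prod_map_map hX he).1 hXe
  have := Measure.isProbabilityMeasure_map (μ := P) hX
  have := Measure.isProbabilityMeasure_map (μ := P) he
  calc _ = (P.map fun ω => (X ω, fun i => e i ω)) B := by
        rw [Measure.map_apply_of_aemeasurable (hX.prodMk he) hBm]; rfl
    _ = ∫⁻ x, P.map (fun ω i => e i ω) (Prod.mk x ⁻¹' B) ∂(P.map X) := by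
        rw [hmap, Measure.prod_apply hBm]
    _ ≤ ∫⁻ _, ENNReal.ofReal (2 * Real.exp (-t ^ 2 / (2 * (V * v)))) ∂(P.map X) := by
        refine lintegral_mono fun x => ?_
        rw [Measure.map_apply_of_aemeasurable he (measurable_prodMk_left hBm)]
        by_cases hx : ∑ i, w x i ^ 2 ≤ V
        · exact (measure_mono fun ω hω => hω.2).trans
            (measure_le_abs_weighted_sum_le hind hsub hx ht)
        · have : (fun ω i => e i ω) ⁻¹' (Prod.mk x ⁻¹' B) = (∅ : Set Ω) := by
            ext ω; simp [hB, hx]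
          rw [this]
          simp
    _ = _ := by simp

end Noise

section LinearAlgebra

variable {ι κ : Type*} [Fintype ι] [Fintype κ]

theorem dotProduct_self_nonneg_real (v : ι → ℝ) : 0 ≤ v ⬝ᵥ v := by
  simpa using dotProduct_star_self_nonneg v

theorem dotProduct_transpose_mulVec_transpose_mulVec [DecidableEq ι] {O : Matrix ι ι ℝ}
    (hO : O * Oᵀ = 1) (x y : ι → ℝ) : (Oᵀ *ᵥ x) ⬝ᵥ (Oᵀ *ᵥ y) = x ⬝ᵥ y := by
  rw [dotProduct_mulVec, vecMul_transpose, mulVec_mulVec, hO, one_mulVec]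

theorem dotProduct_self_le_of_mem_cube {x : ι → ℝ} (hx : x ∈ cube ι) :
    x ⬝ᵥ x ≤ Fintype.card ι := by
  calc x ⬝ᵥ x ≤ ∑ _ : ι, (1 : ℝ) := by
        refine Finset.sum_le_sum fun i _ => ?_
        have := hx i
        nlinarith
    _ = _ := by simp

theorem isUnit_of_coercive [DecidableEq κ] {G : Matrix κ κ ℝ} {a : ℝ} (ha : 0 < a)
    (hG : ∀ v, a * (v ⬝ᵥ v) ≤ v ⬝ᵥ G *ᵥ v) : IsUnit G := by
  rw [← mulVec_injective_iff_isUnit]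
  refine (injective_iff_map_eq_zero (mulVecLin G)).2 fun v hv => ?_
  have h := hG v
  rw [mulVecLin_apply] at hv
  rw [hv, dotProduct_zero] at h
  have h0 := dotProduct_self_nonneg_real v
  have : v ⬝ᵥ v = 0 := by nlinarith
  simpa using this

theorem inv_apply_self_le_of_coercive [DecidableEq κ] {G : Matrix κ κ ℝ} {a : ℝ} (ha : 0 < a)
    (hG : ∀ v, a * (v ⬝ᵥ v) ≤ v ⬝ᵥ G *ᵥ v) (j : κ) : G⁻¹ j j ≤ a⁻¹ := by
  have hdet := (isUnit_iff_isUnit_det G).1 (isUnit_of_coercive ha hG)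
  set u := G⁻¹ *ᵥ Pi.single j 1 with hu
  have hGu : G *ᵥ u = Pi.single j 1 := by
    rw [hu, mulVec_mulVec, mul_nonsing_inv _ hdet, one_mulVec]
  have huj : u j = G⁻¹ j j := by rw [hu, mulVec_single_one, col_apply]
  have h := hG u
  rw [hGu, dotProduct_single_one, huj] at h
  have h1 : u j * u j ≤ u ⬝ᵥ u :=
    Finset.single_le_sum (f := fun i => u i * u i) (fun i _ => mul_self_nonneg _)
      (Finset.mem_univ j)
  rw [huj] at h1
  by_contra! hlt
  have h2 : 1 < a * G⁻¹ j j := by rwa [inv_lt_iff_one_lt_mul₀' ha] at hlt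
  have h3 : 0 < G⁻¹ j j := (inv_pos.2 ha).trans hlt
  nlinarith

/-- The rows of `(Bᵀ B)⁻¹ Bᵀ` have squared norms bounded by the diagonal of `(Bᵀ B)⁻¹`. -/
theorem sum_sq_pinv_le [DecidableEq κ] {B : Matrix ι κ ℝ} {a : ℝ} (ha : 0 < a)
    (hG : ∀ v, a * (v ⬝ᵥ v) ≤ v ⬝ᵥ (Bᵀ * B) *ᵥ v) (j : κ) :
    ∑ i, ((Bᵀ * B)⁻¹ * Bᵀ) j i ^ 2 ≤ a⁻¹ := by
  have hdet := (isUnit_iff_isUnit_det _).1 (isUnit_of_coercive ha hG)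
  refine le_trans (le_of_eq ?_) (inv_apply_self_le_of_coercive ha hG j)
  have hs : ((Bᵀ * B)⁻¹)ᵀ = (Bᵀ * B)⁻¹ := by
    rw [transpose_nonsing_inv, transpose_mul, transpose_transpose]
  calc ∑ i, ((Bᵀ * B)⁻¹ * Bᵀ) j i ^ 2
      = (((Bᵀ * B)⁻¹ * Bᵀ) * ((Bᵀ * B)⁻¹ * Bᵀ)ᵀ) j j := by
        rw [Matrix.mul_apply]; simp [sq]
    _ = (Bᵀ * B)⁻¹ j j := by
        rw [transpose_mul, transpose_transpose, hs, Matrix.mul_assoc, ← Matrix.mul_assoc Bᵀ,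
          mul_nonsing_inv _ hdet, Matrix.mul_one]

theorem isLeastSquares_iff {m n : ℕ} {C : Matrix (Fin m) (Fin n) ℝ} {r : Fin m → ℝ}
    {x : Fin n → ℝ} : IsLeastSquares C r x ↔ ∀ y, (C *ᵥ x - r) ⬝ᵥ (C *ᵥ y) = 0 := by
  constructor
  · intro h y
    set b := (C *ᵥ x - r) ⬝ᵥ (C *ᵥ y) with hb
    set a := (C *ᵥ y) ⬝ᵥ (C *ᵥ y) with ha
    have ha0 : 0 ≤ a := dotProduct_self_nonneg_real _
    have hq : ∀ t : ℝ, 0 ≤ 2 * t * b + t ^ 2 * a := by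
      intro t
      have h1 := h (x + t • y)
      have e : ∑ i, ((C *ᵥ (x + t • y)) i - r i) ^ 2 =
          ∑ i, ((C *ᵥ x) i - r i) ^ 2 + (2 * t * b + t ^ 2 * a) := by
        rw [hb, ha, dotProduct, dotProduct, Finset.mul_sum, Finset.mul_sum,
          ← Finset.sum_add_distrib, ← Finset.sum_add_distrib]
        refine Finset.sum_congr rfl fun i _ => ?_
        rw [mulVec_add, mulVec_smul]
        simp only [Pi.add_apply, Pi.smul_apply, Pi.sub_apply, smul_eq_mul]
        ring
      linarith
    by_contra hne
    have h1 := hq (-b / (a + 1))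
    have h2 : 2 * (-b / (a + 1)) * b + (-b / (a + 1)) ^ 2 * a =
        -(b ^ 2 * (a + 2)) / (a + 1) ^ 2 := by field_simp; ring
    rw [h2] at h1
    have h3 : 0 < b ^ 2 * (a + 2) / (a + 1) ^ 2 := by positivity
    rw [neg_div] at h1
    linarith
  · intro h y
    have h1 := h (y - x)
    have e : ∑ i, ((C *ᵥ y) i - r i) ^ 2 = ∑ i, ((C *ᵥ x) i - r i) ^ 2 +
        (2 * ((C *ᵥ x - r) ⬝ᵥ (C *ᵥ (y - x))) + ∑ i, ((C *ᵥ (y - x)) i) ^ 2) := by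
      rw [dotProduct, Finset.mul_sum, ← Finset.sum_add_distrib, ← Finset.sum_add_distrib]
      refine Finset.sum_congr rfl fun i _ => ?_
      rw [mulVec_sub]
      simp only [Pi.sub_apply]
      ring
    have h2 : 0 ≤ ∑ i, ((C *ᵥ (y - x)) i) ^ 2 := Finset.sum_nonneg fun i _ => sq_nonneg _
    linarith

end LinearAlgebra

section Visible

variable {n : ℕ} {law : Measure (Fin n → ℝ)} {O : Matrix (Fin n) (Fin n) ℝ} {lam : Fin n → ℝ}

theorem mul_transpose_of_mem_orthogonalGroup (hO : O ∈ Matrix.orthogonalGroup (Fin n) ℝ) :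
    O * Oᵀ = 1 :=
  (mem_orthogonalGroup_iff _ _).1 hO

theorem secondMoment_eq (hO : O * Oᵀ = 1)
    (hdiag : Oᵀ * secondMoment law * O = diagonal lam) :
    secondMoment law = O * diagonal lam * Oᵀ := by
  rw [← hdiag]
  calc secondMoment law = (O * Oᵀ) * secondMoment law * (O * Oᵀ) := by rw [hO]; simp
    _ = _ := by simp only [Matrix.mul_assoc]

theorem mem_visible_iff (hO : O * Oᵀ = 1)
    (hdiag : Oᵀ * secondMoment law * O = diagonal lam) {x : Fin n → ℝ} :
    x ∈ visible law ↔ ∀ j, lam j = 0 → (Oᵀ *ᵥ x) j = 0 := by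
  have hO' : Oᵀ * O = 1 := mul_eq_one_comm.1 hO
  rw [visible, Set.mem_ofPred_eq, LinearMap.mem_range, secondMoment_eq hO hdiag]
  constructor
  · rintro ⟨y, rfl⟩ j hj
    rw [toLin'_apply, mulVec_mulVec, ← Matrix.mul_assoc, ← Matrix.mul_assoc, hO', Matrix.one_mul,
      ← mulVec_mulVec, mulVec_diagonal, hj, zero_mul]
  · intro h
    refine ⟨O *ᵥ fun j => (lam j)⁻¹ * (Oᵀ *ᵥ x) j, ?_⟩
    rw [toLin'_apply, mulVec_mulVec, Matrix.mul_assoc, hO', Matrix.mul_one, ← mulVec_mulVec]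
    have : diagonal lam *ᵥ (fun j => (lam j)⁻¹ * (Oᵀ *ᵥ x) j) = Oᵀ *ᵥ x := by
      ext j
      rw [mulVec_diagonal]
      by_cases hj : lam j = 0
      · rw [hj, h j hj]; simp
      · rw [mul_inv_cancel_left₀ hj]
    rw [this, mulVec_mulVec, hO, one_mulVec]

theorem isHermitian_secondMoment : (secondMoment law).IsHermitian := by
  ext i j
  simp [secondMoment, mul_comm]

theorem integrable_apply_mul_apply_of_cube [IsProbabilityMeasure law]
    (hcube : ∀ᵐ c ∂law, c ∈ cube (Fin n)) (a b : Fin n) :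
    Integrable (fun c : Fin n → ℝ => c a * c b) law :=
  integrable_apply_mul_apply (X := fun c : Fin n → ℝ => c) aemeasurable_id
    (hcube.mono fun _ hc => dotProduct_self_le_of_mem_cube hc) a b

theorem integral_dotProduct_mul_dotProduct [IsProbabilityMeasure law]
    (hcube : ∀ᵐ c ∂law, c ∈ cube (Fin n)) (u v : Fin n → ℝ) :
    ∫ c, (u ⬝ᵥ c) * (v ⬝ᵥ c) ∂law = u ⬝ᵥ secondMoment law *ᵥ v := by
  have e : ∀ c : Fin n → ℝ, (u ⬝ᵥ c) * (v ⬝ᵥ c) = ∑ a, ∑ b, (u a * v b) * (c a * c b) := by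
    intro c
    rw [dotProduct, dotProduct, Finset.sum_mul_sum]
    refine Finset.sum_congr rfl fun a _ => Finset.sum_congr rfl fun b _ => by ring
  have hi := fun a b => (integrable_apply_mul_apply_of_cube hcube a b).const_mul (u a * v b)
  simp only [e]
  rw [integral_finsetSum _ fun a _ => integrable_finsetSum _ fun b _ => hi a b]
  simp only [dotProduct, mulVec, Finset.mul_sum]
  refine Finset.sum_congr rfl fun a _ => ?_
  rw [integral_finsetSum _ fun b _ => hi a b]
  refine Finset.sum_congr rfl fun b _ => ?_
  rw [integral_const_mul, secondMoment, of_apply]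
  ring

theorem dotProduct_secondMoment_nonneg [IsProbabilityMeasure law]
    (hcube : ∀ᵐ c ∂law, c ∈ cube (Fin n)) (v : Fin n → ℝ) :
    0 ≤ v ⬝ᵥ secondMoment law *ᵥ v := by
  rw [← integral_dotProduct_mul_dotProduct hcube]
  exact integral_nonneg fun c => mul_self_nonneg _

theorem ae_mem_visible_of_diagonalization [IsProbabilityMeasure law]
    (hcube : ∀ᵐ c ∂law, c ∈ cube (Fin n)) (hO : O * Oᵀ = 1)
    (hdiag : Oᵀ * secondMoment law * O = diagonal lam) : ∀ᵐ c ∂law, c ∈ visible law := by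
  simp only [mem_visible_iff hO hdiag]
  refine ae_all_iff.2 fun j => ?_
  by_cases hj : lam j = 0
  swap
  · exact .of_forall fun c h => absurd h hj
  have hcol : ∀ c : Fin n → ℝ, (Oᵀ *ᵥ c) j = O.col j ⬝ᵥ c := fun c => rfl
  have h0 : ∫ c, (O.col j ⬝ᵥ c) * (O.col j ⬝ᵥ c) ∂law = 0 := by
    rw [integral_dotProduct_mul_dotProduct hcube]
    have : O.col j ⬝ᵥ secondMoment law *ᵥ O.col j = (Oᵀ * secondMoment law * O) j j := by
      rw [Matrix.mul_assoc, Matrix.mul_apply]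
      simp [dotProduct, Matrix.mul_apply, mulVec]
    rw [this, hdiag, diagonal_apply_eq, hj]
  have hint : Integrable (fun c : Fin n → ℝ => (O.col j ⬝ᵥ c) * (O.col j ⬝ᵥ c)) law := by
    have e : ∀ c : Fin n → ℝ, (O.col j ⬝ᵥ c) * (O.col j ⬝ᵥ c) =
        ∑ a, ∑ b, (O.col j a * O.col j b) * (c a * c b) := by
      intro c
      rw [dotProduct, Finset.sum_mul_sum]
      refine Finset.sum_congr rfl fun a _ => Finset.sum_congr rfl fun b _ => by ring
    simp only [e]
    exact integrable_finsetSum _ fun a _ => integrable_finsetSum _ fun b _ =>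
      (integrable_apply_mul_apply_of_cube hcube a b).const_mul _
  have h1 := (integral_eq_zero_iff_of_nonneg (fun c => mul_self_nonneg _) hint).1 h0
  filter_upwards [h1] with c hc _
  rw [hcol]
  exact mul_self_eq_zero.1 hc

theorem exists_diagonalization (law : Measure (Fin n → ℝ)) :
    ∃ (O : Matrix (Fin n) (Fin n) ℝ) (lam : Fin n → ℝ),
      O ∈ Matrix.orthogonalGroup (Fin n) ℝ ∧ Oᵀ * secondMoment law * O = diagonal lam := by
  obtain ⟨U, d, h1, h2, h3⟩ :=
    exists_orthogonal_diagonalization (isHermitian_secondMoment (law := law))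
  refine ⟨U, d, (mem_orthogonalGroup_iff _ _).2 h1, ?_⟩
  calc Uᵀ * secondMoment law * U = (Uᵀ * U) * diagonal d * (Uᵀ * U) := by
        rw [h3]; simp only [Matrix.mul_assoc]
    _ = _ := by rw [h2]; simp

theorem ae_mem_visible [IsProbabilityMeasure law]
    (hcube : ∀ᵐ c ∂law, c ∈ cube (Fin n)) : ∀ᵐ c ∂law, c ∈ visible law := by
  obtain ⟨O, lam, hO, hdiag⟩ := exists_diagonalization law
  exact ae_mem_visible_of_diagonalization hcube (mul_transpose_of_mem_orthogonalGroup hO) hdiag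

theorem smallestNonzeroEigenvalue_pos [IsProbabilityMeasure law]
    (hcube : ∀ᵐ c ∂law, c ∈ cube (Fin n)) {ξ : ℝ}
    (hξ : IsSmallestNonzeroEigenvalue (secondMoment law) ξ) : 0 < ξ := by
  obtain ⟨hne, hev⟩ := hξ.1
  obtain ⟨v, hv⟩ := hev.exists_hasEigenvector
  have h1 : secondMoment law *ᵥ v = ξ • v := by simpa using hv.apply_eq_smul
  have h2 := dotProduct_secondMoment_nonneg hcube v
  rw [h1, dotProduct_smul, smul_eq_mul] at h2
  have h3 : 0 < v ⬝ᵥ v := (dotProduct_self_nonneg_real v).lt_of_ne fun h =>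
    hv.2 (by simpa using h.symm)
  exact lt_of_le_of_ne (nonneg_of_mul_nonneg_left h2 h3) hne.symm

theorem smallestNonzeroEigenvalue_le {ξ : ℝ}
    (hξ : IsSmallestNonzeroEigenvalue (secondMoment law) ξ) (hO : O * Oᵀ = 1)
    (hdiag : Oᵀ * secondMoment law * O = diagonal lam) {j : Fin n} (hj : lam j ≠ 0) :
    ξ ≤ lam j := by
  have hO' : Oᵀ * O = 1 := mul_eq_one_comm.1 hO
  refine hξ.2 ⟨hj, Module.End.hasEigenvalue_of_hasEigenvector (x := O *ᵥ Pi.single j 1) ?_⟩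
  refine Module.End.hasEigenvector_iff.2 ⟨Module.End.mem_eigenspace_iff.2 ?_, ?_⟩
  · rw [toLin'_apply, secondMoment_eq hO hdiag, mulVec_mulVec, Matrix.mul_assoc, hO',
      Matrix.mul_one, ← mulVec_mulVec, diagonal_mulVec_single, mul_one, ← mulVec_smul]
    congr 1
    ext i
    by_cases h : i = j <;> simp [h]
  · intro h
    have := congrArg (Oᵀ *ᵥ ·) h
    simp only [mulVec_mulVec, hO', one_mulVec, mulVec_zero] at this
    simpa using congrFun this j

theorem smallestNonzeroEigenvalue_le_card [IsProbabilityMeasure law]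
    (hcube : ∀ᵐ c ∂law, c ∈ cube (Fin n)) {ξ : ℝ}
    (hξ : IsSmallestNonzeroEigenvalue (secondMoment law) ξ) : ξ ≤ n := by
  obtain ⟨hne, hev⟩ := hξ.1
  obtain ⟨v, hv⟩ := hev.exists_hasEigenvector
  have h1 : secondMoment law *ᵥ v = ξ • v := by simpa using hv.apply_eq_smul
  have h3 : 0 < v ⬝ᵥ v := (dotProduct_self_nonneg_real v).lt_of_ne fun h =>
    hv.2 (by simpa using h.symm)
  have h2 := integral_dotProduct_mul_dotProduct hcube v v
  rw [h1, dotProduct_smul, smul_eq_mul] at h2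
  have h4 : ∫ c, (v ⬝ᵥ c) * (v ⬝ᵥ c) ∂law ≤ ∫ _, n * (v ⬝ᵥ v) ∂law := by
    refine integral_mono_of_nonneg (.of_forall fun c => mul_self_nonneg _)
      (integrable_const _) ?_
    filter_upwards [hcube] with c hc
    have hcs := Finset.sum_mul_sq_le_sq_mul_sq Finset.univ v c
    have hc1 := dotProduct_self_le_of_mem_cube hc
    rw [Fintype.card_fin] at hc1
    have e1 : ∑ i, v i ^ 2 = v ⬝ᵥ v := by simp [dotProduct, sq]
    have e2 : ∑ i, c i ^ 2 = c ⬝ᵥ c := by simp [dotProduct, sq]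
    rw [e1, e2] at hcs
    calc (v ⬝ᵥ c) * (v ⬝ᵥ c) = (∑ i, v i * c i) ^ 2 := by rw [sq]; rfl
      _ ≤ (v ⬝ᵥ v) * (c ⬝ᵥ c) := hcs
      _ ≤ n * (v ⬝ᵥ v) := by rw [mul_comm]; gcongr
  rw [h2, integral_const] at h4
  simp only [probReal_univ, one_smul] at h4
  exact le_of_mul_le_mul_right h4 h3

end Visible

section Regression

variable {m n : ℕ} {O : Matrix (Fin n) (Fin n) ℝ} {lam : Fin n → ℝ}

/-- The coordinates of `Oᵀ x` that belong to the nonzero entries of `lam`. -/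
def visibleCoords (O : Matrix (Fin n) (Fin n) ℝ) (lam : Fin n → ℝ) (x : Fin n → ℝ) :
    {j : Fin n // lam j ≠ 0} → ℝ := fun j => (Oᵀ *ᵥ x) j

theorem reduced_apply (C : Matrix (Fin m) (Fin n) ℝ) (i : Fin m) (j : {j : Fin n // lam j ≠ 0}) :
    reduced C O lam i j = visibleCoords O lam (C i) j := by
  simp [reduced, visibleCoords, Matrix.mul_apply, mulVec, dotProduct, mul_comm]

theorem reduced_transpose_mul_self (C : Matrix (Fin m) (Fin n) ℝ) :
    (reduced C O lam)ᵀ * reduced C O lam =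
      ∑ i, vecMulVec (visibleCoords O lam (C i)) (visibleCoords O lam (C i)) := by
  ext a b
  rw [Matrix.mul_apply, Matrix.sum_apply]
  simp [vecMulVec_apply, reduced_apply]

theorem dotProduct_visibleCoords (hO : O * Oᵀ = 1) {x : Fin n → ℝ}
    (hx : ∀ j, lam j = 0 → (Oᵀ *ᵥ x) j = 0) (y : Fin n → ℝ) :
    visibleCoords O lam x ⬝ᵥ visibleCoords O lam y = x ⬝ᵥ y := by
  rw [← dotProduct_transpose_mulVec_transpose_mulVec hO, dotProduct, dotProduct]
  have e2 : (∑ j, (Oᵀ *ᵥ x) j * (Oᵀ *ᵥ y) j) =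
      ∑ j ∈ Finset.univ.filter (fun j => lam j ≠ 0), (Oᵀ *ᵥ x) j * (Oᵀ *ᵥ y) j := by
    refine (Finset.sum_subset (Finset.subset_univ _) fun j _ hj => ?_).symm
    rw [hx j (by simpa using hj), zero_mul]
  rw [e2]
  exact (Finset.sum_subtype _ (by simp) fun j => (Oᵀ *ᵥ x) j * (Oᵀ *ᵥ y) j).symm

theorem visibleCoords_dotProduct_self_le (hO : O * Oᵀ = 1) (x : Fin n → ℝ) :
    visibleCoords O lam x ⬝ᵥ visibleCoords O lam x ≤ x ⬝ᵥ x := by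
  rw [← dotProduct_transpose_mulVec_transpose_mulVec hO x x, dotProduct, dotProduct]
  refine (Finset.sum_subtype (Finset.univ.filter fun j => lam j ≠ 0) (by simp)
    fun j => (Oᵀ *ᵥ x) j * (Oᵀ *ᵥ x) j).symm.le.trans ?_
  exact Finset.sum_le_sum_of_subset_of_nonneg (Finset.subset_univ _) fun j _ _ => mul_self_nonneg _

theorem mulVec_eq_reduced_mulVec (hO : O * Oᵀ = 1) {C : Matrix (Fin m) (Fin n) ℝ}
    (hC : ∀ i j, lam j = 0 → (Oᵀ *ᵥ C i) j = 0) (s : Fin n → ℝ) :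
    C *ᵥ s = reduced C O lam *ᵥ visibleCoords O lam s := by
  ext i
  change C i ⬝ᵥ s = reduced C O lam i ⬝ᵥ _
  rw [← dotProduct_visibleCoords hO (hC i)]
  congr 1
  ext j
  rw [reduced_apply]

theorem isReducedEstimate_of_isLeastSquares (hO : O * Oᵀ = 1) {C : Matrix (Fin m) (Fin n) ℝ}
    (hC : ∀ i j, lam j = 0 → (Oᵀ *ᵥ C i) j = 0)
    (hunit : IsUnit ((reduced C O lam)ᵀ * reduced C O lam)) {r : Fin m → ℝ} {x : Fin n → ℝ}
    (hx : IsLeastSquares C r x) : IsReducedEstimate C O lam r x := by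
  set B := reduced C O lam with hB
  have hdet := (isUnit_iff_isUnit_det _).1 hunit
  have hnormal : Bᵀ *ᵥ (C *ᵥ x - r) = 0 := by
    ext j
    have h := isLeastSquares_iff.1 hx (O *ᵥ Pi.single (j : Fin n) 1)
    rw [mulVec_mulVec, mulVec_single_one, dotProduct_comm] at h
    exact h
  rw [mulVec_eq_reduced_mulVec hO hC, ← hB, mulVec_sub, sub_eq_zero, mulVec_mulVec] at hnormal
  intro j
  rw [← hB, ← hnormal, mulVec_mulVec, nonsing_inv_mul _ hdet, one_mulVec]
  rfl

theorem abs_prediction_error_le (hO : O * Oᵀ = 1) {C : Matrix (Fin m) (Fin n) ℝ}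
    (hC : ∀ i j, lam j = 0 → (Oᵀ *ᵥ C i) j = 0)
    (hunit : IsUnit ((reduced C O lam)ᵀ * reduced C O lam)) {r : Fin m → ℝ} {s x : Fin n → ℝ}
    {η : ℝ} (hη0 : 0 ≤ η)
    (hη : ∀ j, |∑ i, (((reduced C O lam)ᵀ * reduced C O lam)⁻¹ * (reduced C O lam)ᵀ) j i *
      (r i - C i ⬝ᵥ s)| ≤ η)
    (hx : IsReducedEstimate C O lam r x) {y : Fin n → ℝ} (hy : y ∈ cube (Fin n))
    (hyvis : ∀ j, lam j = 0 → (Oᵀ *ᵥ y) j = 0) : |y ⬝ᵥ x - y ⬝ᵥ s| ≤ n * η := by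
  set B := reduced C O lam with hB
  have hdet := (isUnit_iff_isUnit_det _).1 hunit
  have hxs : ∀ j, visibleCoords O lam (x - s) j =
      ∑ i, ((Bᵀ * B)⁻¹ * Bᵀ) j i * (r i - C i ⬝ᵥ s) := by
    intro j
    have h1 : ∑ i, ((Bᵀ * B)⁻¹ * Bᵀ) j i * (r i - C i ⬝ᵥ s) =
        (((Bᵀ * B)⁻¹ * Bᵀ) *ᵥ (r - C *ᵥ s)) j := rfl
    have h2 : ((Bᵀ * B)⁻¹ * Bᵀ) *ᵥ (C *ᵥ s) = visibleCoords O lam s := by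
      rw [mulVec_eq_reduced_mulVec hO hC, ← hB, mulVec_mulVec, Matrix.mul_assoc,
        nonsing_inv_mul _ hdet, one_mulVec]
    rw [h1, mulVec_sub, h2, ← mulVec_mulVec, Pi.sub_apply, ← hx j, visibleCoords, mulVec_sub]
    rfl
  have hsum : ∑ j, |visibleCoords O lam y j| ≤ n := by
    refine abs_le_of_sq_le_sq' ?_ (Nat.cast_nonneg n) |>.2
    have h1 := sq_sum_le_card_mul_sum_sq (s := Finset.univ)
      (f := fun j => |visibleCoords O lam y j|)
    have h2 := (visibleCoords_dotProduct_self_le (lam := lam) hO y).trans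
      (dotProduct_self_le_of_mem_cube hy)
    have h3 : ((Finset.univ : Finset {j : Fin n // lam j ≠ 0}).card : ℝ) ≤ n := by
      have := Fintype.card_subtype_le fun j : Fin n => lam j ≠ 0
      rw [Fintype.card_fin] at this
      exact_mod_cast this
    rw [Fintype.card_fin] at h2
    have h4 : ∑ j, |visibleCoords O lam y j| ^ 2 =
        visibleCoords O lam y ⬝ᵥ visibleCoords O lam y := by
      simp only [sq_abs]
      simp only [dotProduct, sq]
    rw [h4] at h1
    calc _ ≤ _ := h1
      _ ≤ (n : ℝ) * n := by
        gcongr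
        exact dotProduct_self_nonneg_real _
      _ = _ := (sq _).symm
  rw [← dotProduct_sub, ← dotProduct_visibleCoords hO hyvis]
  calc |∑ j, visibleCoords O lam y j * visibleCoords O lam (x - s) j|
      ≤ ∑ j, |visibleCoords O lam y j * visibleCoords O lam (x - s) j| :=
        Finset.abs_sum_le_sum_abs _ _
    _ ≤ ∑ j, |visibleCoords O lam y j| * η := by
        refine Finset.sum_le_sum fun j _ => ?_
        rw [abs_mul, hxs j]
        exact mul_le_mul_of_nonneg_left (hη j) (abs_nonneg _)
    _ ≤ n * η := by
        rw [← Finset.sum_mul]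
        gcongr

theorem continuous_reduced_apply (i : Fin m) (j : {j : Fin n // lam j ≠ 0}) :
    Continuous fun X : Fin m → Fin n → ℝ => reduced (Matrix.of X) O lam i j := by
  simp only [reduced, submatrix_apply, Matrix.mul_apply, of_apply]
  fun_prop

/-- The weights of the reduced least-squares estimate are a measurable function of the challenges. -/
theorem measurable_reduced_pinv_apply (j : {j : Fin n // lam j ≠ 0}) :
    Measurable fun (X : Fin m → Fin n → ℝ) i =>
      (((reduced (Matrix.of X) O lam)ᵀ * reduced (Matrix.of X) O lam)⁻¹ *
        (reduced (Matrix.of X) O lam)ᵀ) j i := by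
  have hB : Continuous fun X : Fin m → Fin n → ℝ => reduced (Matrix.of X) O lam :=
    continuous_matrix fun i j => continuous_reduced_apply i j
  have hG : Continuous fun X : Fin m → Fin n → ℝ =>
      (reduced (Matrix.of X) O lam)ᵀ * reduced (Matrix.of X) O lam :=
    hB.matrix_transpose.matrix_mul hB
  refine measurable_pi_lambda _ fun i => ?_
  have hdet := hG.matrix_det.measurable.inv
  have e : (fun X : Fin m → Fin n → ℝ =>
      (((reduced (Matrix.of X) O lam)ᵀ * reduced (Matrix.of X) O lam)⁻¹ *
        (reduced (Matrix.of X) O lam)ᵀ) j i) = fun X => ∑ l,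
      (((reduced (Matrix.of X) O lam)ᵀ * reduced (Matrix.of X) O lam).det)⁻¹ *
        ((reduced (Matrix.of X) O lam)ᵀ * reduced (Matrix.of X) O lam).adjugate j l *
        (reduced (Matrix.of X) O lam)ᵀ l i := by
    ext X
    rw [Matrix.mul_apply]
    simp only [Matrix.inv_def, Matrix.smul_apply, smul_eq_mul, Ring.inverse_eq_inv']
  rw [e]
  refine Finset.measurable_sum _ fun l _ => ?_
  refine (hdet.mul (hG.matrix_adjugate.matrix_elem j l).measurable).mul ?_
  exact (hB.matrix_transpose.matrix_elem l i).measurable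

variable {M : ℕ} {law : Measure (Fin n → ℝ)}

theorem sampleBound_pos {ξ τ ε δ : ℝ} (hn : 0 < n) (hM : 1 ≤ M) (hξ : 0 < ξ)
    (hδ : 0 < δ) (hδ1 : δ < 1) : 0 < sampleBound n M ξ τ ε δ := by
  refine lt_max_of_lt_left (mul_pos (by positivity) (Real.log_pos ?_))
  rw [lt_div_iff₀ hδ, one_mul]
  have h1 : (1 : ℝ) ≤ M := by exact_mod_cast hM
  have h2 : (1 : ℝ) ≤ n := by exact_mod_cast hn
  nlinarith

/-- If the sample is large enough, both failure probabilities add up to at most `δ`. -/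
theorem failure_probability_le {d m : ℕ} {ξ τ ε δ : ℝ} (hn : 0 < n) (hd : d ≤ n) (hM : 1 ≤ M)
    (hξ : 0 < ξ) (hτ : 0 < τ) (hε : 0 < ε) (hδ : 0 < δ)
    (hm : sampleBound n M ξ τ ε δ ≤ m) :
    d * Real.exp (-(m * ξ / (8 * n))) +
      M * d * (2 * Real.exp (-(ε / n) ^ 2 / (2 * ((m * ξ / 2)⁻¹ * τ ^ 2)))) ≤ δ := by
  have hn0 : (0 : ℝ) < n := by exact_mod_cast hn
  have hM1 : (1 : ℝ) ≤ M := by exact_mod_cast hM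
  have hdn : (d : ℝ) ≤ n := by exact_mod_cast hd
  have hM0 : (0 : ℝ) < M := by linarith
  have h1 := (le_max_left _ _).trans hm
  have h2 := (le_max_right _ _).trans hm
  have e1 : Real.exp (-(m * ξ / (8 * n))) ≤ δ / (2 * M * n) := by
    rw [← Real.exp_log (show 0 < δ / (2 * M * n) by positivity), ← inv_div _ δ, Real.log_inv]
    refine Real.exp_le_exp.2 (neg_le_neg ?_)
    rw [le_div_iff₀ (by positivity)]
    calc Real.log (2 * M * n / δ) * (8 * n) = (8 * n / ξ * Real.log (2 * M * n / δ)) * ξ := by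
          field_simp
      _ ≤ m * ξ := by gcongr
  have e2 : Real.exp (-(ε / n) ^ 2 / (2 * ((m * ξ / 2)⁻¹ * τ ^ 2))) ≤ δ / (4 * M * n) := by
    rw [← Real.exp_log (show 0 < δ / (4 * M * n) by positivity), ← inv_div _ δ, Real.log_inv]
    refine Real.exp_le_exp.2 ?_
    have e3 : -(ε / n) ^ 2 / (2 * ((m * ξ / 2)⁻¹ * τ ^ 2)) =
        -(m * (ε ^ 2 * ξ / (4 * n ^ 2 * τ ^ 2))) := by
      rcases eq_or_ne (m : ℝ) 0 with h0 | h0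
      · simp [h0]
      · field_simp
        ring
    rw [e3]
    refine neg_le_neg ?_
    calc Real.log (4 * M * n / δ) = (4 * n ^ 2 * τ ^ 2 / (ε ^ 2 * ξ) *
          Real.log (4 * M * n / δ)) * (ε ^ 2 * ξ / (4 * n ^ 2 * τ ^ 2)) := by field_simp
      _ ≤ _ := by gcongr
  have f1 : d * Real.exp (-(m * ξ / (8 * n))) ≤ δ / 2 := by
    calc _ ≤ n * (δ / (2 * M * n)) := by gcongr
      _ = δ / 2 / M := by field_simp
      _ ≤ _ := div_le_self (by positivity) hM1
  have f2 : M * d * (2 * Real.exp (-(ε / n) ^ 2 / (2 * ((m * ξ / 2)⁻¹ * τ ^ 2)))) ≤ δ / 2 := by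
    calc _ ≤ M * n * (2 * (δ / (4 * M * n))) := by gcongr
      _ = _ := by field_simp; ring
  linarith

theorem leastSquares_accuracy [IsProbabilityMeasure law]
    (hcube : ∀ᵐ c ∂law, c ∈ cube (Fin n)) {ξ τ ε δ : ℝ}
    (hξ : IsSmallestNonzeroEigenvalue (secondMoment law) ξ) (hM : 1 ≤ M) (hτ : 0 < τ)
    (hε : 0 < ε) (hδ : 0 < δ) (hδ1 : δ < 1) (hm : sampleBound n M ξ τ ε δ ≤ m)
    (hOmem : O ∈ Matrix.orthogonalGroup (Fin n) ℝ)
    (hdiag : Oᵀ * secondMoment law * O = diagonal lam) (s : Fin M → Fin n → ℝ)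
    {Ω : Type*} [MeasurableSpace Ω] {P : Measure Ω} [IsProbabilityMeasure P]
    {c : Fin m → Ω → Fin n → ℝ} {r : Fin m → Ω → Fin M → ℝ}
    (hsample : IsSample P law (fun x k => x ⬝ᵥ s k) τ c r) :
    ∃ E : Set Ω, MeasurableSet E ∧ ENNReal.ofReal (1 - δ) ≤ P E ∧
      ∀ ω ∈ E,
        IsUnit ((reduced (Matrix.of fun i => c i ω) O lam)ᵀ *
          reduced (Matrix.of fun i => c i ω) O lam) ∧
        ∀ (k : Fin M) (shat : Fin n → ℝ),
          (IsReducedEstimate (Matrix.of fun i => c i ω) O lam (fun i => r i ω k) shat ∨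
            IsLeastSquares (Matrix.of fun i => c i ω) (fun i => r i ω k) shat) →
          ∀ x ∈ cube (Fin n), x ∈ visible law → |x ⬝ᵥ shat - x ⬝ᵥ s k| ≤ ε := by
  have hO := mul_transpose_of_mem_orthogonalGroup hOmem
  have hξ0 := smallestNonzeroEigenvalue_pos hcube hξ
  have hn : 0 < n := by
    have := smallestNonzeroEigenvalue_le_card hcube hξ
    have h : (0 : ℝ) < n := hξ0.trans_le this
    exact_mod_cast h
  have hn0 : (0 : ℝ) < n := by exact_mod_cast hn
  have hm0 : (0 : ℝ) < m := (sampleBound_pos hn hM hξ0 hδ hδ1).trans_le hm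
  have hlaw : ∀ (p : (Fin n → ℝ) → Prop) i, (∀ᵐ x ∂law, p x) → ∀ᵐ ω ∂P, p (c i ω) := by
    intro p i hp
    rw [← (hsample.hasLaw i).map_eq] at hp
    exact ae_of_ae_map (hsample.hasLaw i).aemeasurable hp
  have hcae : ∀ i, AEMeasurable (c i) P := fun i => (hsample.hasLaw i).aemeasurable
  set X : Ω → Fin m → Fin n → ℝ := fun ω i => c i ω with hX
  have hXae : AEMeasurable X P := aemeasurable_pi_lambda _ hcae
  -- the rotated challenges
  have hvm : Measurable (visibleCoords O lam) := by
    refine measurable_pi_lambda _ fun j => ?_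
    simp only [visibleCoords, mulVec, dotProduct]
    fun_prop
  set ct : Fin m → Ω → {j : Fin n // lam j ≠ 0} → ℝ := fun i ω => visibleCoords O lam (c i ω)
    with hct
  have hctae : ∀ i, AEMeasurable (ct i) P := fun i => hvm.comp_aemeasurable (hcae i)
  have hctind : iIndepFun ct P := hsample.indep.comp _ fun _ => hvm
  have hctbd : ∀ i, ∀ᵐ ω ∂P, ct i ω ⬝ᵥ ct i ω ≤ n := by
    intro i
    filter_upwards [hlaw _ i hcube] with ω hω
    refine (visibleCoords_dotProduct_self_le hO _).trans ?_
    simpa using dotProduct_self_le_of_mem_cube hω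
  have hctmom : ∀ i v, ξ * (v ⬝ᵥ v) ≤
      v ⬝ᵥ (Matrix.of fun a b => ∫ ω, ct i ω a * ct i ω b ∂P) *ᵥ v := by
    intro i v
    have hmat : (Matrix.of fun a b => ∫ ω, ct i ω a * ct i ω b ∂P) =
        diagonal fun j : {j : Fin n // lam j ≠ 0} => lam j := by
      ext a b
      have h1 : ∫ ω, ct i ω a * ct i ω b ∂P =
          ∫ x, (O.col a ⬝ᵥ x) * (O.col b ⬝ᵥ x) ∂law := by
        rw [← (hsample.hasLaw i).map_eq, integral_map (hcae i)]
        · rfl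
        · refine Measurable.aestronglyMeasurable ?_
          simp only [dotProduct]
          fun_prop
      have h2 : O.col a ⬝ᵥ secondMoment law *ᵥ O.col b = (Oᵀ * secondMoment law * O) a b := by
        rw [Matrix.mul_assoc, Matrix.mul_apply]
        simp [dotProduct, Matrix.mul_apply, mulVec]
      rw [of_apply, h1, integral_dotProduct_mul_dotProduct hcube, h2, hdiag, diagonal_apply,
        diagonal_apply]
      simp [Subtype.ext_iff]
    rw [hmat, dotProduct, dotProduct, Finset.mul_sum]
    refine Finset.sum_le_sum fun j _ => ?_
    rw [mulVec_diagonal]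
    have := smallestNonzeroEigenvalue_le hξ hO hdiag j.2
    nlinarith [mul_self_nonneg (v j)]
  have hchernoff := measure_not_le_quadraticForm_le hctae hctind hn0 hξ0.le hctbd hctmom
  rw [Fintype.card_fin] at hchernoff
  set d := Fintype.card {j : Fin n // lam j ≠ 0} with hd
  have hdn : d ≤ n := by
    have := Fintype.card_subtype_le fun j : Fin n => lam j ≠ 0
    rwa [Fintype.card_fin] at this
  set W : (Fin m → Fin n → ℝ) → Matrix {j : Fin n // lam j ≠ 0} (Fin m) ℝ := fun x =>
    ((reduced (Matrix.of x) O lam)ᵀ * reduced (Matrix.of x) O lam)⁻¹ *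
      (reduced (Matrix.of x) O lam)ᵀ with hW
  set V := (m * ξ / 2)⁻¹ with hV
  set bad0 := {ω | ¬ ∀ v, m * ξ / 2 * (v ⬝ᵥ v) ≤
    v ⬝ᵥ (∑ i, vecMulVec (ct i ω) (ct i ω)) *ᵥ v} with hbad0
  set bad1 : Fin M × {j : Fin n // lam j ≠ 0} → Set Ω := fun kj =>
    {ω | ∑ i, W (X ω) kj.2 i ^ 2 ≤ V ∧
      ε / n ≤ |∑ i, W (X ω) kj.2 i * (r i ω kj.1 - c i ω ⬝ᵥ s kj.1)|} with hbad1
  set bad2 := {ω | ¬ ∀ i, c i ω ∈ visible law} with hbad2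
  have hnull : P bad2 = 0 :=
    ae_iff.1 (ae_all_iff.2 fun i => hlaw _ i (ae_mem_visible hcube))
  have hnoise : ∀ kj, P (bad1 kj) ≤
      ENNReal.ofReal (2 * Real.exp (-(ε / n) ^ 2 / (2 * (V * τ ^ 2)))) := by
    intro kj
    have h := measure_le_abs_random_weighted_sum_le hXae
      (e := fun i ω => r i ω kj.1 - c i ω ⬝ᵥ s kj.1)
      (hsample.noise_indep_challenge kj.1) (hsample.noise_indep kj.1)
      (fun i => hsample.noise_subgaussian i kj.1)
      (measurable_reduced_pinv_apply (O := O) (lam := lam) kj.2) V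
      (t := ε / n) (by positivity)
    rwa [Real.coe_toNNReal _ (sq_nonneg τ)] at h
  set bad := bad0 ∪ (⋃ kj, bad1 kj) ∪ bad2 with hbad
  have hPbad : P bad ≤ ENNReal.ofReal δ := by
    calc P bad ≤ P bad0 + ∑ kj, P (bad1 kj) + P bad2 :=
          (measure_union_le _ _).trans (add_le_add ((measure_union_le _ _).trans
            (add_le_add le_rfl (measure_iUnion_fintype_le _ _))) le_rfl)
      _ ≤ ENNReal.ofReal (d * Real.exp (-(m * ξ / (8 * n)))) +
          ∑ _ : Fin M × {j : Fin n // lam j ≠ 0},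
            ENNReal.ofReal (2 * Real.exp (-(ε / n) ^ 2 / (2 * (V * τ ^ 2)))) + 0 :=
          add_le_add (add_le_add hchernoff (Finset.sum_le_sum fun kj _ => hnoise kj)) hnull.le
      _ = ENNReal.ofReal (d * Real.exp (-(m * ξ / (8 * n))) +
          M * d * (2 * Real.exp (-(ε / n) ^ 2 / (2 * (V * τ ^ 2))))) := by
          rw [add_zero, ENNReal.ofReal_add (by positivity) (by positivity), Finset.sum_const,
            ← ENNReal.ofReal_nsmul, Finset.card_univ, Fintype.card_prod, Fintype.card_fin,
            nsmul_eq_mul, ← hd]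
          push_cast
          rfl
      _ ≤ ENNReal.ofReal δ := ENNReal.ofReal_le_ofReal
          (failure_probability_le hn hdn hM hξ0 hτ hε hδ hm)
  refine ⟨(toMeasurable P bad)ᶜ, (measurableSet_toMeasurable _ _).compl, ?_, fun ω hω => ?_⟩
  · rw [prob_compl_eq_one_sub (measurableSet_toMeasurable _ _), measure_toMeasurable,
      ENNReal.ofReal_sub _ hδ.le, ENNReal.ofReal_one]
    exact tsub_le_tsub_left hPbad _
  have hωbad : ω ∉ bad := fun h => hω (subset_toMeasurable _ _ h)
  simp only [hbad, Set.mem_union, Set.mem_iUnion, not_or, not_exists] at hωbad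
  obtain ⟨⟨hω0, hω1⟩, hω2⟩ := hωbad
  have hco : ∀ v, m * ξ / 2 * (v ⬝ᵥ v) ≤ v ⬝ᵥ ((reduced (Matrix.of (X ω)) O lam)ᵀ *
      reduced (Matrix.of (X ω)) O lam) *ᵥ v := by
    rw [reduced_transpose_mul_self]
    exact not_not.1 hω0
  have hpos : 0 < m * ξ / 2 := by positivity
  have hunit := isUnit_of_coercive hpos hco
  have hvis : ∀ i j, lam j = 0 → (Oᵀ *ᵥ (Matrix.of (X ω)) i) j = 0 := fun i =>
    (mem_visible_iff hO hdiag).1 (not_not.1 hω2 i)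
  refine ⟨hunit, fun k shat hshat x hx hxvis => ?_⟩
  have hred : IsReducedEstimate (Matrix.of (X ω)) O lam (fun i => r i ω k) shat :=
    hshat.elim id (isReducedEstimate_of_isLeastSquares hO hvis hunit)
  have hη : ∀ j, |∑ i, W (X ω) j i * (r i ω k - c i ω ⬝ᵥ s k)| ≤ ε / n := by
    intro j
    have h := hω1 (k, j)
    simp only [hbad1, Set.mem_ofPred_eq, not_and, not_le] at h
    exact (h (sum_sq_pinv_le hpos hco j)).le
  have h := abs_prediction_error_le hO hvis hunit (by positivity) hη hred hx
    ((mem_visible_iff hO hdiag).1 hxvis)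
  rwa [mul_div_cancel₀ _ hn0.ne'] at h

end Regression

section Program

theorem Program.run_loop_induction {x y : ℕ} {p : Program} {σ : State} {Inv : ℕ → State → Prop}
    {c : ℕ} (h0 : Inv 0 σ)
    (hstep : ∀ k < σ.reg y, ∀ τ, Inv k τ →
      Inv (k + 1) (p.run (τ.setReg x k)).1 ∧ (p.run (τ.setReg x k)).2 ≤ c) :
    Inv (σ.reg y) ((Program.loop x y p).run σ).1 ∧
      ((Program.loop x y p).run σ).2 ≤ 1 + σ.reg y * (c + 1) := by
  simp only [Program.run]
  have key : ∀ v ≤ σ.reg y,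
      Inv v (Nat.rec (motive := fun _ => State × ℕ) (σ, 1)
        (fun k acc => ((p.run (acc.1.setReg x k)).1,
          acc.2 + (p.run (acc.1.setReg x k)).2 + 1)) v).1 ∧
      (Nat.rec (motive := fun _ => State × ℕ) (σ, 1)
        (fun k acc => ((p.run (acc.1.setReg x k)).1,
          acc.2 + (p.run (acc.1.setReg x k)).2 + 1)) v).2 ≤ 1 + v * (c + 1) := by
    intro v
    induction v with
    | zero => intro _; exact ⟨h0, by simp⟩
    | succ k ih =>
      intro hk
      obtain ⟨h1, h2⟩ := ih (by omega)
      obtain ⟨h3, h4⟩ := hstep k (by omega) _ h1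
      refine ⟨h3, ?_⟩
      rw [add_mul, one_mul]
      dsimp only at h2 ⊢
      omega
  exact key _ le_rfl

/-- The inner product of the first `m` entries. -/
noncomputable def ip (m : ℕ) (u v : ℕ → ℝ) : ℝ := ∑ l ∈ Finset.range m, u l * v l

/-- The scalar stored in entry `(0, 0)` of array `a`, when register 6 holds 0. -/
def scalarCell (a : ℕ) : Cell := ⟨a, 6, 6⟩

/-- Stores in scalar `s` the inner product of column `reg 4` of array 0 and column `reg c` of
array `a`. -/
def dotProgram (s a c : ℕ) : Program :=
  .seq (.zero (scalarCell s)) (.loop 5 1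
    (.seq (.arith .mul (scalarCell 6) ⟨0, 5, 4⟩ ⟨a, 5, c⟩)
      (.arith .add (scalarCell s) (scalarCell s) (scalarCell 6))))

theorem dotProgram_spec {s a c : ℕ} (hs : s ≠ 6) (hs0 : s ≠ 0) (ha : a ≠ s) (ha6 : a ≠ 6)
    (hc : c ≠ 5) {σ : State} (h6 : σ.reg 6 = 0) :
    ((∀ x, x ≠ 5 → ((dotProgram s a c).run σ).1.reg x = σ.reg x) ∧
      (∀ b, b ≠ s → b ≠ 6 → ((dotProgram s a c).run σ).1.mem b = σ.mem b) ∧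
      ((dotProgram s a c).run σ).1.mem s 0 0 =
        ip (σ.reg 1) (fun l => σ.mem 0 l (σ.reg 4)) (fun l => σ.mem a l (σ.reg c))) ∧
    ((dotProgram s a c).run σ).2 ≤ 2 + 3 * σ.reg 1 := by
  set σ1 := σ.set (scalarCell s) 0 with hσ1
  have h := Program.run_loop_induction (x := 5) (y := 1) (σ := σ1) (c := 2)
    (p := .seq (.arith .mul (scalarCell 6) ⟨0, 5, 4⟩ ⟨a, 5, c⟩)
      (.arith .add (scalarCell s) (scalarCell s) (scalarCell 6)))
    (Inv := fun k τ => (∀ x, x ≠ 5 → τ.reg x = σ.reg x) ∧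
      (∀ b, b ≠ s → b ≠ 6 → τ.mem b = σ.mem b) ∧
      τ.mem s 0 0 = ip k (fun l => σ.mem 0 l (σ.reg 4)) (fun l => σ.mem a l (σ.reg c)))
    ⟨fun _ _ => rfl, fun b hb _ => by
      funext i j; simp [hσ1, State.set, scalarCell, hb],
      by simp [hσ1, State.set, scalarCell, h6, ip]⟩
    (fun k _ τ ⟨hr, hm, hv⟩ => by
      refine ⟨⟨fun x hx => ?_, fun b hb hb6 => ?_, ?_⟩, ?_⟩
      · simp [Program.run, State.set, State.setReg, hx, hr x hx]
      · funext i j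
        simp [Program.run, State.set, State.setReg, scalarCell, hb, hb6, hm b hb hb6]
      · simp [Program.run, State.set, State.get, State.setReg, scalarCell, hs, hc, hr 6 (by simp),
          hr 4 (by simp), hr c hc, h6, Op.eval, hv, ip, Finset.sum_range_succ, hm 0 hs0.symm,
          hm a ha ha6]
      · simp [Program.run])
  have e : (dotProgram s a c).run σ = ((Program.loop 5 1
    (.seq (.arith .mul (scalarCell 6) ⟨0, 5, 4⟩ ⟨a, 5, c⟩)
      (.arith .add (scalarCell s) (scalarCell s) (scalarCell 6)))).run σ1 |>.1,
      1 + ((Program.loop 5 1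
    (.seq (.arith .mul (scalarCell 6) ⟨0, 5, 4⟩ ⟨a, 5, c⟩)
      (.arith .add (scalarCell s) (scalarCell s) (scalarCell 6)))).run σ1).2) := rfl
  have e1 : σ1.reg 1 = σ.reg 1 := rfl
  rw [e1] at h
  rw [e]
  refine ⟨h.1, ?_⟩
  have := h.2
  dsimp only
  omega

/-- Adds to (or subtracts from) the first `reg y` entries of column `reg c` of array `a` those of
column `reg 4` of array `b`, multiplied by scalar 4. -/
def axpyProgram (op : Op) (a b y c : ℕ) : Program :=
  .loop 5 y (.seq (.arith .mul (scalarCell 6) (scalarCell 4) ⟨b, 5, 4⟩)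
    (.arith op ⟨a, 5, c⟩ ⟨a, 5, c⟩ (scalarCell 6)))

theorem axpyProgram_spec {op : Op} {a b y c : ℕ} (ha : a ≠ 6) (ha4 : a ≠ 4) (hb : b ≠ 6)
    (hc : c ≠ 5) {σ : State} (h6 : σ.reg 6 = 0) (hab : a = b → σ.reg 4 ≠ σ.reg c) :
    ((∀ x, x ≠ 5 → ((axpyProgram op a b y c).run σ).1.reg x = σ.reg x) ∧
      (∀ d, d ≠ a → d ≠ 6 → ((axpyProgram op a b y c).run σ).1.mem d = σ.mem d) ∧
      ∀ l j, ((axpyProgram op a b y c).run σ).1.mem a l j =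
        if l < σ.reg y ∧ j = σ.reg c then
          op.eval (σ.mem a l j) (σ.mem 4 0 0 * σ.mem b l (σ.reg 4))
        else σ.mem a l j) ∧
    ((axpyProgram op a b y c).run σ).2 ≤ 1 + 3 * σ.reg y := by
  have h := Program.run_loop_induction (x := 5) (y := y) (σ := σ) (c := 2)
    (p := .seq (.arith .mul (scalarCell 6) (scalarCell 4) ⟨b, 5, 4⟩)
      (.arith op ⟨a, 5, c⟩ ⟨a, 5, c⟩ (scalarCell 6)))
    (Inv := fun k τ => (∀ x, x ≠ 5 → τ.reg x = σ.reg x) ∧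
      (∀ d, d ≠ a → d ≠ 6 → τ.mem d = σ.mem d) ∧
      ∀ l j, τ.mem a l j = if l < k ∧ j = σ.reg c then
          op.eval (σ.mem a l j) (σ.mem 4 0 0 * σ.mem b l (σ.reg 4))
        else σ.mem a l j)
    ⟨fun _ _ => rfl, fun _ _ _ => rfl, by simp⟩
    (fun k _ τ ⟨hr, hm, hv⟩ => by
      have hbm : τ.mem b k (σ.reg 4) = σ.mem b k (σ.reg 4) := by
        by_cases h : b = a
        · subst h
          rw [hv, if_neg]
          exact fun h => hab rfl h.2
        · rw [hm b h hb]
      refine ⟨⟨fun x hx => ?_, fun d hd hd6 => ?_, fun l j => ?_⟩, ?_⟩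
      · simp [Program.run, State.set, State.setReg, hx, hr x hx]
      · funext i j
        simp [Program.run, State.set, State.setReg, scalarCell, hd, hd6, hm d hd hd6]
      · by_cases hj : j = σ.reg c
        · rcases lt_trichotomy l k with hl | hl | hl
          · simp [Program.run, State.set, State.get, State.setReg, scalarCell, hc,
              hr 6 (by simp), hr 4 (by simp), hr c hc, h6, hj, hl.ne, ha, hv, hl,
              Nat.lt_succ_of_lt hl]
          · simp [Program.run, State.set, State.get, State.setReg, scalarCell, hc,
              hr 6 (by simp), hr 4 (by simp), hr c hc, h6, hj, hl, ha, hv, hbm,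
              hm 4 ha4.symm (by simp)]
            rfl
          · have : ¬ l < k + 1 := by omega
            simp [Program.run, State.set, State.get, State.setReg, scalarCell, hc,
              hr 6 (by simp), hr 4 (by simp), hr c hc, h6, hj, hl.ne', ha, hv, this,
              not_lt.2 hl.le]
        · simp [Program.run, State.set, State.get, State.setReg, scalarCell, hc, hr c hc, hj, ha, hv]
      · simp [Program.run])
  refine ⟨h.1, ?_⟩
  have := h.2
  simp only [axpyProgram]
  omega

end Program

section Sweep

/-- Makes column `reg c` of array `ra` orthogonal to column `i = reg 4` of array 0 by subtracting a
multiple of it, and adds (or subtracts) the same multiple of column `i` of array 3 to column `reg c`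
of array `va`. Division by zero makes the multiple vanish if column `i` of array 0 does. -/
def projectProgram (op : Op) (ra va c : ℕ) : Program :=
  .seq (dotProgram 4 ra c) (.seq (dotProgram 5 0 4)
    (.seq (.arith .div (scalarCell 4) (scalarCell 4) (scalarCell 5))
      (.seq (axpyProgram .sub ra 0 1 c) (axpyProgram op va 3 0 c))))

/-- The coefficient of the orthogonal projection of `v` onto the line spanned by `q`. -/
noncomputable def projCoeff (m : ℕ) (q v : ℕ → ℝ) : ℝ := ip m q v / ip m q q

theorem projectProgram_spec {op : Op} {ra va c : ℕ} (hra : ra ≠ 3 ∧ ra ≠ 4 ∧ ra ≠ 5 ∧ ra ≠ 6)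
    (hva : va ≠ 0 ∧ va ≠ 4 ∧ va ≠ 5 ∧ va ≠ 6) (hrv : ra ≠ va) (hc : c ≠ 5) {σ : State}
    (h6 : σ.reg 6 = 0) (hra0 : ra = 0 → σ.reg 4 ≠ σ.reg c) (hva3 : va = 3 → σ.reg 4 ≠ σ.reg c) :
    ((∀ x, x ≠ 5 → ((projectProgram op ra va c).run σ).1.reg x = σ.reg x) ∧
      (∀ b, b ≠ ra → b ≠ va → b ≠ 4 → b ≠ 5 → b ≠ 6 →
        ((projectProgram op ra va c).run σ).1.mem b = σ.mem b) ∧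
      (∀ l j, ((projectProgram op ra va c).run σ).1.mem ra l j =
        if l < σ.reg 1 ∧ j = σ.reg c then σ.mem ra l j -
          projCoeff (σ.reg 1) (fun l => σ.mem 0 l (σ.reg 4)) (fun l => σ.mem ra l (σ.reg c)) *
            σ.mem 0 l (σ.reg 4)
        else σ.mem ra l j) ∧
      ∀ l j, ((projectProgram op ra va c).run σ).1.mem va l j =
        if l < σ.reg 0 ∧ j = σ.reg c then op.eval (σ.mem va l j)
          (projCoeff (σ.reg 1) (fun l => σ.mem 0 l (σ.reg 4)) (fun l => σ.mem ra l (σ.reg c)) *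
            σ.mem 3 l (σ.reg 4))
        else σ.mem va l j) ∧
    ((projectProgram op ra va c).run σ).2 ≤ 7 + 9 * σ.reg 1 + 3 * σ.reg 0 := by
  obtain ⟨hra3, hra4, hra5, hra6⟩ := hra
  obtain ⟨hva0, hva4, hva5, hva6⟩ := hva
  obtain ⟨⟨r1, m1, v1⟩, t1⟩ := dotProgram_spec (s := 4) (a := ra) (c := c) (by simp) (by simp)
    hra4 hra6 hc h6
  set σ1 := ((dotProgram 4 ra c).run σ).1 with hσ1
  obtain ⟨⟨r2, m2, v2⟩, t2⟩ := dotProgram_spec (s := 5) (a := 0) (c := 4) (σ := σ1) (by simp)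
    (by simp) (by simp) (by simp) (by simp) (by rw [r1 6 (by simp), h6])
  set σ2 := ((dotProgram 5 0 4).run σ1).1 with hσ2
  set σ3 := ((Program.arith .div (scalarCell 4) (scalarCell 4) (scalarCell 5)).run σ2).1 with hσ3
  have r26 : σ2.reg 6 = 0 := by rw [r2 6 (by simp), r1 6 (by simp), h6]
  have r3 : ∀ x, σ3.reg x = σ2.reg x := fun _ => rfl
  have r3' : ∀ x, x ≠ 5 → σ3.reg x = σ.reg x := fun x hx => by rw [r3, r2 x hx, r1 x hx]
  have m3 : ∀ b, b ≠ 4 → σ3.mem b = σ2.mem b := by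
    intro b hb
    funext i j
    simp [hσ3, Program.run, State.set, scalarCell, hb]
  have m3' : ∀ b, b ≠ 4 → b ≠ 5 → b ≠ 6 → σ3.mem b = σ.mem b := fun b h4 h5 h6 => by
    rw [m3 b h4, m2 b h5 h6, m1 b h4 h6]
  set coef := projCoeff (σ.reg 1) (fun l => σ.mem 0 l (σ.reg 4))
    (fun l => σ.mem ra l (σ.reg c)) with hcoef
  have v3 : σ3.mem 4 0 0 = coef := by
    have : σ3.mem 4 0 0 = σ2.mem 4 0 0 / σ2.mem 5 0 0 := by
      simp [hσ3, Program.run, State.set, State.get, scalarCell, r26, Op.eval]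
    rw [this, v2, m2 4 (by simp) (by simp), v1, r1 1 (by simp), r1 4 (by simp),
      m1 0 (by simp) (by simp)]
    rfl
  obtain ⟨⟨r4, m4, v4⟩, t4⟩ := axpyProgram_spec (op := .sub) (a := ra) (b := 0) (y := 1) (c := c)
    (σ := σ3) hra6 hra4 (by simp) hc (by rw [r3, r26])
    (by rw [r3' 4 (by simp), r3' c hc]; exact hra0)
  set σ4 := ((axpyProgram .sub ra 0 1 c).run σ3).1 with hσ4
  obtain ⟨⟨r5, m5, v5⟩, t5⟩ := axpyProgram_spec (op := op) (a := va) (b := 3) (y := 0) (c := c)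
    (σ := σ4) hva6 hva4 (by simp) hc (by rw [r4 6 (by simp), r3, r26])
    (by rw [r4 4 (by simp), r4 c hc, r3' 4 (by simp), r3' c hc]; exact hva3)
  set σ5 := ((axpyProgram op va 3 0 c).run σ4).1 with hσ5
  have hrun : ((projectProgram op ra va c).run σ).1 = σ5 := rfl
  have hsteps : ((projectProgram op ra va c).run σ).2 = ((dotProgram 4 ra c).run σ).2 +
      (((dotProgram 5 0 4).run σ1).2 + (1 + (((axpyProgram .sub ra 0 1 c).run σ3).2 +
        ((axpyProgram op va 3 0 c).run σ4).2))) := rfl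
  rw [hrun, hsteps]
  refine ⟨⟨fun x hx => ?_, fun b h1 h2 h3 h4 h5 => ?_, fun l j => ?_, fun l j => ?_⟩, ?_⟩
  · rw [r5 x hx, r4 x hx, r3' x hx]
  · rw [m5 b h2 h5, m4 b h1 h5, m3' b h3 h4 h5]
  · rw [m5 ra hrv hra6, v4, v3, r3' 1 (by simp), r3' c hc, r3' 4 (by simp),
      m3' ra hra4 hra5 hra6, m3' 0 (by simp) (by simp) (by simp)]
    rfl
  · rw [v5, r4 0 (by simp), r4 c hc, r4 4 (by simp), r3' 0 (by simp), r3' c hc, r3' 4 (by simp),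
      m4 va hrv.symm hva6, m4 4 hra4.symm (by simp), m4 3 hra3.symm (by simp), v3,
      m3' va hva4 hva5 hva6, m3' 3 (by simp) (by simp) (by simp)]
  · rw [r1 1 (by simp)] at t2
    rw [r3' 1 (by simp)] at t4
    rw [r4 0 (by simp), r3' 0 (by simp)] at t5
    omega

theorem ip_comm (m : ℕ) (u v : ℕ → ℝ) : ip m u v = ip m v u := by
  simp only [ip, mul_comm]

theorem ip_sub_mul (m : ℕ) (u v w : ℕ → ℝ) (a : ℝ) :
    ip m u (fun l => v l - a * w l) = ip m u v - a * ip m u w := by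
  simp only [ip, Finset.mul_sum, ← Finset.sum_sub_distrib]
  exact Finset.sum_congr rfl fun l _ => by ring

theorem ip_congr {m : ℕ} {u u' v v' : ℕ → ℝ} (hu : ∀ l < m, u l = u' l) (hv : ∀ l < m, v l = v' l) :
    ip m u v = ip m u' v' :=
  Finset.sum_congr rfl fun l hl => by
    rw [hu l (Finset.mem_range.1 hl), hv l (Finset.mem_range.1 hl)]

theorem ip_sub_projCoeff_mul (m : ℕ) (q v : ℕ → ℝ) :
    ip m q (fun l => v l - projCoeff m q v * q l) = 0 := by
  rw [ip_sub_mul]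
  by_cases h : ip m q q = 0
  · have hq : ∀ l ∈ Finset.range m, q l = 0 := by
      intro l hl
      have := (Finset.sum_eq_zero_iff_of_nonneg fun l _ => mul_self_nonneg (q l)).1 h l hl
      exact mul_self_eq_zero.1 this
    have h1 : ip m q v = 0 := Finset.sum_eq_zero fun l hl => by rw [hq l hl, zero_mul]
    rw [h, h1]; simp
  · rw [projCoeff, div_mul_cancel₀ _ h, sub_self]

/-- Makes column `reg c` of array `ra` orthogonal to the first `reg y` columns of array 0. -/
def sweepProgram (op : Op) (ra va y c : ℕ) : Program := .loop 4 y (projectProgram op ra va c)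

theorem sweepProgram_spec {op : Op} {ra va y c : ℕ} {s : ℝ} (hop : ∀ a b, op.eval a b = a + s * b)
    (hs : s * s = 1) (hra : ra ≠ 3 ∧ ra ≠ 4 ∧ ra ≠ 5 ∧ ra ≠ 6)
    (hva : va ≠ 0 ∧ va ≠ 4 ∧ va ≠ 5 ∧ va ≠ 6) (hrv : ra ≠ va) (hc4 : c ≠ 4) (hc : c ≠ 5)
    {σ : State} (h6 : σ.reg 6 = 0)
    (hra0 : ra = 0 → σ.reg y ≤ σ.reg c) (hva3 : va = 3 → σ.reg y ≤ σ.reg c) {C : ℕ → ℕ → ℝ}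
    (hQ : ∀ a < σ.reg y, ∀ l < σ.reg 1,
      ip (σ.reg 0) (C l) (fun b => σ.mem 3 b a) = σ.mem 0 l a)
    (horth : ∀ a < σ.reg y, ∀ b < σ.reg y, a ≠ b →
      ip (σ.reg 1) (fun l => σ.mem 0 l a) (fun l => σ.mem 0 l b) = 0) :
    ((∀ x, x ≠ 4 → x ≠ 5 → ((sweepProgram op ra va y c).run σ).1.reg x = σ.reg x) ∧
      (∀ b, b ≠ ra → b ≠ va → b ≠ 4 → b ≠ 5 → b ≠ 6 →
        ((sweepProgram op ra va y c).run σ).1.mem b = σ.mem b) ∧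
      (∀ l j, j ≠ σ.reg c → ((sweepProgram op ra va y c).run σ).1.mem ra l j = σ.mem ra l j) ∧
      (∀ l j, j ≠ σ.reg c → ((sweepProgram op ra va y c).run σ).1.mem va l j = σ.mem va l j) ∧
      (∀ a < σ.reg y, ip (σ.reg 1) (fun l => σ.mem 0 l a)
        (fun l => ((sweepProgram op ra va y c).run σ).1.mem ra l (σ.reg c)) = 0) ∧
      (∀ l < σ.reg 1, ((sweepProgram op ra va y c).run σ).1.mem ra l (σ.reg c) +
        s * ip (σ.reg 0) (C l) (fun b => ((sweepProgram op ra va y c).run σ).1.mem va b (σ.reg c)) =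
          σ.mem ra l (σ.reg c) + s * ip (σ.reg 0) (C l) (fun b => σ.mem va b (σ.reg c))) ∧
      ∀ u : ℕ → ℝ, (∀ a < σ.reg y, ip (σ.reg 1) u (fun l => σ.mem 0 l a) = 0) →
        ip (σ.reg 1) u (fun l => ((sweepProgram op ra va y c).run σ).1.mem ra l (σ.reg c)) =
          ip (σ.reg 1) u (fun l => σ.mem ra l (σ.reg c))) ∧
    ((sweepProgram op ra va y c).run σ).2 ≤
      1 + σ.reg y * (8 + 9 * σ.reg 1 + 3 * σ.reg 0) := by
  have h := Program.run_loop_induction (x := 4) (y := y) (σ := σ)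
    (c := 7 + 9 * σ.reg 1 + 3 * σ.reg 0) (p := projectProgram op ra va c)
    (Inv := fun k τ => (∀ x, x ≠ 4 → x ≠ 5 → τ.reg x = σ.reg x) ∧
      (∀ b, b ≠ ra → b ≠ va → b ≠ 4 → b ≠ 5 → b ≠ 6 → τ.mem b = σ.mem b) ∧
      (∀ l j, j ≠ σ.reg c → τ.mem ra l j = σ.mem ra l j) ∧
      (∀ l j, j ≠ σ.reg c → τ.mem va l j = σ.mem va l j) ∧
      (∀ a < k, ip (σ.reg 1) (fun l => σ.mem 0 l a) (fun l => τ.mem ra l (σ.reg c)) = 0) ∧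
      (∀ l < σ.reg 1, τ.mem ra l (σ.reg c) +
        s * ip (σ.reg 0) (C l) (fun b => τ.mem va b (σ.reg c)) =
          σ.mem ra l (σ.reg c) + s * ip (σ.reg 0) (C l) (fun b => σ.mem va b (σ.reg c))) ∧
      ∀ u : ℕ → ℝ, (∀ a < σ.reg y, ip (σ.reg 1) u (fun l => σ.mem 0 l a) = 0) →
        ip (σ.reg 1) u (fun l => τ.mem ra l (σ.reg c)) =
          ip (σ.reg 1) u (fun l => σ.mem ra l (σ.reg c)))
    ⟨fun _ _ _ => rfl, fun _ _ _ _ _ _ => rfl, fun _ _ _ => rfl, fun _ _ _ => rfl,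
      fun _ h => absurd h (by simp), fun _ _ => rfl, fun _ _ => rfl⟩
    (fun k hk τ ⟨ir, im, ira, iva, iorth, ieq, ispan⟩ => by
      set τ0 := τ.setReg 4 k with hτ0
      have r04 : τ0.reg 4 = k := by simp [hτ0, State.setReg]
      have r0 : ∀ x, x ≠ 4 → x ≠ 5 → τ0.reg x = σ.reg x := fun x h4 h5 => by
        simp [hτ0, State.setReg, h4, ir x h4 h5]
      have mm : ∀ b, τ0.mem b = τ.mem b := fun _ => rfl
      have q0 : ∀ l, τ.mem 0 l k = σ.mem 0 l k := by
        intro l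
        by_cases h : ra = 0
        · have := hra0 h
          rw [← h, ira l k (by omega)]
        · rw [im 0 (Ne.symm h) hva.1.symm (by simp) (by simp) (by simp)]
      have q3 : ∀ l, τ.mem 3 l k = σ.mem 3 l k := by
        intro l
        by_cases h : va = 3
        · have := hva3 h
          rw [← h, iva l k (by omega)]
        · rw [im 3 hra.1.symm (Ne.symm h) (by simp) (by simp) (by simp)]
      obtain ⟨⟨pr, pm, pra, pva⟩, pt⟩ := projectProgram_spec (op := op) hra hva hrv hc (σ := τ0)
        (by rw [r0 6 (by simp) (by simp), h6])
        (fun h => by have := hra0 h; rw [r04, r0 c hc4 hc]; omega)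
        (fun h => by have := hva3 h; rw [r04, r0 c hc4 hc]; omega)
      simp only [r04, r0 0 (by simp) (by simp), r0 1 (by simp) (by simp), r0 c hc4 hc, mm, q0,
        q3] at pra pva pt
      set τ1 := ((projectProgram op ra va c).run τ0).1 with hτ1
      set coef := projCoeff (σ.reg 1) (fun l => σ.mem 0 l k) (fun l => τ.mem ra l (σ.reg c))
        with hcoef
      have ura : ∀ u : ℕ → ℝ, ip (σ.reg 1) u (fun l => τ1.mem ra l (σ.reg c)) =
          ip (σ.reg 1) u (fun l => τ.mem ra l (σ.reg c) - coef * σ.mem 0 l k) := fun u =>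
        ip_congr (fun _ _ => rfl) fun l hl => by rw [pra, if_pos ⟨hl, rfl⟩]
      refine ⟨⟨fun x h4 h5 => ?_, fun b h1 h2 h3 h4 h5 => ?_, fun l j hj => ?_, fun l j hj => ?_,
        fun a ha => ?_, fun l hl => ?_, fun u hu => ?_⟩, pt⟩
      · rw [pr x h5, r0 x h4 h5]
      · rw [pm b h1 h2 h3 h4 h5, mm, im b h1 h2 h3 h4 h5]
      · rw [pra, if_neg fun h => hj h.2, ira l j hj]
      · rw [pva, if_neg fun h => hj h.2, iva l j hj]
      · rw [ura]
        rcases Nat.lt_succ_iff_lt_or_eq.1 ha with h | h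
        · rw [ip_sub_mul, iorth a h, horth a (by omega) k hk h.ne, mul_zero, sub_zero]
        · rw [h, hcoef]
          exact ip_sub_projCoeff_mul _ _ _
      · have e : ip (σ.reg 0) (C l) (fun b => τ1.mem va b (σ.reg c)) =
            ip (σ.reg 0) (C l) (fun b => τ.mem va b (σ.reg c)) + s * coef * σ.mem 0 l k := by
          have e1 : ip (σ.reg 0) (C l) (fun b => τ1.mem va b (σ.reg c)) =
              ip (σ.reg 0) (C l)
                (fun b => τ.mem va b (σ.reg c) - (-(s * coef)) * σ.mem 3 b k) :=
            ip_congr (fun _ _ => rfl) fun b hb => by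
              rw [pva, if_pos ⟨hb, rfl⟩, hop]; ring
          rw [e1, ip_sub_mul, hQ k hk l hl]
          ring
        rw [e, pra, if_pos ⟨hl, rfl⟩, ← ieq l hl]
        linear_combination coef * σ.mem 0 l k * hs
      · rw [ura, ip_sub_mul, hu k hk, mul_zero, sub_zero, ispan u hu])
  refine ⟨h.1, ?_⟩
  have := h.2
  simp only [sweepProgram]
  calc _ ≤ _ := this
    _ = _ := by ring

end Sweep

section LeastSquaresProgram

/-- Gram–Schmidt orthogonalization of the columns of array 0. Array 3 receives the coefficients that
express the new columns through the old ones. -/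
def orthogonalizeProgram : Program :=
  .loop 3 0 (.seq (.one ⟨3, 3, 3⟩) (sweepProgram .sub 0 3 3 3))

theorem orthogonalizeProgram_spec {σ : State} (h6 : σ.reg 6 = 0) (h3 : ∀ l j, σ.mem 3 l j = 0) :
    ((∀ x, x ≠ 3 → x ≠ 4 → x ≠ 5 → (orthogonalizeProgram.run σ).1.reg x = σ.reg x) ∧
      (∀ b, b ≠ 0 → b ≠ 3 → b ≠ 4 → b ≠ 5 → b ≠ 6 →
        (orthogonalizeProgram.run σ).1.mem b = σ.mem b) ∧
      (∀ l a, σ.reg 0 ≤ a → (orthogonalizeProgram.run σ).1.mem 0 l a = σ.mem 0 l a ∧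
        (orthogonalizeProgram.run σ).1.mem 3 l a = 0) ∧
      (∀ a < σ.reg 0, ∀ l < σ.reg 1,
        ip (σ.reg 0) (σ.mem 0 l) (fun b => (orthogonalizeProgram.run σ).1.mem 3 b a) =
          (orthogonalizeProgram.run σ).1.mem 0 l a) ∧
      (∀ a < σ.reg 0, ∀ b < σ.reg 0, a ≠ b →
        ip (σ.reg 1) (fun l => (orthogonalizeProgram.run σ).1.mem 0 l a)
          (fun l => (orthogonalizeProgram.run σ).1.mem 0 l b) = 0) ∧
      ∀ u : ℕ → ℝ, (∀ a < σ.reg 0,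
        ip (σ.reg 1) u (fun l => (orthogonalizeProgram.run σ).1.mem 0 l a) = 0) →
        ∀ a < σ.reg 0, ip (σ.reg 1) u (fun l => σ.mem 0 l a) = 0) ∧
    (orthogonalizeProgram.run σ).2 ≤
      1 + σ.reg 0 * (3 + σ.reg 0 * (8 + 9 * σ.reg 1 + 3 * σ.reg 0)) := by
  have h := Program.run_loop_induction (x := 3) (y := 0) (σ := σ)
    (c := 2 + σ.reg 0 * (8 + 9 * σ.reg 1 + 3 * σ.reg 0))
    (p := .seq (.one ⟨3, 3, 3⟩) (sweepProgram .sub 0 3 3 3))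
    (Inv := fun k τ => (∀ x, x ≠ 3 → x ≠ 4 → x ≠ 5 → τ.reg x = σ.reg x) ∧
      (∀ b, b ≠ 0 → b ≠ 3 → b ≠ 4 → b ≠ 5 → b ≠ 6 → τ.mem b = σ.mem b) ∧
      (∀ l a, k ≤ a → τ.mem 0 l a = σ.mem 0 l a ∧ τ.mem 3 l a = 0) ∧
      (∀ a < k, ∀ l < σ.reg 1,
        ip (σ.reg 0) (σ.mem 0 l) (fun b => τ.mem 3 b a) = τ.mem 0 l a) ∧
      (∀ a < k, ∀ b < k, a ≠ b →
        ip (σ.reg 1) (fun l => τ.mem 0 l a) (fun l => τ.mem 0 l b) = 0) ∧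
      ∀ u : ℕ → ℝ, (∀ a < k, ip (σ.reg 1) u (fun l => τ.mem 0 l a) = 0) →
        ∀ a < k, ip (σ.reg 1) u (fun l => σ.mem 0 l a) = 0)
    ⟨fun _ _ _ _ => rfl, fun _ _ _ _ _ _ => rfl, fun l a _ => ⟨rfl, h3 l a⟩,
      fun _ h => absurd h (by simp), fun _ h => absurd h (by simp), fun _ _ _ h => absurd h (by simp)⟩
    (fun k hk τ ⟨ir, im, inew, ieq, iorth, ispan⟩ => by
      set τ1 := ((Program.one ⟨3, 3, 3⟩).run (τ.setReg 3 k)).1 with hτ1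
      have r13 : τ1.reg 3 = k := by simp [hτ1, Program.run, State.set, State.setReg]
      have r1 : ∀ x, x ≠ 3 → x ≠ 4 → x ≠ 5 → τ1.reg x = σ.reg x := fun x hx3 hx4 hx5 => by
        simp [hτ1, Program.run, State.set, State.setReg, hx3, ir x hx3 hx4 hx5]
      have m1 : ∀ b, b ≠ 3 → τ1.mem b = τ.mem b := fun b hb => by
        funext i j
        simp [hτ1, Program.run, State.set, State.setReg, hb]
      have m13 : ∀ l a, τ1.mem 3 l a = if l = k ∧ a = k then 1 else τ.mem 3 l a := fun l a => by
        simp [hτ1, Program.run, State.set, State.setReg]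
      have r10 := r1 0 (by simp) (by simp) (by simp)
      have r11 := r1 1 (by simp) (by simp) (by simp)
      have V1 : ∀ a < k, ∀ l, τ1.mem 3 l a = τ.mem 3 l a := fun a ha l => by
        rw [m13, if_neg]; omega
      have hsweep := sweepProgram_spec (op := .sub) (ra := 0) (va := 3) (y := 3) (c := 3) (s := -1)
        (fun a b => by simp [Op.eval, sub_eq_add_neg]) (by ring) (by simp) (by simp) (by simp)
        (by simp) (by simp) (σ := τ1) (by rw [r1 6 (by simp) (by simp) (by simp), h6])
        (fun _ => le_rfl) (fun _ => le_rfl) (C := σ.mem 0)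
        (by
          intro a ha l hl
          rw [r13] at ha
          rw [r11] at hl
          rw [r10, m1 0 (by simp), ← ieq a ha l hl]
          simp only [V1 a ha])
        (by
          intro a ha b hb hab
          rw [r13] at ha hb
          rw [r11, m1 0 (by simp)]
          exact iorth a ha b hb hab)
      obtain ⟨⟨pr, pm, pra, pva, porth, peq, pspan⟩, pt⟩ := hsweep
      simp only [r13, r11, r10, m1 0 (show 0 ≠ 3 by simp)] at pra pva porth peq pspan pt
      set τ2 := ((sweepProgram .sub 0 3 3 3).run τ1).1 with hτ2
      have hrun : ((Program.seq (.one ⟨3, 3, 3⟩) (sweepProgram .sub 0 3 3 3)).run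
        (τ.setReg 3 k)).1 = τ2 := rfl
      have hsteps : ((Program.seq (.one ⟨3, 3, 3⟩) (sweepProgram .sub 0 3 3 3)).run
        (τ.setReg 3 k)).2 = 1 + ((sweepProgram .sub 0 3 3 3).run τ1).2 := rfl
      rw [hrun, hsteps]
      have Q2 : ∀ a < k, ∀ l, τ2.mem 0 l a = τ.mem 0 l a := fun a ha l => pra l a ha.ne
      refine ⟨⟨fun x hx3 hx4 hx5 => ?_, fun b h1 h2 h3 h4 h5 => ?_, fun l a ha => ?_,
        fun a ha l hl => ?_, fun a ha b hb hab => ?_, fun u hu a ha => ?_⟩, ?_⟩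
      · rw [pr x hx4 hx5, r1 x hx3 hx4 hx5]
      · rw [pm b h1 h2 h3 h4 h5, m1 b h2, im b h1 h2 h3 h4 h5]
      · rw [pra l a (by omega), pva l a (by omega), m13, if_neg (by omega)]
        exact inew l a (by omega)
      · rcases Nat.lt_succ_iff_lt_or_eq.1 ha with h | h
        · rw [Q2 a h, ← ieq a h l hl]
          exact ip_congr (fun _ _ => rfl) fun b _ => by rw [pva b a h.ne, V1 a h]
        · subst h
          have e : ip (σ.reg 0) (σ.mem 0 l) (fun b => τ1.mem 3 b a) = σ.mem 0 l a := by
            have : ∀ b, τ1.mem 3 b a = if b = a then 1 else 0 := fun b => by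
              rw [m13, (inew b a le_rfl).2]; simp
            simp [ip, this, hk]
          have := peq l hl
          rw [e, (inew l a le_rfl).1] at this
          linarith
      · have key : ∀ a < k, ip (σ.reg 1) (fun l => τ2.mem 0 l a) (fun l => τ2.mem 0 l k) = 0 := by
          intro a ha
          simp only [Q2 a ha]
          exact porth a ha
        rcases Nat.lt_succ_iff_lt_or_eq.1 ha with ha' | ha' <;>
          rcases Nat.lt_succ_iff_lt_or_eq.1 hb with hb' | hb'
        · simp only [Q2 a ha', Q2 b hb']
          exact iorth a ha' b hb' hab
        · rw [hb']; exact key a ha'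
        · rw [ha', ip_comm]; exact key b hb'
        · omega
      · have hu' : ∀ a < k, ip (σ.reg 1) u (fun l => τ.mem 0 l a) = 0 := fun a ha => by
          have := hu a (by omega)
          simpa only [Q2 a ha] using this
        rcases Nat.lt_succ_iff_lt_or_eq.1 ha with h | h
        · exact ispan u hu' a h
        · have h2 := hu k (by omega)
          rw [pspan u hu'] at h2
          rw [h, ← h2]
          exact ip_congr (fun _ _ => rfl) fun l _ => (inew l k le_rfl).1.symm
      · have : k * (8 + 9 * σ.reg 1 + 3 * σ.reg 0) ≤ σ.reg 0 * (8 + 9 * σ.reg 1 + 3 * σ.reg 0) :=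
          Nat.mul_le_mul_right _ hk.le
        omega)
  refine ⟨h.1, ?_⟩
  have := h.2
  simp only [orthogonalizeProgram]
  calc _ ≤ _ := this
    _ = _ := by ring

/-- Solves the least-squares problem for all right-hand sides once array 0 is orthogonalized. -/
def projectResponsesProgram : Program := .loop 3 2 (sweepProgram .add 1 2 0 3)

theorem projectResponsesProgram_spec {σ : State} (h6 : σ.reg 6 = 0)
    (h2 : ∀ l j, σ.mem 2 l j = 0) {C : ℕ → ℕ → ℝ}
    (hQ : ∀ a < σ.reg 0, ∀ l < σ.reg 1,
      ip (σ.reg 0) (C l) (fun b => σ.mem 3 b a) = σ.mem 0 l a)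
    (horth : ∀ a < σ.reg 0, ∀ b < σ.reg 0, a ≠ b →
      ip (σ.reg 1) (fun l => σ.mem 0 l a) (fun l => σ.mem 0 l b) = 0) :
    (∀ k < σ.reg 2,
      (∀ a < σ.reg 0, ip (σ.reg 1) (fun l => σ.mem 0 l a)
        (fun l => (projectResponsesProgram.run σ).1.mem 1 l k) = 0) ∧
      ∀ l < σ.reg 1, (projectResponsesProgram.run σ).1.mem 1 l k +
        ip (σ.reg 0) (C l) (fun b => (projectResponsesProgram.run σ).1.mem 2 b k) =
          σ.mem 1 l k) ∧
    (projectResponsesProgram.run σ).2 ≤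
      1 + σ.reg 2 * (2 + σ.reg 0 * (8 + 9 * σ.reg 1 + 3 * σ.reg 0)) := by
  have h := Program.run_loop_induction (x := 3) (y := 2) (σ := σ)
    (c := 1 + σ.reg 0 * (8 + 9 * σ.reg 1 + 3 * σ.reg 0))
    (p := sweepProgram .add 1 2 0 3)
    (Inv := fun k τ => (∀ x, x ≠ 3 → x ≠ 4 → x ≠ 5 → τ.reg x = σ.reg x) ∧
      (∀ b, b ≠ 1 → b ≠ 2 → b ≠ 4 → b ≠ 5 → b ≠ 6 → τ.mem b = σ.mem b) ∧
      (∀ l a, k ≤ a → τ.mem 1 l a = σ.mem 1 l a ∧ τ.mem 2 l a = 0) ∧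
      ∀ p < k, (∀ a < σ.reg 0, ip (σ.reg 1) (fun l => σ.mem 0 l a)
          (fun l => τ.mem 1 l p) = 0) ∧
        ∀ l < σ.reg 1, τ.mem 1 l p + ip (σ.reg 0) (C l) (fun b => τ.mem 2 b p) = σ.mem 1 l p)
    ⟨fun _ _ _ _ => rfl, fun _ _ _ _ _ _ => rfl, fun l a _ => ⟨rfl, h2 l a⟩,
      fun _ h => absurd h (by simp)⟩
    (fun k hk τ ⟨ir, im, inew, idone⟩ => by
      set τ1 := τ.setReg 3 k with hτ1
      have r13 : τ1.reg 3 = k := by simp [hτ1, State.setReg]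
      have r1 : ∀ x, x ≠ 3 → x ≠ 4 → x ≠ 5 → τ1.reg x = σ.reg x := fun x hx3 hx4 hx5 => by
        simp [hτ1, State.setReg, hx3, ir x hx3 hx4 hx5]
      have m1 : ∀ b, τ1.mem b = τ.mem b := fun _ => rfl
      have r10 := r1 0 (by simp) (by simp) (by simp)
      have r11 := r1 1 (by simp) (by simp) (by simp)
      have m0 := im 0 (by simp) (by simp) (by simp) (by simp) (by simp)
      have m3 := im 3 (by simp) (by simp) (by simp) (by simp) (by simp)
      have hsweep := sweepProgram_spec (op := .add) (ra := 1) (va := 2) (y := 0) (c := 3) (s := 1)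
        (fun a b => by simp [Op.eval]) (by ring) (by simp) (by simp) (by simp)
        (by simp) (by simp) (σ := τ1) (by rw [r1 6 (by simp) (by simp) (by simp), h6])
        (by simp) (by simp) (C := C)
        (by rw [r10, r11, m1, m1, m0, m3]; exact hQ)
        (by rw [r10, r11, m1, m0]; exact horth)
      obtain ⟨⟨pr, pm, pra, pva, porth, peq, -⟩, pt⟩ := hsweep
      simp only [r13, r11, r10, m1, m0] at pra pva porth peq pt
      set τ2 := ((sweepProgram .add 1 2 0 3).run τ1).1 with hτ2
      refine ⟨⟨fun x hx3 hx4 hx5 => ?_, fun b h1 h2 h4 h5 h6 => ?_, fun l a ha => ?_,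
        fun p hp => ?_⟩, by omega⟩
      · rw [pr x hx4 hx5, r1 x hx3 hx4 hx5]
      · rw [pm b h1 h2 h4 h5 h6, m1, im b h1 h2 h4 h5 h6]
      · rw [pra l a (by omega), pva l a (by omega)]
        exact inew l a (by omega)
      · rcases Nat.lt_succ_iff_lt_or_eq.1 hp with h | h
        · simp only [pra _ p h.ne, pva _ p h.ne]
          exact idone p h
        · subst h
          refine ⟨porth, fun l hl => ?_⟩
          have := peq l hl
          have e : ip (σ.reg 0) (C l) (fun b => τ.mem 2 b p) = 0 :=
            Finset.sum_eq_zero fun b _ => by simp only [(inew b p le_rfl).2, mul_zero]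
          rw [e, (inew l p le_rfl).1] at this
          linarith)
  refine ⟨h.1.2.2.2, ?_⟩
  have := h.2
  simp only [projectResponsesProgram]
  calc _ ≤ _ := this
    _ = _ := by ring

/-- Least squares for many right-hand sides by orthogonalization without normalization. -/
def leastSquaresProgram : Program := .seq orthogonalizeProgram projectResponsesProgram

theorem ip_eq_dotProduct (m : ℕ) (u v : ℕ → ℝ) :
    ip m u v = (fun i : Fin m => u i) ⬝ᵥ (fun i : Fin m => v i) :=
  Finset.sum_range fun l => u l * v l

theorem leastSquaresProgram_spec {m n M : ℕ} (C : Matrix (Fin m) (Fin n) ℝ)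
    (R : Matrix (Fin m) (Fin M) ℝ) :
    (∀ k, IsLeastSquares C (fun i => R i k) (leastSquaresProgram.output C R k)) ∧
    leastSquaresProgram.steps C R ≤ 2 + n * (3 + n * (8 + 9 * m + 3 * n)) +
      M * (2 + n * (8 + 9 * m + 3 * n)) := by
  set σ := inputState C R with hσ
  have reg0 : σ.reg 0 = n := by simp [hσ, inputState]
  have reg1 : σ.reg 1 = m := by simp [hσ, inputState]
  have reg2 : σ.reg 2 = M := by simp [hσ, inputState]
  have reg6 : σ.reg 6 = 0 := by simp [hσ, inputState]
  have mem0 : ∀ (i : Fin m) (j : Fin n), σ.mem 0 i j = C i j := by simp [hσ, inputState]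
  have mem1 : ∀ (i : Fin m) (k : Fin M), σ.mem 1 i k = R i k := by simp [hσ, inputState]
  obtain ⟨⟨pr, pm, -, peq, porth, pspan⟩, pt⟩ := orthogonalizeProgram_spec reg6
    (by simp [hσ, inputState])
  set τ := (orthogonalizeProgram.run σ).1 with hτ
  have tr : ∀ x, x ≠ 3 → x ≠ 4 → x ≠ 5 → τ.reg x = σ.reg x := pr
  have t0 : τ.reg 0 = n := by rw [tr 0 (by simp) (by simp) (by simp), reg0]
  have t1 : τ.reg 1 = m := by rw [tr 1 (by simp) (by simp) (by simp), reg1]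
  have t2 : τ.reg 2 = M := by rw [tr 2 (by simp) (by simp) (by simp), reg2]
  rw [reg0, reg1] at peq porth pspan pt
  have hresp := projectResponsesProgram_spec (σ := τ)
    (by rw [tr 6 (by simp) (by simp) (by simp), reg6])
    (by rw [pm 2 (by simp) (by simp) (by simp) (by simp) (by simp)]; simp [hσ, inputState])
    (C := σ.mem 0) (by rw [t0, t1]; exact peq) (by rw [t0, t1]; exact porth)
  rw [t0, t1, t2, pm 1 (by simp) (by simp) (by simp) (by simp) (by simp)] at hresp
  obtain ⟨hsol, ht⟩ := hresp
  have hsteps : leastSquaresProgram.steps C R =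
    (orthogonalizeProgram.run σ).2 + (projectResponsesProgram.run τ).2 := rfl
  refine ⟨fun k => ?_, by rw [hsteps]; omega⟩
  obtain ⟨h1, h2⟩ := hsol k k.2
  set ρ := fun l => (projectResponsesProgram.run τ).1.mem 1 l k with hρ
  have hx : leastSquaresProgram.output C R k =
    fun i : Fin n => (projectResponsesProgram.run τ).1.mem 2 i k := rfl
  rw [isLeastSquares_iff]
  have hres : C *ᵥ leastSquaresProgram.output C R k - (fun i => R i k) =
      fun i : Fin m => -ρ i := by
    ext i
    have h := h2 i i.2
    rw [ip_eq_dotProduct, mem1] at h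
    simp only [mem0] at h
    have e : (C *ᵥ leastSquaresProgram.output C R k) i =
      (fun j : Fin n => C i j) ⬝ᵥ fun j : Fin n =>
        (projectResponsesProgram.run τ).1.mem 2 j k := rfl
    rw [Pi.sub_apply, e]
    linarith
  have hcol : ∀ j : Fin n, (fun i : Fin m => -ρ i) ⬝ᵥ (fun i => C i j) = 0 := by
    intro j
    have h := pspan ρ (fun a ha => by rw [ip_comm]; exact h1 a ha) j j.2
    rw [ip_eq_dotProduct] at h
    simp only [mem0] at h
    have e : (fun i : Fin m => -ρ i) = -(fun i : Fin m => ρ i) := rfl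
    rw [e, neg_dotProduct, h, neg_zero]
  intro y
  rw [hres, dotProduct_mulVec]
  have : (fun i : Fin m => -ρ i) ᵥ* C = 0 := by
    ext j
    exact hcol j
  rw [this, zero_dotProduct]

end LeastSquaresProgram

section OpticalPUF

variable {N M n : ℕ} {α : Fin n → Fin N → ℕ}

theorem exists_eq_add_of_sum_le_two (a : Fin N → ℕ) (ha : ∑ j, a j ≤ 2) :
    ∃ o : Option (Fin N) × Option (Fin N),
      a = (o.1.elim 0 fun j => Pi.single j 1) + o.2.elim 0 fun j => Pi.single j 1 := by
  have peel : ∀ a : Fin N → ℕ, a ≠ 0 → ∃ (j : Fin N) (b : Fin N → ℕ),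
      a = Pi.single j 1 + b ∧ ∑ i, a i = 1 + ∑ i, b i := by
    intro a ha
    obtain ⟨j, hj⟩ := Function.ne_iff.1 ha
    have e : a = Pi.single j 1 + (a - Pi.single j 1) := by
      ext i
      by_cases h : i = j
      · subst h
        simp only [Pi.zero_apply] at hj
        simp
        omega
      · simp [h]
    refine ⟨j, _, e, ?_⟩
    conv_lhs => rw [e]
    simp [Finset.sum_add_distrib]
  have zero : ∀ a : Fin N → ℕ, ∑ i, a i = 0 → a = 0 := by
    intro a h
    ext i
    exact Finset.sum_eq_zero_iff.1 h i (Finset.mem_univ i)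
  by_cases h0 : a = 0
  · exact ⟨(none, none), by simp [h0]⟩
  obtain ⟨j, b, hab, hsum⟩ := peel a h0
  by_cases hb : b = 0
  · exact ⟨(some j, none), by simp [hab, hb]⟩
  obtain ⟨l, c, hbc, hsum'⟩ := peel b hb
  have hc : c = 0 := zero c (by omega)
  exact ⟨(some j, some l), by simp [hab, hbc, hc]⟩

theorem IsQuadraticFeatures.card_le (hα : IsQuadraticFeatures α) : n ≤ (N + 1) ^ 2 := by
  choose o ho using fun i => exists_eq_add_of_sum_le_two (α i) (hα.degree_le i)
  have hinj : Function.Injective o := fun i j hij =>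
    hα.injective ((ho i).trans (hij ▸ (ho j).symm))
  have h := Fintype.card_le_of_injective o hinj
  simpa [sq] using h

theorem IsQuadraticFeatures.pos (hα : IsQuadraticFeatures α) : 0 < n :=
  hα.constant.choose.pos

theorem features_mem_cube {b : Fin N → ℝ} (hb : b ∈ cube (Fin N)) :
    features α b ∈ cube (Fin n) := fun _ =>
  ⟨Finset.prod_nonneg fun j _ => pow_nonneg (hb j).1 _,
    Finset.prod_le_one (fun j _ => pow_nonneg (hb j).1 _) fun j _ => pow_le_one₀ (hb j).1 (hb j).2⟩

theorem measurable_features : Measurable (features α) := by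
  refine measurable_pi_lambda _ fun i => ?_
  exact Finset.measurable_prod _ fun j _ => (measurable_pi_apply j).pow_const _

/-- The intensities are linear in the features. -/
theorem IsQuadraticFeatures.exists_intensity_eq (hα : IsQuadraticFeatures α)
    (T : Matrix (Fin M) (Fin N) ℂ) :
    ∃ s : Fin M → Fin n → ℝ, ∀ b k, intensity T b k = features α b ⬝ᵥ s k := by
  have hidx : ∀ j l : Fin N, ∃ i, α i = Pi.single j 1 + Pi.single l 1 := fun j l =>
    hα.quadratic _ (by simp [Finset.sum_add_distrib])
  choose idx hidx using hidx
  have hfeat : ∀ b j l, features α b (idx j l) = b j * b l := by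
    intro b j l
    simp only [features, hidx, Pi.add_apply, pow_add, Finset.prod_mul_distrib]
    simp [Pi.single_apply]
  refine ⟨fun k => ∑ j, ∑ l, ((T k j).re * (T k l).re + (T k j).im * (T k l).im) •
    Pi.single (idx j l) 1, fun b k => ?_⟩
  have hnorm : intensity T b k = (∑ j, b j * (T k j).re) ^ 2 + (∑ j, b j * (T k j).im) ^ 2 := by
    rw [intensity, ← Complex.normSq_eq_norm_sq, Complex.normSq_apply, Complex.re_sum,
      Complex.im_sum]
    simp [sq]
  rw [hnorm, sq, sq, Finset.sum_mul_sum, Finset.sum_mul_sum, ← Finset.sum_add_distrib,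
    dotProduct_sum]
  refine Finset.sum_congr rfl fun j _ => ?_
  rw [← Finset.sum_add_distrib, dotProduct_sum]
  refine Finset.sum_congr rfl fun l _ => ?_
  rw [dotProduct_smul, dotProduct_single_one, hfeat, smul_eq_mul]
  ring

theorem IsSample.map_challenge {Ω : Type*} [MeasurableSpace Ω] {P : Measure Ω}
    {X Y : Type*} [MeasurableSpace X] [MeasurableSpace Y] {m : ℕ} {law : Measure X}
    {g : X → Y} (hg : Measurable g) {f : Y → Fin M → ℝ} {f' : X → Fin M → ℝ}
    (hf : ∀ x k, f' x k = f (g x) k) {τ : ℝ}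
    {x : Fin m → Ω → X} {r : Fin m → Ω → Fin M → ℝ} (h : IsSample P law f' τ x r) :
    IsSample P (law.map g) f τ (fun i ω => g (x i ω)) r where
  hasLaw i := by
    refine ⟨hg.comp_aemeasurable (h.hasLaw i).aemeasurable, ?_⟩
    rw [← (h.hasLaw i).map_eq,
      AEMeasurable.map_map_of_aemeasurable hg.aemeasurable (h.hasLaw i).aemeasurable]
    rfl
  indep := h.indep.comp _ fun _ => hg
  noise_subgaussian i k := by simpa only [hf] using h.noise_subgaussian i k
  noise_indep k := by simpa only [hf] using h.noise_indep k
  noise_indep_challenge k := by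
    have h1 := (h.noise_indep_challenge k).comp
      (φ := fun (y : Fin m → X) i => g (y i)) (ψ := id)
      (measurable_pi_lambda _ fun i => hg.comp (measurable_pi_apply i)) measurable_id
    simpa only [hf] using! h1

theorem ae_map_features_mem_cube {ν : Measure (Fin N → ℝ)} (hν : ∀ᵐ b ∂ν, b ∈ cube (Fin N)) :
    ∀ᵐ c ∂(ν.map (features α)), c ∈ cube (Fin n) := by
  have hms : MeasurableSet (cube (Fin n)) := by
    simp only [cube, Set.ofPred_forall]
    refine MeasurableSet.iInter fun i => ?_
    exact (measurableSet_le measurable_const (measurable_pi_apply i)).inter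
      (measurableSet_le (measurable_pi_apply i) measurable_const)
  exact (ae_map_iff measurable_features.aemeasurable hms).2
    (hν.mono fun b hb => features_mem_cube hb)

theorem leastSquaresProgram_learns (hα : IsQuadraticFeatures α) {ν : Measure (Fin N → ℝ)}
    [IsProbabilityMeasure ν] (hν : ∀ᵐ b ∂ν, b ∈ cube (Fin N)) {ξ τ ε δ : ℝ}
    (hξ : IsSmallestNonzeroEigenvalue (secondMoment (ν.map (features α))) ξ) (hM : 1 ≤ M)
    (hτ : 0 < τ) (hε : 0 < ε) (hδ : 0 < δ) (hδ1 : δ < 1) (T : Matrix (Fin M) (Fin N) ℂ) {m : ℕ}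
    (hm : sampleBound n M ξ τ ε δ ≤ m) : Learns.{u} leastSquaresProgram α ν T τ ε δ m := by
  intro Ω _ P _ b r hsample
  have := Measure.isProbabilityMeasure_map (μ := ν) (measurable_features (α := α)).aemeasurable
  obtain ⟨s, hs⟩ := hα.exists_intensity_eq T
  obtain ⟨O, lam, hO, hdiag⟩ := exists_diagonalization (ν.map (features α))
  obtain ⟨E, hE, hPE, h⟩ := leastSquares_accuracy (ae_map_features_mem_cube hν) hξ hM hτ hε hδ hδ1
    hm hO hdiag s (hsample.map_challenge measurable_features (f := fun x k => x ⬝ᵥ s k) hs)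
  refine ⟨E, hE, hPE, fun ω hω x hx hvis k => ?_⟩
  rw [hs]
  exact (h ω hω).2 k _ (.inr ((leastSquaresProgram_spec _ _).1 k)) _ (features_mem_cube hx) hvis

end OpticalPUF

section Asymptotics

variable {N M n m : ℕ} {ξ τ ε δ κ : ℝ}

theorem sampleBound_le_of_log_le {L n' : ℝ} (hn : (n : ℝ) ≤ n') (hξ : 0 < ξ) (hL : 0 ≤ L)
    (h1 : Real.log (2 * M * n / δ) ≤ L) (h2 : Real.log (4 * M * n / δ) ≤ L) :
    sampleBound n M ξ τ ε δ ≤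
      8 * n' / ξ * L + 4 * n' ^ 2 * τ ^ 2 / (ε ^ 2 * ξ) * L := by
  have hn' : 0 ≤ n' := (Nat.cast_nonneg n).trans hn
  refine max_le ?_ ?_
  · calc _ ≤ 8 * n / ξ * L := by gcongr
      _ ≤ 8 * n' / ξ * L := by gcongr
      _ ≤ _ := le_add_of_nonneg_right (by positivity)
  · calc _ ≤ 4 * n ^ 2 * τ ^ 2 / (ε ^ 2 * ξ) * L := by gcongr
      _ ≤ 4 * n' ^ 2 * τ ^ 2 / (ε ^ 2 * ξ) * L := by gcongr
      _ ≤ _ := le_add_of_nonneg_left (by positivity)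

theorem one_le_log_of_four_le {X : ℝ} (hX : 4 ≤ X) : 1 ≤ Real.log X := by
  rw [Real.le_log_iff_exp_le (by linarith)]
  linarith [Real.exp_one_lt_d9]

theorem log_le_three_mul_log {X y : ℝ} (hX : 4 ≤ X) (hy0 : 0 < y) (hy : y ≤ 16 * X) :
    Real.log y ≤ 3 * Real.log X := by
  have : 3 * Real.log X = Real.log (X ^ 3) := by rw [Real.log_pow]; norm_num
  rw [this]
  refine Real.log_le_log hy0 (hy.trans ?_)
  have : 16 ≤ X ^ 2 := by nlinarith
  calc 16 * X ≤ X ^ 2 * X := by gcongr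
    _ = X ^ 3 := by ring

/-- `N ^ 4 τ² / (ε² ξ) ln (M N² / δ)`. -/
noncomputable def sampleRate (N M : ℕ) (ξ τ ε δ : ℝ) : ℝ :=
  N ^ 4 * τ ^ 2 / (ε ^ 2 * ξ) * Real.log (M * N ^ 2 / δ)

theorem four_le_div (hN : 2 ≤ N) (hM : 1 ≤ M) (hδ : 0 < δ) (hδ1 : δ < 1) :
    (4 : ℝ) ≤ M * N ^ 2 / δ := by
  have hN' : (2 : ℝ) ≤ N := by exact_mod_cast hN
  have hM' : (1 : ℝ) ≤ M := by exact_mod_cast hM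
  rw [le_div_iff₀ hδ]
  nlinarith [mul_le_mul hM' (pow_le_pow_left₀ (by norm_num) hN' 2) (by norm_num) (by positivity)]

theorem sq_div_le_sampleRate (hN : 2 ≤ N) (hM : 1 ≤ M) (hξ : 0 < ξ) (hε : 0 < ε)
    (hδ : 0 < δ) (hδ1 : δ < 1) (hκ : ε ≤ κ * N * τ) :
    N ^ 2 / ξ * Real.log (M * N ^ 2 / δ) ≤ κ ^ 2 * sampleRate N M ξ τ ε δ := by
  have hl := one_le_log_of_four_le (four_le_div hN hM hδ hδ1)
  have h1 : 1 ≤ κ ^ 2 * N ^ 2 * τ ^ 2 / ε ^ 2 := by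
    rw [le_div_iff₀ (by positivity), one_mul]
    calc ε ^ 2 ≤ (κ * N * τ) ^ 2 := by gcongr
      _ = _ := by ring
  calc N ^ 2 / ξ * Real.log (M * N ^ 2 / δ) =
        N ^ 2 / ξ * Real.log (M * N ^ 2 / δ) * 1 := by ring
    _ ≤ N ^ 2 / ξ * Real.log (M * N ^ 2 / δ) * (κ ^ 2 * N ^ 2 * τ ^ 2 / ε ^ 2) := by gcongr
    _ = _ := by rw [sampleRate]; field_simp

theorem ceil_sampleBound_le (hN : 2 ≤ N) (hM : 1 ≤ M) (hn0 : 0 < n) (hn : (n : ℝ) ≤ 4 * N ^ 2)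
    (hξ : 0 < ξ) (hξn : ξ ≤ n) (hε : 0 < ε) (hδ : 0 < δ) (hδ1 : δ < 1)
    (hκ : ε ≤ κ * N * τ) :
    (⌈sampleBound n M ξ τ ε δ⌉₊ : ℝ) ≤ (100 * κ ^ 2 + 192) * sampleRate N M ξ τ ε δ := by
  have hX := four_le_div hN hM hδ hδ1
  have hl := one_le_log_of_four_le hX
  have hN' : (2 : ℝ) ≤ N := by exact_mod_cast hN
  have hM' : (1 : ℝ) ≤ M := by exact_mod_cast hM
  have hn' : (1 : ℝ) ≤ n := by exact_mod_cast hn0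
  have hlog1 : Real.log (2 * M * n / δ) ≤ 3 * Real.log (M * N ^ 2 / δ) := by
    refine log_le_three_mul_log hX (by positivity) ?_
    rw [mul_div_assoc', div_le_div_iff_of_pos_right hδ]
    nlinarith
  have hlog2 : Real.log (4 * M * n / δ) ≤ 3 * Real.log (M * N ^ 2 / δ) := by
    refine log_le_three_mul_log hX (by positivity) ?_
    rw [mul_div_assoc', div_le_div_iff_of_pos_right hδ]
    nlinarith
  have hb := sampleBound_le_of_log_le (τ := τ) (ε := ε) hn hξ (by linarith) hlog1 hlog2
  have hrate := sq_div_le_sampleRate hN hM hξ hε hδ hδ1 hκ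
  have hpos := sampleBound_pos (τ := τ) (ε := ε) hn0 hM hξ hδ hδ1
  have hceil := (Nat.ceil_lt_add_one hpos.le).le
  have h1 : 1 ≤ 4 * (N ^ 2 / ξ * Real.log (M * N ^ 2 / δ)) := by
    have h2 : 1 ≤ 4 * (N ^ 2 / ξ) := by
      rw [mul_div_assoc', le_div_iff₀ hξ]; linarith
    nlinarith
  have e1 : 8 * (4 * N ^ 2) / ξ * (3 * Real.log (M * N ^ 2 / δ)) =
      96 * (N ^ 2 / ξ * Real.log (M * N ^ 2 / δ)) := by ring
  have e2 : 4 * (4 * N ^ 2) ^ 2 * τ ^ 2 / (ε ^ 2 * ξ) * (3 * Real.log (M * N ^ 2 / δ)) =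
      192 * sampleRate N M ξ τ ε δ := by rw [sampleRate]; ring
  rw [e1, e2] at hb
  linarith

theorem card_le_sampleRate (hN : 2 ≤ N) (hM : 1 ≤ M) (hn : (n : ℝ) ≤ 4 * N ^ 2)
    (hξ : 0 < ξ) (hξn : ξ ≤ n) (hε : 0 < ε) (hδ : 0 < δ) (hδ1 : δ < 1)
    (hκ : ε ≤ κ * τ) : (n : ℝ) ≤ 16 * κ ^ 2 * sampleRate N M ξ τ ε δ := by
  have hl := one_le_log_of_four_le (four_le_div hN hM hδ hδ1)
  have hN' : (2 : ℝ) ≤ N := by exact_mod_cast hN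
  have h1 : 1 ≤ κ ^ 2 * τ ^ 2 / ε ^ 2 := by
    rw [le_div_iff₀ (by positivity), one_mul]
    calc ε ^ 2 ≤ (κ * τ) ^ 2 := by gcongr
      _ = _ := by ring
  have h2 : 1 ≤ 4 * N ^ 2 / ξ := by
    rw [le_div_iff₀ hξ]; linarith
  calc (n : ℝ) ≤ 4 * N ^ 2 * 1 * 1 * 1 := by linarith
    _ ≤ 4 * N ^ 2 * (4 * N ^ 2 / ξ) * (κ ^ 2 * τ ^ 2 / ε ^ 2) *
        Real.log (M * N ^ 2 / δ) := by gcongr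
    _ = _ := by rw [sampleRate]; field_simp; ring

theorem steps_le_of_le {n m M : ℕ} {A k : ℝ} (hn0 : 0 < n) (hm0 : 0 < m)
    (hm : (m : ℝ) ≤ k * A) (hn : (n : ℝ) ≤ 16 * κ ^ 2 * A) {N : ℝ} (hN : (n : ℝ) ≤ 4 * N ^ 2) :
    (2 + n * (3 + n * (8 + 9 * m + 3 * n)) + M * (2 + n * (8 + 9 * m + 3 * n)) : ℝ) ≤
      32 * (17 * k + 48 * κ ^ 2) * ((N ^ 4 + M * N ^ 2) * A) := by
  have hn' : (1 : ℝ) ≤ n := by exact_mod_cast hn0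
  have hm' : (1 : ℝ) ≤ m := by exact_mod_cast hm0
  have hM' : (0 : ℝ) ≤ M := Nat.cast_nonneg M
  set T : ℝ := 8 + 9 * m + 3 * n with hT
  have hT1 : 20 ≤ T := by linarith
  have hTA : T ≤ (17 * k + 48 * κ ^ 2) * A := by linarith
  have h1 : 2 + 3 * (n : ℝ) ≤ n * n * T := by nlinarith [mul_le_mul hn' hn' zero_le_one (by linarith)]
  have h2 : 2 * (M : ℝ) ≤ M * (n * T) := by
    rw [mul_comm]
    exact mul_le_mul_of_nonneg_left (by nlinarith) hM'
  have h3 : (n : ℝ) * n ≤ 16 * N ^ 4 := by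
    calc (n : ℝ) * n ≤ (4 * N ^ 2) * (4 * N ^ 2) := by gcongr
      _ = _ := by ring
  have h4 : (M : ℝ) * n ≤ M * (4 * N ^ 2) := by gcongr
  have h5 : 0 ≤ (M : ℝ) * N ^ 2 := by positivity
  calc (2 + n * (3 + n * T) + M * (2 + n * T) : ℝ) ≤ 2 * ((n * n + M * n) * T) := by linarith
    _ ≤ 2 * ((16 * (N ^ 4 + M * N ^ 2)) * T) := by gcongr; linarith
    _ ≤ 2 * ((16 * (N ^ 4 + M * N ^ 2)) * ((17 * k + 48 * κ ^ 2) * A)) := by gcongr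
    _ = _ := by ring

theorem card_le_four_mul_sq (hN : 1 ≤ N) (hn : n ≤ (N + 1) ^ 2) : (n : ℝ) ≤ 4 * N ^ 2 := by
  have hN' : (1 : ℝ) ≤ N := by exact_mod_cast hN
  have : (n : ℝ) ≤ ((N + 1) ^ 2 : ℕ) := by exact_mod_cast hn
  push_cast at this
  nlinarith

end Asymptotics

section PAC

/-- A polynomial bound for the sufficient number of samples, in terms of `N`, `M`, `1/ε`, `1/δ`,
`τ`, `1/ξ`. -/
noncomputable def pacSamples {R : Type*} [CommSemiring R] (x : Fin 6 → R) : R :=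
  8 * (x 0 + 1) ^ 2 * x 5 * (4 * (x 1 + 1) * (x 0 + 1) ^ 2 * x 3) +
    4 * ((x 0 + 1) ^ 2) ^ 2 * x 4 ^ 2 * x 2 ^ 2 * x 5 * (4 * (x 1 + 1) * (x 0 + 1) ^ 2 * x 3) + 1

/-- A polynomial bound for the running time on that number of samples. -/
noncomputable def pacSteps {R : Type*} [CommSemiring R] (x : Fin 6 → R) : R :=
  2 + (x 0 + 1) ^ 2 * (3 + (x 0 + 1) ^ 2 * (8 + 9 * pacSamples x + 3 * (x 0 + 1) ^ 2)) +
    x 1 * (2 + (x 0 + 1) ^ 2 * (8 + 9 * pacSamples x + 3 * (x 0 + 1) ^ 2))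

theorem pacSamples_nonneg {x : Fin 6 → ℝ} (hx : ∀ i, 0 ≤ x i) : 0 ≤ pacSamples x := by
  have h0 := hx 0
  have h1 := hx 1
  have h2 := hx 2
  have h3 := hx 3
  have h4 := hx 4
  have h5 := hx 5
  unfold pacSamples
  positivity

theorem pacSteps_nonneg {x : Fin 6 → ℝ} (hx : ∀ i, 0 ≤ x i) : 0 ≤ pacSteps x := by
  have h0 := hx 0
  have h1 := hx 1
  have := pacSamples_nonneg hx
  unfold pacSteps
  positivity

theorem sampleBound_add_one_le_pacSamples {N M n : ℕ} {ξ τ ε δ : ℝ} (hM : 1 ≤ M) (hn0 : 0 < n)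
    (hn : n ≤ (N + 1) ^ 2) (hξ : 0 < ξ) (hδ : 0 < δ) :
    sampleBound n M ξ τ ε δ + 1 ≤ pacSamples ![(N : ℝ), (M : ℝ), 1 / ε, 1 / δ, τ, 1 / ξ] := by
  have hn' : (n : ℝ) ≤ (N + 1) ^ 2 := by exact_mod_cast hn
  have hn1 : (0 : ℝ) < n := by exact_mod_cast hn0
  have hM1 : (0 : ℝ) < M := by exact_mod_cast hM
  have hL2 : Real.log (4 * M * n / δ) ≤ 4 * (M + 1) * (N + 1) ^ 2 * (1 / δ) := by
    refine (Real.log_le_self (by positivity)).trans ?_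
    rw [mul_one_div]
    gcongr
    linarith
  have hL1 : Real.log (2 * M * n / δ) ≤ 4 * (M + 1) * (N + 1) ^ 2 * (1 / δ) := by
    refine (Real.log_le_log (by positivity) ?_).trans hL2
    gcongr
    norm_num
  have h := sampleBound_le_of_log_le (τ := τ) (ε := ε) hn' hξ (by positivity) hL1 hL2
  calc _ ≤ _ := add_le_add_left h 1
    _ = _ := by
      simp only [pacSamples, Matrix.cons_val]
      ring

theorem leastSquaresProgram_isEfficientPACLearner :
    IsEfficientPACLearner.{u} leastSquaresProgram := by
  refine ⟨pacSamples MvPolynomial.X + pacSteps MvPolynomial.X, fun N M ε δ τ ξ hε hδ hδ1 hτ hξ => ?_⟩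
  set x : Fin 6 → ℝ := ![(N : ℝ), (M : ℝ), 1 / ε, 1 / δ, τ, 1 / ξ] with hx
  have hx0 : ∀ i, 0 ≤ x i := by
    intro i
    fin_cases i <;> simp [hx] <;> positivity
  have heval : MvPolynomial.eval x (pacSamples MvPolynomial.X + pacSteps MvPolynomial.X) =
      pacSamples x + pacSteps x := by
    simp [pacSamples, pacSteps]
  have hs := pacSamples_nonneg hx0
  have ht := pacSteps_nonneg hx0
  rw [heval]
  have hfloor := Nat.floor_le hs
  refine ⟨⌊pacSamples x⌋₊, by linarith, fun n α hα => ⟨fun C R => ?_, fun ν _ hν hev T => ?_⟩⟩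
  · have hn : (n : ℝ) ≤ (N + 1) ^ 2 := by exact_mod_cast hα.card_le
    have h : (leastSquaresProgram.steps C R : ℝ) ≤
        (2 + n * (3 + n * (8 + 9 * ⌊pacSamples x⌋₊ + 3 * n)) +
          M * (2 + n * (8 + 9 * ⌊pacSamples x⌋₊ + 3 * n)) : ℝ) := by
      exact_mod_cast (leastSquaresProgram_spec C R).2
    have h2 : (2 + n * (3 + n * (8 + 9 * ⌊pacSamples x⌋₊ + 3 * n)) +
          M * (2 + n * (8 + 9 * ⌊pacSamples x⌋₊ + 3 * n)) : ℝ) ≤ pacSteps x := by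
      have e0 : x 0 = N := rfl
      have e1 : x 1 = M := rfl
      rw [pacSteps, e0, e1]
      gcongr
    linarith
  · rcases Nat.eq_zero_or_pos M with rfl | hM
    · intro Ω _ P _ b r _
      refine ⟨Set.univ, MeasurableSet.univ, ?_, fun _ _ _ _ _ k => k.elim0⟩
      rw [measure_univ]
      exact ENNReal.ofReal_le_one.2 (by linarith)
    · refine leastSquaresProgram_learns hα hν hev hM hτ hε hδ hδ1 T ?_
      have h := sampleBound_add_one_le_pacSamples (τ := τ) (ε := ε) hM hα.pos hα.card_le hξ hδ
      have := Nat.lt_floor_add_one (pacSamples x)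
      linarith

end PAC

theorem leastSquaresProgram_asymptotics {κ : ℝ} {N M n : ℕ} {α : Fin n → Fin N → ℕ}
    {ν : Measure (Fin N → ℝ)} [IsProbabilityMeasure ν] {ξ τ ε δ : ℝ} (hκ : 0 < κ) (hN : 2 ≤ N)
    (hM : 1 ≤ M) (hα : IsQuadraticFeatures α) (hν : ∀ᵐ b ∂ν, b ∈ cube (Fin N))
    (hξ : IsSmallestNonzeroEigenvalue (secondMoment (ν.map (features α))) ξ)
    (hτ : 0 < τ) (hε : 0 < ε) (hδ : 0 < δ) (hδ1 : δ < 1) :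
    (ε ≤ κ * N * τ → (⌈sampleBound n M ξ τ ε δ⌉₊ : ℝ) ≤
      (100 * κ ^ 2 + 192) * sampleRate N M ξ τ ε δ) ∧
    (ε ≤ κ * τ → ∀ (C : Matrix (Fin ⌈sampleBound n M ξ τ ε δ⌉₊) (Fin n) ℝ)
      (R : Matrix (Fin ⌈sampleBound n M ξ τ ε δ⌉₊) (Fin M) ℝ),
      (leastSquaresProgram.steps C R : ℝ) ≤
        32 * (17 * (100 * κ ^ 2 + 192) + 48 * κ ^ 2) *
          ((N ^ 4 + M * N ^ 2) * sampleRate N M ξ τ ε δ)) := by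
  have := Measure.isProbabilityMeasure_map (μ := ν) (measurable_features (α := α)).aemeasurable
  have hcube := ae_map_features_mem_cube (α := α) hν
  have hξ0 := smallestNonzeroEigenvalue_pos hcube hξ
  have hξn := smallestNonzeroEigenvalue_le_card hcube hξ
  have hn := card_le_four_mul_sq (by omega) hα.card_le
  have hm := fun h => ceil_sampleBound_le (κ := κ) hN hM hα.pos hn hξ0 hξn hε hδ hδ1
    (τ := τ) h
  refine ⟨hm, fun hεκ C R => ?_⟩
  have hN' : (1 : ℝ) ≤ N := by exact_mod_cast (by omega : 1 ≤ N)
  have hεκ' : ε ≤ κ * N * τ := by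
    calc ε ≤ κ * 1 * τ := by rwa [mul_one]
      _ ≤ κ * N * τ := by gcongr
  have hpos : 0 < ⌈sampleBound n M ξ τ ε δ⌉₊ :=
    Nat.ceil_pos.2 (sampleBound_pos hα.pos hM hξ0 hδ hδ1)
  refine le_trans ?_ (steps_le_of_le hα.pos hpos (hm hεκ')
    (card_le_sampleRate hN hM hn hξ0 hξn hε hδ hδ1 hεκ) hn)
  exact_mod_cast (leastSquaresProgram_spec C R).2

end PUF

theorem mainTheorem1 :
    -- the sufficient number of samples for the least-squares estimate
    (∀ (n M m : ℕ) (law : Measure (Fin n → ℝ)) (s : Fin M → Fin n → ℝ) (ξ τ ε δ : ℝ),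
      IsProbabilityMeasure law → (∀ᵐ c ∂law, c ∈ PUF.cube (Fin n)) →
      PUF.IsSmallestNonzeroEigenvalue (PUF.secondMoment law) ξ →
      1 ≤ M → 0 < τ → 0 < ε → 0 < δ → δ < 1 → PUF.sampleBound n M ξ τ ε δ ≤ m →
      (∀ᵐ c ∂law, c ∈ PUF.visible law) ∧
      ∀ (O : Matrix (Fin n) (Fin n) ℝ) (lam : Fin n → ℝ),
        O ∈ Matrix.orthogonalGroup (Fin n) ℝ →
        Oᵀ * PUF.secondMoment law * O = Matrix.diagonal lam →
        ∀ (Ω : Type u) [MeasurableSpace Ω] (P : Measure Ω) [IsProbabilityMeasure P]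
          (c : Fin m → Ω → Fin n → ℝ) (r : Fin m → Ω → Fin M → ℝ),
          PUF.IsSample P law (fun x k => x ⬝ᵥ s k) τ c r →
          ∃ E : Set Ω, MeasurableSet E ∧ ENNReal.ofReal (1 - δ) ≤ P E ∧
            ∀ ω ∈ E,
              IsUnit ((PUF.reduced (Matrix.of fun i => c i ω) O lam)ᵀ *
                PUF.reduced (Matrix.of fun i => c i ω) O lam) ∧
              ∀ (k : Fin M) (shat : Fin n → ℝ),
                (PUF.IsReducedEstimate (Matrix.of fun i => c i ω) O lam (fun i => r i ω k) shat ∨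
                  PUF.IsLeastSquares (Matrix.of fun i => c i ω) (fun i => r i ω k) shat) →
                ∀ x ∈ PUF.cube (Fin n), x ∈ PUF.visible law → |x ⬝ᵥ shat - x ⬝ᵥ s k| ≤ ε) ∧
    -- one algorithm that computes the estimate for all pixels
    ∃ p : PUF.Program,
      (∀ (m n M : ℕ) (C : Matrix (Fin m) (Fin n) ℝ) (R : Matrix (Fin m) (Fin M) ℝ) (k : Fin M),
        PUF.IsLeastSquares C (fun i => R i k) (p.output C R k)) ∧
      -- it learns the PUF, with the asymptotic bounds on the number of samples and the time
      (∀ κ : ℝ, 0 < κ → ∃ K : ℝ, 0 < K ∧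
        ∀ (N M n : ℕ) (α : Fin n → Fin N → ℕ) (ν : Measure (Fin N → ℝ)) (ξ τ ε δ : ℝ),
          2 ≤ N → 1 ≤ M → PUF.IsQuadraticFeatures α →
          IsProbabilityMeasure ν → (∀ᵐ b ∂ν, b ∈ PUF.cube (Fin N)) →
          PUF.IsSmallestNonzeroEigenvalue
            (PUF.secondMoment (ν.map (PUF.features α))) ξ →
          0 < τ → 0 < ε → 0 < δ → δ < 1 →
          (∀ (T : Matrix (Fin M) (Fin N) ℂ) (m : ℕ), PUF.sampleBound n M ξ τ ε δ ≤ m →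
            PUF.Learns.{u} p α ν T τ ε δ m) ∧
          (ε ≤ κ * N * τ →
            (⌈PUF.sampleBound n M ξ τ ε δ⌉₊ : ℝ) ≤
              K * (N ^ 4 * τ ^ 2 / (ε ^ 2 * ξ) * Real.log (M * N ^ 2 / δ))) ∧
          (ε ≤ κ * τ →
            ∀ (C : Matrix (Fin ⌈PUF.sampleBound n M ξ τ ε δ⌉₊) (Fin n) ℝ)
              (R : Matrix (Fin ⌈PUF.sampleBound n M ξ τ ε δ⌉₊) (Fin M) ℝ),
              (p.steps C R : ℝ) ≤
                K * ((N ^ 8 + M * N ^ 6) * τ ^ 2 / (ε ^ 2 * ξ) * Real.log (M * N ^ 2 / δ)) ∧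
              ((M : ℝ) ≤ κ * N ^ 2 →
                (p.steps C R : ℝ) ≤
                  K * (N ^ 8 * τ ^ 2 / (ε ^ 2 * ξ) * Real.log (M * N ^ 2 / δ))))) ∧
      PUF.IsEfficientPACLearner.{u} p := by
  refine ⟨?_, PUF.leastSquaresProgram, fun m n M C R => (PUF.leastSquaresProgram_spec C R).1, ?_,
    PUF.leastSquaresProgram_isEfficientPACLearner⟩
  · intro n M m law s ξ τ ε δ hlaw hcube hξ hM hτ hε hδ hδ1 hm
    refine ⟨PUF.ae_mem_visible hcube, fun O lam hO hdiag Ω _ P _ c r hsample => ?_⟩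
    exact PUF.leastSquares_accuracy hcube hξ hM hτ hε hδ hδ1 hm hO hdiag s hsample
  · intro κ hκ
    set K₁ : ℝ := 100 * κ ^ 2 + 192 with hK₁
    set K₂ : ℝ := 32 * (17 * K₁ + 48 * κ ^ 2) with hK₂
    have hK₁0 : 0 < K₁ := by positivity
    have hK₁₂ : K₁ ≤ K₂ := by nlinarith [sq_nonneg κ]
    have hK₂0 : 0 < K₂ := hK₁0.trans_le hK₁₂
    have hK : K₂ ≤ K₂ * (1 + κ) := by nlinarith
    refine ⟨K₂ * (1 + κ), by positivity,
      fun N M n α ν ξ τ ε δ hN hM hα hprob hν hξ hτ hε hδ hδ1 => ⟨fun T m hm =>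
        PUF.leastSquaresProgram_learns hα hν hξ hM hτ hε hδ hδ1 T hm, fun hεκ => ?_,
        fun hεκ C R => ?_⟩⟩
    all_goals
      obtain ⟨hsamples, hsteps⟩ :=
        PUF.leastSquaresProgram_asymptotics hκ hN hM hα hν hξ hτ hε hδ hδ1
      have hl := PUF.one_le_log_of_four_le (PUF.four_le_div hN hM hδ hδ1)
      have hξ0 : 0 < ξ := by
        have := MeasureTheory.Measure.isProbabilityMeasure_map (μ := ν)
          (PUF.measurable_features (α := α)).aemeasurable
        exact PUF.smallestNonzeroEigenvalue_pos (PUF.ae_map_features_mem_cube hν) hξ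
      have hrate0 : 0 ≤ PUF.sampleRate N M ξ τ ε δ := by
        unfold PUF.sampleRate
        positivity
    · exact (hsamples hεκ).trans (mul_le_mul_of_nonneg_right (hK₁₂.trans hK) hrate0)
    · have h : (PUF.leastSquaresProgram.steps C R : ℝ) ≤
          K₂ * ((N ^ 4 + M * N ^ 2) * PUF.sampleRate N M ξ τ ε δ) := hsteps hεκ C R
      have e : (N ^ 8 + M * N ^ 6) * τ ^ 2 / (ε ^ 2 * ξ) * Real.log (M * N ^ 2 / δ) =
          (N ^ 4 + M * N ^ 2) * PUF.sampleRate N M ξ τ ε δ := by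
        rw [PUF.sampleRate]; ring
      have e' : N ^ 8 * τ ^ 2 / (ε ^ 2 * ξ) * Real.log (M * N ^ 2 / δ) =
          N ^ 4 * PUF.sampleRate N M ξ τ ε δ := by
        rw [PUF.sampleRate]; ring
      rw [e, e']
      refine ⟨h.trans (mul_le_mul_of_nonneg_right hK (by positivity)), fun hMκ => h.trans ?_⟩
      rw [mul_assoc K₂]
      refine mul_le_mul_of_nonneg_left ?_ hK₂0.le
      rw [← mul_assoc]
      refine mul_le_mul_of_nonneg_right ?_ hrate0
      have : (M : ℝ) * N ^ 2 ≤ κ * N ^ 2 * N ^ 2 := by gcongr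
      linarith [show κ * (N : ℝ) ^ 2 * N ^ 2 = κ * N ^ 4 by ring]
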